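/- Let $U\subset\mathbb{R}^2$ be open, with coordinates $(X^1,X^2)$ and $\partial_a=\partial/\partial X^a$, and let $\lambda^1,\lambda^2:U\to\mathbb{R}$ be of class $C^6$ with $\lambda^1\neq\lambda^2$ everywhere on $U$. Put $$A=\frac{\partial_2\lambda^1}{\lambda^2-\lambda^1},\qquad B=\frac{\partial_1\lambda^2}{\lambda^1-\lambda^2},$$ assume that $A$ and $B$ have no zeros on $U$, and let $\nabla$ be the torsion-free affine connection on $U$ whose only non-zero Christoffel symbols are $$\Gamma^1_{11}=\partial_1\ln|A|-2B,\quad \Gamma^2_{22}=\partial_2\ln|B|-2A,\quad \Gamma^1_{12}=\Gamma^1_{21}=-\Big(\tfrac12\partial_2\ln|A|+A\Big),\quad \Gamma^2_{12}=\Gamma^2_{21}=-\Big(\tfrac12\partial_1\ln|B|+B\Big).$$ A linear first integral of $\nabla$ on an open set $W\subset U$ is a $C^1$ one-form $K=K_a\,dX^a$ on $W$ such that $K_a\dot X^a$ is constant along every affinely parametrised geodesic of $\nabla$ in $W$. A Hamiltonian formulation on $W$ of the system $$\partial_tX^1=\lambda^1(X)\,\partial_xX^1,\qquad \partial_tX^2=\lambda^2(X)\,\partial_xX^2$$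 is an operator $\Omega^{ab}=g^{ab}(X)\,\partial_x+b^{ab}_c(X)\,\partial_xX^c$ with $g^{ab},b^{ab}_c\in C^1(W)$, for which the bracket $\{F,G\}=\int_{\mathbb{R}}\frac{\delta F}{\delta X^a}\,\Omega^{ab}\,\frac{\delta G}{\delta X^b}\,dx$ on functionals of smooth maps $X:\mathbb{R}\to W$ is skew-symmetric and satisfies the Jacobi identity (tested on the functionals $F[X]=\int_{\mathbb{R}}\varphi(x,X(x))\,dx$ with $\varphi$ smooth and supported over a bounded range of $x$), and such that the system is $\partial_tX^a=\Omega^{ab}\,\delta H/\delta X^b$ for some $H[X]=\int\mathcal{H}(X)\,dx$ with $\mathcal{H}\in C^2(W)$. The matrix $g^{ab}$ is allowed to be degenerate; the formulation is called non-degenerate if $\det(g^{ab})$ has no zeros on $W$. Independence, of operators $\Omega$ or of first integrals $K$, means linear independence over $\mathbb{R}$ on $W$. Then, for every integer $n\ge0$: 1. For every open $W\subset U$: if the system admits $n$ independent Hamiltonian formulations on $W$, then $\nabla$ admits $n$ independent linear first integrals on $W$. 2. For every convex open $W\subset U$: the system admits $n$ independent non-degenerate Hamiltonian formulations on $W$ if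 and only if $\nabla$ admits $n$ independent linear first integrals on $W$, each with both components $K_1,K_2$ nowhere zero on $W$. 3. There is a dense open subset $G$ of $U$, not depending on $n$, such that every $p\in G$ has an open neighbourhood $V\subset U$, not depending on $n$, with the following property: for every convex open $W\subset V$, the system admits $n$ independent Hamiltonian formulations on $W$ if and only if $\nabla$ admits $n$ independent linear first integrals on $W$. Consequently the system admits exactly $n$ independent Hamiltonian formulations on $W$ if and only if $\nabla$ admits exactly $n$ independent linear first integrals on $W$; in particular this holds for $n=1,2,3$. -/

import Mathlib

open scoped ContDiff

noncomputable section

namespace Hydro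

/-- The coordinate plane of the Riemann invariants; the indices `1, 2` are `0, 1 : Fin 2` here. -/
abbrev Plane : Type := Fin 2 → ℝ

/-- The partial derivative `∂_a F` at `u`. -/
def pd (a : Fin 2) (F : Plane → ℝ) (u : Plane) : ℝ :=
  fderiv ℝ F u (Pi.single a 1)

/-! ### The connection attached to a diagonal system -/

/-- `A = ∂₂λ¹ / (λ² - λ¹)`. -/
def coefA (lam : Fin 2 → Plane → ℝ) (u : Plane) : ℝ :=
  pd 1 (lam 0) u / (lam 1 u - lam 0 u)

/-- `B = ∂₁λ² / (λ¹ - λ²)`. -/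
def coefB (lam : Fin 2 → Plane → ℝ) (u : Plane) : ℝ :=
  pd 0 (lam 1) u / (lam 0 u - lam 1 u)

/-- Christoffel symbols `Γ^c_{ab}` (arguments in the order `c a b`), symmetric in `a, b`.
`Real.log x` is `log |x|`, so `∂_a ln A` is the logarithmic derivative for either sign of `A`. -/
def christoffel (lam : Fin 2 → Plane → ℝ) : Fin 2 → Fin 2 → Fin 2 → Plane → ℝ
  | 0, 0, 0 => fun u => pd 0 (fun w => Real.log (coefA lam w)) u - 2 * coefB lam u
  | 1, 1, 1 => fun u => pd 1 (fun w => Real.log (coefB lam w)) u - 2 * coefA lam u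
  | 0, 0, 1 => fun u => -(1 / 2 * pd 1 (fun w => Real.log (coefA lam w)) u + coefA lam u)
  | 0, 1, 0 => fun u => -(1 / 2 * pd 1 (fun w => Real.log (coefA lam w)) u + coefA lam u)
  | 1, 0, 1 => fun u => -(1 / 2 * pd 0 (fun w => Real.log (coefB lam w)) u + coefB lam u)
  | 1, 1, 0 => fun u => -(1 / 2 * pd 0 (fun w => Real.log (coefB lam w)) u + coefB lam u)
  | 0, 1, 1 => fun _ => 0
  | 1, 0, 0 => fun _ => 0

/-! ### Linear first integrals of the geodesic flow -/

/-- `γ`, with velocity `v`, is an affinely parametrised geodesic in `W` on the interval `(s, t)`: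
`γ̈^a + Γ^a_{bc} γ̇^b γ̇^c = 0`. -/
def IsGeodesicOn (Γ : Fin 2 → Fin 2 → Fin 2 → Plane → ℝ) (W : Set Plane)
    (γ v : ℝ → Plane) (s t : ℝ) : Prop :=
  ∀ τ ∈ Set.Ioo s t, γ τ ∈ W ∧ HasDerivAt γ (v τ) τ ∧
    ∀ a, HasDerivAt (fun σ => v σ a) (-∑ b, ∑ c, Γ a b c (γ τ) * v τ b * v τ c) τ

/-- `κ = K_a(X) Ẋ^a` is a first integral on `W` : it has zero derivative along every geodesic. -/
def IsFirstIntegral (Γ : Fin 2 → Fin 2 → Fin 2 → Plane → ℝ) (W : Set Plane)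
    (K : Fin 2 → Plane → ℝ) : Prop :=
  (∀ a, ContDiffOn ℝ 1 (K a) W) ∧
    ∀ (γ v : ℝ → Plane) (s t : ℝ), IsGeodesicOn Γ W γ v s t →
      ∀ τ ∈ Set.Ioo s t, HasDerivAt (fun σ => ∑ a, K a (γ σ) * v σ a) 0 τ

/-- No nontrivial constant real combination of the one-forms `K i` vanishes identically on `W`. -/
def IndepForms (W : Set Plane) {n : ℕ} (K : Fin n → Fin 2 → Plane → ℝ) : Prop :=
  ∀ c : Fin n → ℝ, (∀ u ∈ W, ∀ a, ∑ i, c i * K i a u = 0) → c = 0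

/-- There are `n` independent linear first integrals on `W`. -/
def AdmitsFirstIntegrals (Γ : Fin 2 → Fin 2 → Fin 2 → Plane → ℝ) (W : Set Plane) (n : ℕ) : Prop :=
  ∃ K : Fin n → Fin 2 → Plane → ℝ, (∀ i, IsFirstIntegral Γ W (K i)) ∧ IndepForms W K

/-- There are `n` independent linear first integrals on `W`, each with both components nowhere
zero. -/
def AdmitsNondegFirstIntegrals (Γ : Fin 2 → Fin 2 → Fin 2 → Plane → ℝ) (W : Set Plane)
    (n : ℕ) : Prop :=
  ∃ K : Fin n → Fin 2 → Plane → ℝ,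
    (∀ i, IsFirstIntegral Γ W (K i) ∧ ∀ u ∈ W, ∀ a, K i a u ≠ 0) ∧ IndepForms W K

/-! ### Operators and Poisson brackets of Dubrovin-Novikov type -/

/-- The coefficients `g^{ab}` (`g a b`) and `b^{ab}_c` (`b a b c`) of the operator
`Ω^{ab} = g^{ab} ∂/∂x + b^{ab}_c ∂X^c/∂x`. -/
structure HydroOp where
  g : Fin 2 → Fin 2 → Plane → ℝ
  b : Fin 2 → Fin 2 → Fin 2 → Plane → ℝ

/-- `Ω^{ab} θ_b` along the map `X`, at the point `x`. -/
def HydroOp.apply (Ω : HydroOp) (X θ : ℝ → Plane) (x : ℝ) : Plane := fun a =>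
  ∑ b, (Ω.g a b (X x) * deriv (fun y => θ y b) x
    + (∑ c, Ω.b a b c (X x) * deriv (fun y => X y c) x) * θ x b)

/-- Smooth maps from the line to `W`. -/
def IsMap (W : Set Plane) (X : ℝ → Plane) : Prop :=
  ContDiff ℝ ∞ X ∧ ∀ x, X x ∈ W

/-- Densities of the functionals `F[X] = ∫ φ(x, X(x)) dx` on which the Poisson bracket is
evaluated: smooth, and supported over a bounded range of `x`, so that all integrals converge
and no boundary terms arise. -/
def IsDensity (φ : ℝ → Plane → ℝ) : Prop :=
  ContDiff ℝ ∞ (fun z : ℝ × Plane => φ z.1 z.2) ∧ ∃ R : ℝ, ∀ x u, R < |x| → φ x u = 0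

/-- The variational derivative `δF/δX^a = ∂φ/∂X^a` of `F[X] = ∫ φ(x, X(x)) dx`. -/
def varDeriv (φ : ℝ → Plane → ℝ) (X : ℝ → Plane) (x : ℝ) : Plane := fun a =>
  pd a (φ x) (X x)

/-- The bracket `{F, G}[X] = ∫ (δF/δX^a) Ω^{ab} (δG/δX^b) dx`. -/
def HydroOp.bracket (Ω : HydroOp) (φ ψ : ℝ → Plane → ℝ) (X : ℝ → Plane) : ℝ :=
  ∫ x, ∑ a, varDeriv φ X x a * Ω.apply X (varDeriv ψ X) x a

/-- The iterated bracket `{{F, G}, H}[X]`. As `{E, H} = ∫ (δE/δX^a) Ω^{ab} (δH/δX^b) dx`, it is the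
derivative of `E = {F, G}` at `X` in the direction of the vector field `Ω^{ab} δH/δX^b`. -/
def HydroOp.bracket₂ (Ω : HydroOp) (φ ψ χ : ℝ → Plane → ℝ) (X : ℝ → Plane) : ℝ :=
  deriv (fun ε : ℝ =>
    Ω.bracket φ ψ (fun x => X x + ε • Ω.apply X (varDeriv χ X) x)) 0

/-- `Ω` defines a Poisson structure on the space of maps from the line to `W`: its bracket is
skew-symmetric and satisfies the Jacobi identity. -/
structure HydroOp.IsPoisson (Ω : HydroOp) (W : Set Plane) : Prop where
  contDiff_g : ∀ a b, ContDiffOn ℝ 1 (Ω.g a b) W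
  contDiff_b : ∀ a b c, ContDiffOn ℝ 1 (Ω.b a b c) W
  skew : ∀ φ ψ, IsDensity φ → IsDensity ψ → ∀ X, IsMap W X →
    Ω.bracket φ ψ X = -Ω.bracket ψ φ X
  jacobi : ∀ φ ψ χ, IsDensity φ → IsDensity ψ → IsDensity χ → ∀ X, IsMap W X →
    Ω.bracket₂ φ ψ χ X + Ω.bracket₂ ψ χ φ X + Ω.bracket₂ χ φ ψ X = 0

/-- The system `∂_t X^a = λ^a(X) ∂_x X^a` on `W` is `∂_t X^a = Ω^{ab} δH/δX^b` with `Ω` Poisson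
and `H = ∫ h(X) dx`, so that `δH/δX^b = ∂_b h`. -/
def IsHamiltonianFormulation (lam : Fin 2 → Plane → ℝ) (W : Set Plane) (Ω : HydroOp)
    (h : Plane → ℝ) : Prop :=
  Ω.IsPoisson W ∧ ContDiffOn ℝ 2 h W ∧
    ∀ X, IsMap W X → ∀ x a,
      lam a (X x) * deriv (fun y => X y a) x = Ω.apply X (fun y b => pd b h (X y)) x a

/-- No nontrivial constant real combination of the operators `Ω i` vanishes on `W`. -/
def IndepOps (W : Set Plane) {n : ℕ} (Ω : Fin n → HydroOp) : Prop :=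
  ∀ c : Fin n → ℝ,
    (∀ u ∈ W, (∀ a b, ∑ i, c i * (Ω i).g a b u = 0) ∧
      ∀ a b d, ∑ i, c i * (Ω i).b a b d u = 0) → c = 0

/-- The system has `n` independent Hamiltonian formulations on `W`. -/
def AdmitsHamiltonians (lam : Fin 2 → Plane → ℝ) (W : Set Plane) (n : ℕ) : Prop :=
  ∃ Ω : Fin n → HydroOp,
    (∀ i, ∃ h, IsHamiltonianFormulation lam W (Ω i) h) ∧ IndepOps W Ω

/-- The system has `n` independent Hamiltonian formulations on `W`, each with `g^{ab}`
non-degenerate at every point. -/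
def AdmitsNondegHamiltonians (lam : Fin 2 → Plane → ℝ) (W : Set Plane) (n : ℕ) : Prop :=
  ∃ Ω : Fin n → HydroOp,
    (∀ i, (∃ h, IsHamiltonianFormulation lam W (Ω i) h) ∧
      ∀ u ∈ W, (Matrix.of fun a b => (Ω i).g a b u).det ≠ 0) ∧ IndepOps W Ω

end Hydro

end

/-!
The theorem rests on a pointwise linear bijection between the leading coefficients of Hamiltonian
operators and linear first integrals. Write `c_{ij} = ∂_j λ^i / (λ^j - λ^i)`, so that `c_{01} = A`
and `c_{10} = B`, and let `i ≠ j` be the two indices.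

*From formulations to first integrals.* Evaluating the skew-symmetry and the Jacobi identity on
densities linear in `X` shows that `g` is symmetric, that `∂_c g^{ab} = b^{ab}_c + b^{ba}_c`, and
that the `b^{ab}_c` satisfy an algebraic relation and a curvature equation
(`HydroOp.IsPoisson.skewCoeffs`, `HydroOp.IsPoisson.g_mul_b`, `HydroOp.IsPoisson.curl_eq`).
Together with the equations for the Hamiltonian they force `g` to be diagonal, with entries
`G_i = g^{ii}` such that `∂_j G_i = -2 c_{ij} G_i`, and with all `b^{ab}_c` determined by `G`; the
curvature equation becomes one further linear equation for `G`
(`IsHamiltonianFormulation.structureEqs`). For degenerate `g` this is done first where `g^{ii}`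
does not vanish and where it vanishes on an open set, and then extended by continuity. The pairs
`G` with these properties are the flat pairs (`IsFlatPair`), and `K_i = c_{ij} G_j` turns their
equations into the Killing equations of the connection (`IsFlatPair.isKilling`,
`IsKilling.isFlatPair`), which say that `K` is a linear first integral
(`isFirstIntegral_iff_isKilling`). This proves the first part.

*From first integrals to formulations.* Conversely, the operator built from a flat pair is Poisson,
since the integrand of its Jacobi identity vanishes identically (`IsFlatPair.isPoisson`). What is
left is a Hamiltonian, that is, a closed one-form solving a linear system. If `G_0` and `G_1` have
no zeros, the Lamé coefficients `|G_i|^{-1/2}` and a rotation or boost by a potential angle reduce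
the system to quadratures, which exist on convex sets
(`IsFlatPair.exists_formulation_of_nondegenerate`). If one of them vanishes identically and the
other has no zeros, the system is solved algebraically, and flatness makes the solution closed
(`IsFlatPair.exists_formulation_of_degenerate`). As `det g = G_0 G_1`, the first of these results
proves the second part.

*Generic points.* The Killing equations are of finite type: a first integral on a convex open set
is determined by its jet `(K_0, K_1, ∂_0 K_1)` at one point (`IsKilling.eq_zero_of_jet_eq_zero`),
so that there are at most three independent ones. In any nonempty open set there is a convex one on
which their number is maximal (`exists_maximal`). If a first integral `L` has a point with
`L_0 L_1 ≠ 0`, then near that point independent `K^{(k)}` may be replaced by `L + t K^{(k)}` for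
small generic `t`, which are non-degenerate and still independent. Otherwise `K_0 K_1` vanishes for
every first integral, and by polarisation they all have the same vanishing component near a
suitable point; the other component of a nonzero one has no zeros, and the degenerate construction
applies (`exists_isGood`).
-/

noncomputable section

namespace Hydro

open Set Filter Topology MeasureTheory

/-! ### Calculus of partial derivatives in the plane -/

section PartialDerivatives

variable {F G : Plane → ℝ} {u : Plane} {W : Set Plane}

lemma fderiv_apply_eq_sum_pd (F : Plane → ℝ) (u v : Plane) :
    fderiv ℝ F u v = ∑ c, pd c F u * v c := by
  have : v = ∑ c, v c • (Pi.single c (1 : ℝ) : Plane) := by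
    ext d
    simp [Finset.sum_apply, Pi.single_apply]
  conv_lhs => rw [this]
  simp [pd, mul_comm]

lemma pd_congr (h : F =ᶠ[𝓝 u] G) (a : Fin 2) : pd a F u = pd a G u := by
  simp [pd, h.fderiv_eq]

lemma pd_congr_on (hW : IsOpen W) (h : ∀ w ∈ W, F w = G w) (hu : u ∈ W) (a : Fin 2) :
    pd a F u = pd a G u :=
  pd_congr (by filter_upwards [hW.mem_nhds hu] using h) a

lemma pd_const (c : ℝ) (a : Fin 2) (u : Plane) : pd a (fun _ => c) u = 0 := by
  simp [pd]

lemma pd_add (hF : DifferentiableAt ℝ F u) (hG : DifferentiableAt ℝ G u) (a : Fin 2) :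
    pd a (fun w => F w + G w) u = pd a F u + pd a G u := by
  simp [pd, fderiv_fun_add hF hG]

lemma pd_sub (hF : DifferentiableAt ℝ F u) (hG : DifferentiableAt ℝ G u) (a : Fin 2) :
    pd a (fun w => F w - G w) u = pd a F u - pd a G u := by
  simp [pd, fderiv_fun_sub hF hG]

lemma pd_neg (F : Plane → ℝ) (u : Plane) (a : Fin 2) :
    pd a (fun w => -F w) u = -pd a F u := by
  simp [pd]

lemma pd_mul (hF : DifferentiableAt ℝ F u) (hG : DifferentiableAt ℝ G u) (a : Fin 2) :
    pd a (fun w => F w * G w) u = pd a F u * G u + F u * pd a G u := by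
  simp [pd, fderiv_fun_mul hF hG]
  ring

lemma pd_const_mul (hF : DifferentiableAt ℝ F u) (c : ℝ) (a : Fin 2) :
    pd a (fun w => c * F w) u = c * pd a F u := by
  simp [pd, fderiv_const_mul hF]

lemma pd_sum {ι : Type*} {s : Finset ι} {F : ι → Plane → ℝ}
    (hF : ∀ i ∈ s, DifferentiableAt ℝ (F i) u) (a : Fin 2) :
    pd a (fun w => ∑ i ∈ s, F i w) u = ∑ i ∈ s, pd a (F i) u := by
  simp [pd, fderiv_fun_sum hF]

/-- The chain rule for a scalar function of one variable. -/
lemma pd_comp {f : ℝ → ℝ} {f' : ℝ} (hf : HasDerivAt f f' (F u)) (hF : DifferentiableAt ℝ F u)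
    (a : Fin 2) : pd a (fun w => f (F w)) u = f' * pd a F u := by
  have := hf.comp_hasFDerivAt u hF.hasFDerivAt
  simp only [pd]
  rw [show (fun w => f (F w)) = f ∘ F from rfl, this.fderiv]
  simp

lemma pd_div (hF : DifferentiableAt ℝ F u) (hG : DifferentiableAt ℝ G u) (h0 : G u ≠ 0)
    (a : Fin 2) :
    pd a (fun w => F w / G w) u = (pd a F u * G u - F u * pd a G u) / G u ^ 2 := by
  have h1 : DifferentiableAt ℝ (fun w => (G w)⁻¹) u := hG.fun_inv h0
  simp only [div_eq_mul_inv]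
  rw [pd_mul hF h1, pd_comp (hasDerivAt_inv h0) hG]
  field_simp
  ring

/-- `F` is differentiable at `u`, with `a`-th partial derivative `d`. The rules below compute the
partial derivatives of compound expressions. -/
structure HasPd (a : Fin 2) (F : Plane → ℝ) (d : ℝ) (u : Plane) : Prop where
  diff : DifferentiableAt ℝ F u
  eq : pd a F u = d

namespace HasPd

variable {a : Fin 2} {d e : ℝ}

lemma of_diff (h : DifferentiableAt ℝ F u) (a : Fin 2) : HasPd a F (pd a F u) u := ⟨h, rfl⟩

lemma of_contDiffOn {n : WithTop ℕ∞} (h : ContDiffOn ℝ n F W) (hn : n ≠ 0) (hW : IsOpen W)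
    (hu : u ∈ W) (a : Fin 2) : HasPd a F (pd a F u) u :=
  ⟨(h.differentiableOn hn).differentiableAt (hW.mem_nhds hu), rfl⟩

lemma add (hF : HasPd a F d u) (hG : HasPd a G e u) : HasPd a (fun w => F w + G w) (d + e) u :=
  ⟨hF.diff.add hG.diff, by rw [pd_add hF.diff hG.diff, hF.eq, hG.eq]⟩

lemma sub (hF : HasPd a F d u) (hG : HasPd a G e u) : HasPd a (fun w => F w - G w) (d - e) u :=
  ⟨hF.diff.sub hG.diff, by rw [pd_sub hF.diff hG.diff, hF.eq, hG.eq]⟩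

lemma neg (hF : HasPd a F d u) : HasPd a (fun w => -F w) (-d) u :=
  ⟨hF.diff.neg, by rw [pd_neg, hF.eq]⟩

lemma mul (hF : HasPd a F d u) (hG : HasPd a G e u) :
    HasPd a (fun w => F w * G w) (d * G u + F u * e) u :=
  ⟨hF.diff.mul hG.diff, by rw [pd_mul hF.diff hG.diff, hF.eq, hG.eq]⟩

lemma const_mul (c : ℝ) (hF : HasPd a F d u) : HasPd a (fun w => c * F w) (c * d) u :=
  ⟨hF.diff.const_mul c, by rw [pd_const_mul hF.diff, hF.eq]⟩

lemma div (hF : HasPd a F d u) (hG : HasPd a G e u) (h0 : G u ≠ 0) :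
    HasPd a (fun w => F w / G w) ((d * G u - F u * e) / G u ^ 2) u :=
  ⟨by simpa only [div_eq_mul_inv] using hF.diff.fun_mul (hG.diff.fun_inv h0),
    by rw [pd_div hF.diff hG.diff h0, hF.eq, hG.eq]⟩

lemma comp {f : ℝ → ℝ} {f' : ℝ} (hf : HasDerivAt f f' (F u)) (hF : HasPd a F d u) :
    HasPd a (fun w => f (F w)) (f' * d) u :=
  ⟨hf.differentiableAt.comp u hF.diff, by rw [pd_comp hf hF.diff, hF.eq]⟩

end HasPd

/-- The chain rule along a curve. -/
lemma hasDerivAt_comp_curve {X : ℝ → Plane} {v : Plane} {t : ℝ}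
    (hF : DifferentiableAt ℝ F (X t)) (hX : HasDerivAt X v t) :
    HasDerivAt (fun s => F (X s)) (∑ c, pd c F (X t) * v c) t := by
  have := hF.hasFDerivAt.comp_hasDerivAt t hX
  rwa [fderiv_apply_eq_sum_pd] at this

lemma differentiableAt_of_contDiffOn {n : WithTop ℕ∞} (h : ContDiffOn ℝ n F W) (hn : n ≠ 0)
    (hW : IsOpen W) (hu : u ∈ W) : DifferentiableAt ℝ F u :=
  (h.differentiableOn hn).differentiableAt (hW.mem_nhds hu)

lemma contDiffOn_pd {n m : WithTop ℕ∞} (h : ContDiffOn ℝ n F W) (hW : IsOpen W)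
    (hmn : m + 1 ≤ n) (a : Fin 2) : ContDiffOn ℝ m (pd a F) W :=
  (h.fderiv_of_isOpen hW hmn).clm_apply contDiffOn_const

lemma fderiv_eq_pd (F : Plane → ℝ) (u : Plane) :
    fderiv ℝ F u =
      ∑ c, pd c F u • ContinuousLinearMap.proj (R := ℝ) (φ := fun _ : Fin 2 => ℝ) c := by
  ext v
  rw [fderiv_apply_eq_sum_pd]
  simp

/-- A differentiable function with partial derivatives of class `C^n` is of class `C^(n+1)`. -/
lemma contDiffOn_succ_of_pd {n : ℕ} (hW : IsOpen W) (h : DifferentiableOn ℝ F W)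
    (h' : ∀ a, ContDiffOn ℝ n (pd a F) W) : ContDiffOn ℝ (n + 1) F W := by
  rw [contDiffOn_succ_iff_fderiv_of_isOpen hW]
  refine ⟨h, by simp, ?_⟩
  have : fderiv ℝ F = fun u => ∑ c, pd c F u •
      ContinuousLinearMap.proj (R := ℝ) (φ := fun _ : Fin 2 => ℝ) c := by
    ext1 u
    exact fderiv_eq_pd F u
  rw [this]
  exact ContDiffOn.sum fun c _ => (h' c).smul contDiffOn_const

/-- The symmetry of second derivatives. -/
lemma pd_comm (h : ContDiffOn ℝ 2 F W) (hW : IsOpen W) (hu : u ∈ W) (a b : Fin 2) :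
    pd a (pd b F) u = pd b (pd a F) u := by
  have hs : IsSymmSndFDerivAt ℝ F u :=
    (h.contDiffAt (hW.mem_nhds hu)).isSymmSndFDerivAt (by simp)
  have hd : DifferentiableAt ℝ (fderiv ℝ F) u :=
    ((h.fderiv_of_isOpen hW (m := 1) (by norm_num)).differentiableOn (by simp)).differentiableAt
      (hW.mem_nhds hu)
  have key : ∀ a b : Fin 2, pd a (pd b F) u =
      fderiv ℝ (fderiv ℝ F) u (Pi.single a 1) (Pi.single b 1) := by
    intro a b
    unfold pd
    rw [fderiv_clm_apply hd (differentiableAt_const _)]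
    simp
  rw [key, key]
  exact hs _ _

lemma hasDerivAt_line {a : Fin 2} (hF : DifferentiableAt ℝ F u) :
    HasDerivAt (fun t : ℝ => F (u + t • (Pi.single a 1 : Plane))) (pd a F u) 0 := by
  have h1 : HasDerivAt (fun t : ℝ => u + t • (Pi.single a 1 : Plane)) (Pi.single a 1) 0 := by
    simpa using ((hasDerivAt_id (0 : ℝ)).smul_const (Pi.single a 1 : Plane)).const_add u
  have h2 : HasFDerivAt F (fderiv ℝ F u) (u + (0 : ℝ) • (Pi.single a 1 : Plane)) := by
    simpa using hF.hasFDerivAt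
  exact h2.comp_hasDerivAt (0 : ℝ) h1

/-- A function with continuous partial derivatives, given as derivatives along coordinate lines,
is of class `C^1`. -/
lemma contDiffOn_one_of_line {q : Plane → ℝ} {q' : Fin 2 → Plane → ℝ} (hW : IsOpen W)
    (hc : ∀ a, ContinuousOn (q' a) W)
    (hq : ∀ u ∈ W, ∀ a, HasDerivAt (fun t : ℝ => q (u + t • (Pi.single a 1 : Plane))) (q' a u) 0) :
    ContDiffOn ℝ 1 q W ∧ ∀ u ∈ W, ∀ a, pd a q u = q' a u := by
  let e : (ℝ × ℝ) ≃L[ℝ] Plane := (ContinuousLinearEquiv.finTwoArrow ℝ ℝ).symm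
  have he : ∀ x y : ℝ, e (x, y) = ![x, y] := fun x y => by
    rw [ContinuousLinearEquiv.symm_apply_eq]
    simp
  have he' : ∀ w : Plane, e (w 0, w 1) = w := fun w => by
    rw [he]; ext i; fin_cases i <;> rfl
  have hstrict : ∀ u ∈ W, HasFDerivAt q
      (∑ c, q' c u • ContinuousLinearMap.proj (R := ℝ) (φ := fun _ : Fin 2 => ℝ) c) u := by
    intro u hu
    let f : ℝ → ℝ → ℝ := fun x y => q (e (x, y))
    let f₁ : ℝ → ℝ → ℝ →L[ℝ] ℝ := fun x y => ContinuousLinearMap.toSpanSingleton ℝ (q' 0 (e (x, y)))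
    let f₂ : ℝ → ℝ → ℝ →L[ℝ] ℝ := fun x y => ContinuousLinearMap.toSpanSingleton ℝ (q' 1 (e (x, y)))
    have hnear : ∀ᶠ v : ℝ × ℝ in 𝓝 (u 0, u 1), e v ∈ W :=
      e.continuous.continuousAt.preimage_mem_nhds (by rw [he']; exact hW.mem_nhds hu)
    have h1 : ∀ᶠ v in 𝓝 (u 0, u 1), HasFDerivAt (f · v.2) (↿f₁ v) v.1 := by
      filter_upwards [hnear] with v hv
      have h := (hq _ hv 0)
      have hs : HasDerivAt (fun x : ℝ => x - v.1) 1 v.1 := (hasDerivAt_id _).sub_const _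
      have h' : HasDerivAt (fun t : ℝ => q (e v + t • (Pi.single 0 1 : Plane))) (q' 0 (e v))
          (v.1 - v.1) := by simpa using h
      have := HasDerivAt.comp (h := fun x : ℝ => x - v.1) v.1 h' hs
      have hfun : ((fun t : ℝ => q (e v + t • (Pi.single 0 1 : Plane))) ∘ fun x => x - v.1)
          = (f · v.2) := by
        ext x
        simp only [Function.comp, f]
        congr 1
        rw [show v = (v.1, v.2) from rfl, he, he]
        ext i; fin_cases i <;> simp
      rw [hfun] at this
      simpa [f₁, Function.HasUncurry.uncurry] using this.hasFDerivAt
    have h2 : ∀ᶠ v in 𝓝 (u 0, u 1), HasFDerivAt (f v.1 ·) (↿f₂ v) v.2 := by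
      filter_upwards [hnear] with v hv
      have h := (hq _ hv 1)
      have hs : HasDerivAt (fun x : ℝ => x - v.2) 1 v.2 := (hasDerivAt_id _).sub_const _
      have h' : HasDerivAt (fun t : ℝ => q (e v + t • (Pi.single 1 1 : Plane))) (q' 1 (e v))
          (v.2 - v.2) := by simpa using h
      have := HasDerivAt.comp (h := fun x : ℝ => x - v.2) v.2 h' hs
      have hfun : ((fun t : ℝ => q (e v + t • (Pi.single 1 1 : Plane))) ∘ fun x => x - v.2)
          = (f v.1 ·) := by
        ext x
        simp only [Function.comp, f]
        congr 1
        rw [show v = (v.1, v.2) from rfl, he, he]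
        ext i; fin_cases i <;> simp
      rw [hfun] at this
      simpa [f₂, Function.HasUncurry.uncurry] using this.hasFDerivAt
    have hcont : ∀ a, ContinuousAt (fun v : ℝ × ℝ =>
        ContinuousLinearMap.toSpanSingleton ℝ (q' a (e v))) (u 0, u 1) := by
      intro a
      have h3 : ContinuousAt (fun v : ℝ × ℝ => q' a (e v)) (u 0, u 1) := by
        have h4 : ContinuousAt (q' a) (e (u 0, u 1)) := by
          rw [he']; exact (hc a).continuousAt (hW.mem_nhds hu)
        exact ContinuousAt.comp h4 e.continuous.continuousAt
      exact (ContinuousLinearMap.toSpanSingletonCLE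
        (𝕜 := ℝ) (E := ℝ)).continuous.continuousAt.comp h3
    have hmain := (hasStrictFDerivAt_uncurry_coprod h1 h2 (hcont 0) (hcont 1)).hasFDerivAt
    have hcomp : HasFDerivAt (↿f ∘ e.symm) _ u :=
      HasFDerivAt.comp u (by
        have : e.symm u = (u 0, u 1) := by
          rw [ContinuousLinearEquiv.symm_apply_eq, he']
        rw [this]; exact hmain) e.symm.hasFDerivAt
    have hq' : ↿f ∘ e.symm = q := by
      ext w
      simp [f, Function.HasUncurry.uncurry]
    rw [hq'] at hcomp
    convert! hcomp using 1
    refine ContinuousLinearMap.ext fun v => ?_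
    have : e.symm v = (v 0, v 1) := by
      rw [ContinuousLinearEquiv.symm_apply_eq, he']
    simp [f₁, f₂, Function.HasUncurry.uncurry, he', Fin.sum_univ_two, this, mul_comm]
  have hpd : ∀ u ∈ W, ∀ a, pd a q u = q' a u := by
    intro u hu a
    simp only [pd, (hstrict u hu).fderiv]
    fin_cases a <;> simp
  refine ⟨?_, hpd⟩
  have := contDiffOn_succ_of_pd (n := 0) hW
    (fun u hu => (hstrict u hu).differentiableAt.differentiableWithinAt)
    (fun a => by
      simp only [Nat.cast_zero, contDiffOn_zero]
      exact (hc a).congr fun u hu => hpd u hu a)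
  simpa using this

/-- A form of Schwarz's theorem that assumes only one of the two mixed derivatives: if `f` and
`∂_i f` are of class `C^1`, then `∂_j f` is differentiable along the `i`-th coordinate line, with
derivative `∂_j ∂_i f`. -/
lemma hasDerivAt_line_pd {f : Plane → ℝ} {i j : Fin 2} (hW : IsOpen W) (hf : ContDiffOn ℝ 1 f W)
    (hf' : ContDiffOn ℝ 1 (pd i f) W) (hu : u ∈ W) :
    HasDerivAt (fun t : ℝ => pd j f (u + t • (Pi.single i 1 : Plane))) (pd j (pd i f) u) 0 := by
  set ei : Plane := Pi.single i 1
  set ej : Plane := Pi.single j 1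
  set c := pd j (pd i f) u
  have hcont : ContinuousOn (pd j (pd i f)) W := by
    have := contDiffOn_pd (m := 0) hf' hW (by simp) j
    exact this.continuousOn
  have hline : ∀ (g : Plane → ℝ) (hg : ContDiffOn ℝ 1 g W) (a : Fin 2) (w : Plane) (t : ℝ),
      w + t • (Pi.single a 1 : Plane) ∈ W →
      HasDerivAt (fun s : ℝ => g (w + s • (Pi.single a 1 : Plane)))
        (pd a g (w + t • (Pi.single a 1 : Plane))) t := by
    intro g hg a w t hw
    have h1 : HasDerivAt (fun t : ℝ => w + t • (Pi.single a 1 : Plane)) (Pi.single a 1) t := by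
      simpa using ((hasDerivAt_id t).smul_const (Pi.single a 1 : Plane)).const_add w
    exact (differentiableAt_of_contDiffOn hg (by simp) hW hw).hasFDerivAt.comp_hasDerivAt t h1
  rw [hasDerivAt_iff_isLittleO, Asymptotics.isLittleO_iff]
  intro ε hε
  have hu0 : u + (0:ℝ) • ei + (0:ℝ) • ej = u := by simp
  have hct : Tendsto (fun z : ℝ × ℝ => u + z.1 • ei + z.2 • ej) (𝓝 (0, 0)) (𝓝 u) := by
    have : Continuous (fun z : ℝ × ℝ => u + z.1 • ei + z.2 • ej) := by fun_prop
    simpa using this.tendsto (0, 0)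
  have hnear : ∀ᶠ z : ℝ × ℝ in 𝓝 (0, 0), u + z.1 • ei + z.2 • ej ∈ W ∧
      ‖pd j (pd i f) (u + z.1 • ei + z.2 • ej) - c‖ ≤ ε := by
    have h1 := hct.eventually (hW.mem_nhds hu)
    have h2 := (hcont.continuousAt (hW.mem_nhds hu)).tendsto.comp hct
    have h3 : ∀ᶠ z : ℝ × ℝ in 𝓝 (0, 0),
        pd j (pd i f) (u + z.1 • ei + z.2 • ej) ∈ Metric.closedBall c ε :=
      h2.eventually (Metric.closedBall_mem_nhds c hε)
    filter_upwards [h1, h3] with z hz1 hz2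
    exact ⟨hz1, by simpa [dist_eq_norm] using hz2⟩
  obtain ⟨δ, hδ, hball⟩ := Metric.eventually_nhds_iff_ball.mp hnear
  have hmem : ∀ t s : ℝ, |t| < δ → |s| < δ → u + t • ei + s • ej ∈ W ∧
      ‖pd j (pd i f) (u + t • ei + s • ej) - c‖ ≤ ε := fun t s ht hs =>
    hball (t, s) (by
      rw [Metric.mem_ball, dist_eq_norm]
      simpa [Prod.norm_def] using ⟨ht, hs⟩)
  have hsmall : ∀ᶠ t : ℝ in 𝓝 0, |t| < δ := by
    have := Metric.ball_mem_nhds (0 : ℝ) hδ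
    filter_upwards [this] with t ht
    simpa using ht
  filter_upwards [hsmall] with t ht
  -- increment of `∂_i f` in the direction `j`
  have step1 : ∀ t s : ℝ, |t| < δ → |s| < δ →
      ‖pd i f (u + t • ei + s • ej) - pd i f (u + t • ei) - s * c‖ ≤ ε * |s| := by
    intro t s ht hs
    have hconv : Convex ℝ (Metric.ball (0 : ℝ) δ) := convex_ball _ _
    have := hconv.norm_image_sub_le_of_norm_hasDerivWithin_le
      (f := fun r : ℝ => pd i f (u + t • ei + r • ej) - r * c)
      (f' := fun r => pd j (pd i f) (u + t • ei + r • ej) - 1 * c) (C := ε) (x := 0) (y := s)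
      (fun r hr => ((hline _ hf' j _ r (hmem t r ht (by simpa using hr)).1).sub
        ((hasDerivAt_id r).mul_const c)).hasDerivWithinAt)
      (fun r hr => by simpa using (hmem t r ht (by simpa using hr)).2)
      (by simpa using hδ) (by simpa using hs)
    simp only [zero_smul, add_zero, zero_mul, sub_zero, Real.norm_eq_abs] at this ⊢
    rw [sub_right_comm]
    exact this
  -- second differences of `f`
  have step2 : ∀ s : ℝ, |s| < δ →
      ‖(f (u + t • ei + s • ej) - f (u + t • ei)) - (f (u + s • ej) - f u) - t * (s * c)‖
        ≤ ε * |s| * |t| := by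
    intro s hs
    have hconv : Convex ℝ (Metric.ball (0 : ℝ) δ) := convex_ball _ _
    have hd1 : ∀ r : ℝ, |r| < δ →
        HasDerivAt (fun r : ℝ => f (u + r • ei + s • ej)) (pd i f (u + r • ei + s • ej)) r := by
      intro r hr
      have h := hline f hf i (u + s • ej) r (by
        have := (hmem r s hr hs).1
        rwa [add_right_comm] at this)
      simpa only [add_right_comm] using h
    have hd2 : ∀ r : ℝ, |r| < δ →
        HasDerivAt (fun r : ℝ => f (u + r • ei)) (pd i f (u + r • ei)) r := by
      intro r hr
      exact hline f hf i u r (by simpa using (hmem r 0 hr (by simpa using hδ)).1)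
    have := hconv.norm_image_sub_le_of_norm_hasDerivWithin_le
      (f := fun r : ℝ => f (u + r • ei + s • ej) - f (u + r • ei) - r * (s * c))
      (f' := fun r => pd i f (u + r • ei + s • ej) - pd i f (u + r • ei) - 1 * (s * c))
      (C := ε * |s|) (x := 0) (y := t)
      (fun r hr => (((hd1 r (by simpa using hr)).sub (hd2 r (by simpa using hr))).sub
        ((hasDerivAt_id r).mul_const (s * c))).hasDerivWithinAt)
      (fun r hr => by simpa using step1 r s (by simpa using hr) hs)
      (by simpa using hδ) (by simpa using ht)
    simp only [zero_smul, add_zero, zero_mul, sub_zero, Real.norm_eq_abs] at this ⊢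
    rw [sub_right_comm]
    exact this
  -- divide by `s` and let `s` tend to `0`
  have hw1 : u + t • ei ∈ W := by simpa using (hmem t 0 ht (by simpa using hδ)).1
  have hlim : HasDerivAt (fun s : ℝ =>
      (f (u + t • ei + s • ej) - f (u + t • ei)) - (f (u + s • ej) - f u) - t * (s * c))
      (pd j f (u + t • ei) - pd j f u - t * (1 * c)) 0 := by
    have h1 := hline f hf j (u + t • ei) 0 (by simpa using hw1)
    have h2 := hline f hf j u 0 (by simpa using hu)
    simp only [zero_smul, add_zero] at h1 h2
    exact ((h1.sub_const _).sub (h2.sub_const _)).sub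
      (((hasDerivAt_id (0 : ℝ)).mul_const c).const_mul t)
  have hle := hlim.le_of_lip' (C := ε * |t|) (by positivity) (by
    have hsmall : ∀ᶠ t : ℝ in 𝓝 0, |t| < δ := by
      have := Metric.ball_mem_nhds (0 : ℝ) hδ
      filter_upwards [this] with t ht
      simpa using ht
    filter_upwards [hsmall] with s hs
    have := step2 s hs
    simp only [zero_smul, add_zero, sub_self, zero_mul, mul_zero, sub_zero,
      Real.norm_eq_abs] at this ⊢
    linarith [this])
  simp only [zero_smul, add_zero, Real.norm_eq_abs, sub_zero, smul_eq_mul, one_mul] at hle ⊢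
  exact hle

/-- The Poincaré lemma on a convex open set of the plane. -/
lemma exists_pd_eq {P Q : Plane → ℝ} (hW : IsOpen W) (hc : Convex ℝ W)
    (hP : DifferentiableOn ℝ P W) (hQ : DifferentiableOn ℝ Q W)
    (h : ∀ u ∈ W, pd 1 P u = pd 0 Q u) :
    ∃ f : Plane → ℝ, DifferentiableOn ℝ f W ∧ ∀ u ∈ W, pd 0 f u = P u ∧ pd 1 f u = Q u := by
  let p : Fin 2 → Plane →L[ℝ] ℝ := ContinuousLinearMap.proj (R := ℝ) (φ := fun _ : Fin 2 => ℝ)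
  let θ : Plane → Plane →L[ℝ] ℝ := fun u => P u • p 0 + Q u • p 1
  have hPa : ∀ u ∈ W, DifferentiableAt ℝ P u := fun u hu => hP.differentiableAt (hW.mem_nhds hu)
  have hQa : ∀ u ∈ W, DifferentiableAt ℝ Q u := fun u hu => hQ.differentiableAt (hW.mem_nhds hu)
  have hθ : ∀ u ∈ W, HasFDerivAt θ
      ((fderiv ℝ P u).smulRight (p 0) + (fderiv ℝ Q u).smulRight (p 1)) u := fun u hu =>
    ((hPa u hu).hasFDerivAt.smul_const (p 0)).add ((hQa u hu).hasFDerivAt.smul_const (p 1))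
  have hd : DifferentiableOn ℝ θ W :=
    fun u hu => (hθ u hu).differentiableAt.differentiableWithinAt
  obtain ⟨f, hf⟩ := hc.exists_forall_hasFDerivAt_of_fderiv_symmetric hW hd (by
      intro u hu x y
      rw [(hθ u hu).fderiv]
      simp [fderiv_apply_eq_sum_pd, p, Fin.sum_univ_two, h u hu]
      ring)
  refine ⟨f, fun u hu => (hf u hu).differentiableAt.differentiableWithinAt, fun u hu => ?_⟩
  simp [pd, (hf u hu).fderiv, θ, p]

end PartialDerivatives

/-! ### Integrals over the line, depending on a parameter -/

section LineIntegrals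

lemma integrable_of_continuous_of_vanish {f : ℝ → ℝ} {R : ℝ} (hf : Continuous f)
    (h : ∀ x, R < |x| → f x = 0) : Integrable f :=
  hf.integrable_of_hasCompactSupport <| HasCompactSupport.intro (isCompact_Icc (a := -R) (b := R))
    fun x hx => h x <| by
      by_contra hlt
      exact hx (abs_le.mp (not_lt.mp hlt))

lemma integral_eq_zero_of_hasDerivAt_of_vanish {f f' : ℝ → ℝ} {R : ℝ}
    (hf : ∀ x, HasDerivAt f (f' x) x) (hf' : Continuous f') (h : ∀ x, R < |x| → f x = 0) :
    Integrable f' ∧ ∫ x, f' x = 0 := by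
  have h' : ∀ x, R < |x| → f' x = 0 := by
    intro x hx
    have hev : f =ᶠ[𝓝 x] fun _ => 0 := by
      filter_upwards [(isOpen_lt continuous_const continuous_abs).mem_nhds hx] with y hy
      exact h y hy
    exact ((hf x).congr_of_eventuallyEq hev.symm).unique (hasDerivAt_const x 0)
  have hint := integrable_of_continuous_of_vanish hf' h'
  refine ⟨hint, integral_eq_zero_of_hasDerivAt_of_integrable hf hint
    (integrable_of_continuous_of_vanish ?_ h)⟩
  exact continuous_iff_continuousAt.mpr fun x => (hf x).continuousAt

/-- `F' ε x` is the derivative of `F ε x` in `ε ∈ I`, and both are jointly continuous. -/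
structure HasParamDeriv (I : Set ℝ) (F F' : ℝ → ℝ → ℝ) : Prop where
  cont : ContinuousOn (fun z : ℝ × ℝ => F z.1 z.2) (I ×ˢ univ)
  cont' : ContinuousOn (fun z : ℝ × ℝ => F' z.1 z.2) (I ×ˢ univ)
  deriv : ∀ ε ∈ I, ∀ x, HasDerivAt (fun ε => F ε x) (F' ε x) ε

namespace HasParamDeriv

variable {I : Set ℝ} {F F' G G' : ℝ → ℝ → ℝ}

lemma add (hF : HasParamDeriv I F F') (hG : HasParamDeriv I G G') :
    HasParamDeriv I (fun ε x => F ε x + G ε x) (fun ε x => F' ε x + G' ε x) :=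
  ⟨hF.cont.add hG.cont, hF.cont'.add hG.cont',
    fun ε hε x => (hF.deriv ε hε x).add (hG.deriv ε hε x)⟩

lemma mul (hF : HasParamDeriv I F F') (hG : HasParamDeriv I G G') :
    HasParamDeriv I (fun ε x => F ε x * G ε x) (fun ε x => F' ε x * G ε x + F ε x * G' ε x) :=
  ⟨hF.cont.mul hG.cont, (hF.cont'.mul hG.cont).add (hF.cont.mul hG.cont'),
    fun ε hε x => (hF.deriv ε hε x).mul (hG.deriv ε hε x)⟩

lemma sum {ι : Type*} [Fintype ι] {F F' : ι → ℝ → ℝ → ℝ}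
    (h : ∀ i, HasParamDeriv I (F i) (F' i)) :
    HasParamDeriv I (fun ε x => ∑ i, F i ε x) (fun ε x => ∑ i, F' i ε x) :=
  ⟨continuousOn_finsetSum _ fun i _ => (h i).cont, continuousOn_finsetSum _ fun i _ => (h i).cont',
    fun ε hε x => HasDerivAt.fun_sum fun i _ => (h i).deriv ε hε x⟩

/-- Differentiation under the integral sign, for integrands supported over a bounded range. The
derivative `D` may be given in any form. -/
lemma hasDerivAt_integral {δ R : ℝ} (hδ : 0 < δ) (h : HasParamDeriv (Ioo (-δ) δ) F F')
    (hR : ∀ ε x, R < |x| → F ε x = 0) {D : ℝ → ℝ} (hD : ∀ x, D x = F' 0 x) :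
    Integrable D ∧ Continuous D ∧ HasDerivAt (fun ε => ∫ x, F ε x) (∫ x, D x) 0 := by
  obtain rfl : D = F' 0 := funext hD
  have h0 : (0 : ℝ) ∈ Ioo (-δ) δ := ⟨by linarith, hδ⟩
  have hslice : ∀ ε ∈ Ioo (-δ) δ, Continuous (F ε) ∧ Continuous (F' ε) := by
    intro ε hε
    have hmap : MapsTo (fun x : ℝ => (ε, x)) univ (Ioo (-δ) δ ×ˢ univ) := fun x _ => ⟨hε, trivial⟩
    have hc : ContinuousOn (fun x : ℝ => (ε, x)) univ := by fun_prop
    exact ⟨continuousOn_univ.mp (h.cont.comp hc hmap),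
      continuousOn_univ.mp (h.cont'.comp hc hmap)⟩
  have hR' : ∀ x, R < |x| → F' 0 x = 0 := by
    intro x hx
    have h1 := h.deriv 0 h0 x
    have h2 : (fun ε => F ε x) = fun _ => 0 := funext fun ε => hR ε x hx
    rw [h2] at h1
    exact h1.unique (hasDerivAt_const _ _)
  have hint : Integrable (F' 0) := integrable_of_continuous_of_vanish (hslice 0 h0).2 hR'
  refine ⟨hint, (hslice 0 h0).2, ?_⟩
  have hset : ∀ f : ℝ → ℝ, (∀ x, R < |x| → f x = 0) → ∫ x in Icc (-R) R, f x = ∫ x, f x :=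
    fun f hf => setIntegral_eq_integral_of_forall_compl_eq_zero fun x hx => hf x <| by
      by_contra hlt
      exact hx (abs_le.mp (not_lt.mp hlt))
  have hcomp : IsCompact (Icc (-(δ / 2)) (δ / 2) ×ˢ Icc (-R) R) := isCompact_Icc.prod isCompact_Icc
  have hsub : Icc (-(δ / 2)) (δ / 2) ⊆ Ioo (-δ) δ := fun ε hε =>
    ⟨by linarith [hε.1], by linarith [hε.2]⟩
  obtain ⟨C, hC⟩ := hcomp.exists_bound_of_continuousOn
    (h.cont'.mono (prod_mono hsub (subset_univ _)))
  have key := (hasDerivAt_integral_of_dominated_loc_of_deriv_le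
    (μ := volume.restrict (Icc (-R) R)) (F := F) (F' := F') (x₀ := 0)
    (s := Icc (-(δ / 2)) (δ / 2)) (bound := fun _ => C)
    (Icc_mem_nhds (by linarith) (by linarith))
    (by
      filter_upwards [Ioo_mem_nhds h0.1 h0.2] with ε hε
      exact (hslice ε hε).1.aestronglyMeasurable)
    ((hslice 0 h0).1.integrableOn_Icc)
    (hslice 0 h0).2.aestronglyMeasurable
    (by
      filter_upwards [ae_restrict_mem measurableSet_Icc] with x hx ε hε
      exact hC (ε, x) ⟨hε, hx⟩)
    (integrable_const _)
    (ae_of_all _ fun x ε hε => h.deriv ε (hsub hε) x)).2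
  rw [hset _ hR'] at key
  refine key.congr_of_eventuallyEq (Eventually.of_forall fun ε => ?_)
  exact (hset _ (hR ε)).symm

end HasParamDeriv

end LineIntegrals

/-! ### The bracket along a curve -/

/-- The vector `Ω^{ab} θ_b` at the point `u` of a curve with velocity `v`, where `θ` and `θ'` are
the values of the covector and of its derivative. -/
def HydroOp.flow (Ω : HydroOp) (u v θ θ' : Plane) : Plane := fun a =>
  ∑ b, (Ω.g a b u * θ' b + (∑ c, Ω.b a b c u * v c) * θ b)

/-- The derivative of `HydroOp.flow` when the curve moves with velocity `η`, the covector being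
fixed. -/
def HydroOp.dflow (Ω : HydroOp) (u v η η' θ θ' : Plane) : Plane := fun a =>
  ∑ b, ((∑ c, pd c (Ω.g a b) u * η c) * θ' b
    + (∑ c, ((∑ d, pd d (Ω.b a b c) u * η d) * v c + Ω.b a b c u * η' c)) * θ b)

lemma HydroOp.apply_eq_flow (Ω : HydroOp) {X θ : ℝ → Plane} {v θ' : Plane} {x : ℝ}
    (hX : HasDerivAt X v x) (hθ : HasDerivAt θ θ' x) :
    Ω.apply X θ x = Ω.flow (X x) v (θ x) θ' := by
  rw [hasDerivAt_pi] at hX hθ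
  ext a
  simp only [HydroOp.apply, HydroOp.flow, (hX _).deriv, (hθ _).deriv]

/-- The partial derivatives of a density, as functions on `ℝ × Plane`. -/
def densityPd (φ : ℝ → Plane → ℝ) (a : Fin 2) (z : ℝ × Plane) : ℝ := pd a (φ z.1) z.2

section Densities

variable {φ : ℝ → Plane → ℝ}

lemma densityPd_eq (hφ : IsDensity φ) (a : Fin 2) (z : ℝ × Plane) :
    densityPd φ a z = fderiv ℝ (fun z : ℝ × Plane => φ z.1 z.2) z (0, Pi.single a 1) := by
  have h1 : HasFDerivAt (fun z : ℝ × Plane => φ z.1 z.2) _ (z.1, z.2) :=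
    (hφ.1.differentiable (by simp) z).hasFDerivAt
  have h2 : HasFDerivAt (fun u : Plane => (z.1, u)) (ContinuousLinearMap.inr ℝ ℝ Plane) z.2 :=
    hasFDerivAt_prodMk_right z.1 z.2
  have h3 := (h1.comp z.2 h2).fderiv
  simp only [densityPd, pd]
  rw [show φ z.1 = (fun z : ℝ × Plane => φ z.1 z.2) ∘ fun u : Plane => (z.1, u) from rfl, h3]
  simp

lemma contDiff_densityPd (hφ : IsDensity φ) (a : Fin 2) : ContDiff ℝ ∞ (densityPd φ a) := by
  have : densityPd φ a = fun z =>
      fderiv ℝ (fun z : ℝ × Plane => φ z.1 z.2) z (0, Pi.single a 1) :=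
    funext fun z => densityPd_eq hφ a z
  rw [this]
  exact (hφ.1.fderiv_right (m := ∞) (by simp)).clm_apply contDiff_const

/-- The Hessian of a density, in the direction of the plane, is symmetric. -/
lemma sum_fderiv_densityPd_comm (hφ : IsDensity φ) (z : ℝ × Plane) (η ξ : Plane) :
    ∑ a, fderiv ℝ (densityPd φ a) z (0, η) * ξ a
      = ∑ a, fderiv ℝ (densityPd φ a) z (0, ξ) * η a := by
  have hs : IsSymmSndFDerivAt ℝ (fun z : ℝ × Plane => φ z.1 z.2) z :=
    hφ.1.contDiffAt.isSymmSndFDerivAt (by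
      simpa using WithTop.coe_le_coe.mpr (le_top : (2 : ℕ∞) ≤ ⊤))
  have hd : DifferentiableAt ℝ (fderiv ℝ fun z : ℝ × Plane => φ z.1 z.2) z :=
    (hφ.1.fderiv_right (m := ∞) (by simp)).differentiable (by simp) z
  have key : ∀ η ξ : Plane, ∑ a, fderiv ℝ (densityPd φ a) z (0, η) * ξ a =
      fderiv ℝ (fderiv ℝ fun z : ℝ × Plane => φ z.1 z.2) z (0, η) (0, ξ) := by
    intro η ξ
    have h1 : ∀ a, fderiv ℝ (densityPd φ a) z (0, η) =
        fderiv ℝ (fderiv ℝ fun z : ℝ × Plane => φ z.1 z.2) z (0, η) (0, Pi.single a 1) := by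
      intro a
      have : densityPd φ a = fun z =>
          fderiv ℝ (fun z : ℝ × Plane => φ z.1 z.2) z (0, Pi.single a 1) :=
        funext fun z => densityPd_eq hφ a z
      rw [this, fderiv_clm_apply hd (differentiableAt_const _)]
      simp
    have h2 : ((0 : ℝ), ξ) = ∑ a, ξ a • ((0 : ℝ), (Pi.single a 1 : Plane)) := by
      ext d
      · simp
      · fin_cases d <;> simp
    conv_rhs => rw [h2]
    simp only [map_sum, map_smul, smul_eq_mul, h1, mul_comm]
  rw [key, key]
  exact hs _ _

lemma densityPd_eq_zero {R : ℝ} (hR : ∀ x u, R < |x| → φ x u = 0) (a : Fin 2) {z : ℝ × Plane}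
    (hz : R < |z.1|) : densityPd φ a z = 0 := by
  have : φ z.1 = fun _ => 0 := funext fun u => hR _ u hz
  simp [densityPd, this, pd_const]

lemma contDiff_varDeriv (hφ : IsDensity φ) {X : ℝ → Plane} {n : WithTop ℕ∞} (hn : n ≤ ∞)
    (hX : ContDiff ℝ n X) : ContDiff ℝ n (varDeriv φ X) :=
  contDiff_pi.mpr fun a => ((contDiff_densityPd hφ a).of_le hn).comp (contDiff_id.prodMk hX)

end Densities

/-- The coefficients of `Ω` are of class `C^1`, `g` is symmetric and
`∂_c g^{ab} = b^{ab}_c + b^{ba}_c`: these relations amount to the skew-symmetry of the bracket. -/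
structure HydroOp.SkewCoeffs (Ω : HydroOp) (W : Set Plane) : Prop where
  contDiff_g : ∀ a b, ContDiffOn ℝ 1 (Ω.g a b) W
  contDiff_b : ∀ a b c, ContDiffOn ℝ 1 (Ω.b a b c) W
  symm : ∀ u ∈ W, ∀ a b, Ω.g a b u = Ω.g b a u
  pd_g : ∀ u ∈ W, ∀ a b c, pd c (Ω.g a b) u = Ω.b a b c u + Ω.b b a c u

section Bracket

variable {Ω : HydroOp} {W : Set Plane} {X : ℝ → Plane}

lemma IsMap.hasDerivAt (hX : IsMap W X) (x : ℝ) : HasDerivAt X (deriv X x) x :=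
  (hX.1.differentiable (by simp) x).hasDerivAt

lemma IsMap.continuous_deriv (hX : IsMap W X) : Continuous (deriv X) :=
  hX.1.continuous_deriv (by simp)

lemma continuous_comp_map {F : Plane → ℝ} (hF : ContinuousOn F W) (hX : IsMap W X) :
    Continuous fun x => F (X x) :=
  hF.comp_continuous hX.1.continuous hX.2

lemma continuous_pd_comp_map {F : Plane → ℝ} (hW : IsOpen W) (hF : ContDiffOn ℝ 1 F W)
    (hX : IsMap W X) (c : Fin 2) : Continuous fun x => pd c F (X x) :=
  continuous_comp_map (contDiffOn_pd (m := 0) hF hW (by simp) c).continuousOn hX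

lemma hasDerivAt_comp_map {F : Plane → ℝ} (hW : IsOpen W) (hF : ContDiffOn ℝ 1 F W)
    (hX : IsMap W X) (x : ℝ) :
    HasDerivAt (fun x => F (X x)) (∑ c, pd c F (X x) * deriv X x c) x :=
  hasDerivAt_comp_curve (differentiableAt_of_contDiffOn hF (by simp) hW (hX.2 x)) (hX.hasDerivAt x)

lemma hasDerivAt_varDeriv {φ : ℝ → Plane → ℝ} (hφ : IsDensity φ) (hX : IsMap W X) (x : ℝ) :
    HasDerivAt (varDeriv φ X) (deriv (varDeriv φ X) x) x :=
  ((contDiff_varDeriv hφ le_rfl hX.1).differentiable (by simp) x).hasDerivAt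

lemma continuous_deriv_varDeriv {φ : ℝ → Plane → ℝ} (hφ : IsDensity φ) (hX : IsMap W X) :
    Continuous (deriv (varDeriv φ X)) :=
  (contDiff_varDeriv hφ le_rfl hX.1).continuous_deriv (by simp)

/-- The vector `Ω^{ab} δH/δX^b` of a density is of class `C^1` along a smooth map. -/
lemma contDiff_apply_varDeriv (hg : ∀ a b, ContDiffOn ℝ 1 (Ω.g a b) W)
    (hb : ∀ a b c, ContDiffOn ℝ 1 (Ω.b a b c) W) {χ : ℝ → Plane → ℝ} (hχ : IsDensity χ)
    (hX : IsMap W X) : ContDiff ℝ 1 fun x => Ω.apply X (varDeriv χ X) x := by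
  have hfun : (fun x => Ω.apply X (varDeriv χ X) x) = fun x =>
      Ω.flow (X x) (deriv X x) (varDeriv χ X x) (deriv (varDeriv χ X) x) := by
    ext1 x
    exact Ω.apply_eq_flow (hX.hasDerivAt x) (hasDerivAt_varDeriv hχ hX x)
  have hcomp : ∀ {F : Plane → ℝ}, ContDiffOn ℝ 1 F W → ContDiff ℝ 1 fun x => F (X x) := by
    intro F hF
    have := hF.comp (s := univ) (hX.1.of_le (by simp)).contDiffOn fun x _ => hX.2 x
    exact contDiffOn_univ.mp this
  have hdX : ∀ c, ContDiff ℝ 1 fun x => deriv X x c := fun c =>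
    contDiff_pi.mp ((contDiff_infty_iff_deriv.mp hX.1).2.of_le (by simp)) c
  have hθ := contDiff_varDeriv hχ le_rfl hX.1
  have hθ0 : ∀ c, ContDiff ℝ 1 fun x => varDeriv χ X x c := fun c =>
    contDiff_pi.mp (hθ.of_le (by simp)) c
  have hθ1 : ∀ c, ContDiff ℝ 1 fun x => deriv (varDeriv χ X) x c := fun c =>
    contDiff_pi.mp ((contDiff_infty_iff_deriv.mp hθ).2.of_le (by simp)) c
  rw [hfun]
  refine contDiff_pi.mpr fun a => ContDiff.sum fun b _ => ?_
  exact ((hcomp (hg a b)).mul (hθ1 b)).add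
    ((ContDiff.sum fun c _ => (hcomp (hb a b c)).mul (hdX c)).mul (hθ0 b))

lemma varDeriv_eq_zero {φ : ℝ → Plane → ℝ} {R : ℝ} (hR : ∀ x u, R < |x| → φ x u = 0) {x : ℝ}
    (hx : R < |x|) (X : ℝ → Plane) : varDeriv φ X x = 0 :=
  funext fun a => densityPd_eq_zero hR a (z := (x, X x)) hx

lemma apply_varDeriv_eq_zero {φ : ℝ → Plane → ℝ} {R : ℝ} (hR : ∀ x u, R < |x| → φ x u = 0) {x : ℝ}
    (hx : R < |x|) (X : ℝ → Plane) : Ω.apply X (varDeriv φ X) x = 0 := by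
  have hev : ∀ b, (fun y => varDeriv φ X y b) =ᶠ[𝓝 x] fun _ => 0 := by
    intro b
    filter_upwards [(isOpen_lt continuous_const continuous_abs).mem_nhds hx] with y hy
    rw [varDeriv_eq_zero hR hy]
    rfl
  ext a
  simp [HydroOp.apply, (hev _).deriv_eq, varDeriv_eq_zero hR hx]

end Bracket

/-! ### The variation of the bracket -/

section Variation

variable {Ω : HydroOp} {W : Set Plane} {X η η' : ℝ → Plane}

/-- A compactly supported perturbation of a map to an open set stays in that set. -/
lemma exists_perturbation_mem (hW : IsOpen W) (hX : IsMap W X) (hη : Continuous η) {R : ℝ}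
    (hR : ∀ x, R < |x| → η x = 0) :
    ∃ δ : ℝ, 0 < δ ∧ ∀ ε ∈ Ioo (-δ) δ, ∀ x, X x + ε • η x ∈ W := by
  have hcont : Continuous fun z : ℝ × ℝ => X z.2 + z.1 • η z.2 := by
    have := hX.1.continuous
    fun_prop
  have hopen : IsOpen ((fun z : ℝ × ℝ => X z.2 + z.1 • η z.2) ⁻¹' W) := hW.preimage hcont
  have hsub : ({0} : Set ℝ) ×ˢ Icc (-R) R ⊆ (fun z : ℝ × ℝ => X z.2 + z.1 • η z.2) ⁻¹' W := by
    rintro ⟨ε, x⟩ ⟨hε, -⟩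
    simp only [mem_singleton_iff] at hε
    simp [hε, hX.2 x]
  obtain ⟨u, v, hu, -, h0, hv, huv⟩ :=
    generalized_tube_lemma isCompact_singleton isCompact_Icc hopen hsub
  obtain ⟨δ, hδ, hball⟩ := Metric.isOpen_iff.mp hu 0 (h0 rfl)
  refine ⟨δ, hδ, fun ε hε x => ?_⟩
  by_cases hx : R < |x|
  · simp [hR x hx, hX.2 x]
  · have hmem : (ε, x) ∈ u ×ˢ v := ⟨hball ?_, hv (abs_le.mp (not_lt.mp hx))⟩
    · exact huv hmem
    rw [Real.ball_eq_Ioo]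
    simpa using hε

variable {I : Set ℝ}

lemma hasParamDeriv_comp {F : Plane → ℝ} (hW : IsOpen W) (hF : ContDiffOn ℝ 1 F W)
    (hX : Continuous X) (hη : Continuous η) (hI : ∀ ε ∈ I, ∀ x, X x + ε • η x ∈ W) :
    HasParamDeriv I (fun ε x => F (X x + ε • η x))
      (fun ε x => ∑ c, pd c F (X x + ε • η x) * η x c) := by
  have hmap : MapsTo (fun z : ℝ × ℝ => X z.2 + z.1 • η z.2) (I ×ˢ univ) W :=
    fun z hz => hI z.1 hz.1 z.2
  have hc : ContinuousOn (fun z : ℝ × ℝ => X z.2 + z.1 • η z.2) (I ×ˢ univ) := by fun_prop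
  refine ⟨hF.continuousOn.comp hc hmap, continuousOn_finsetSum _ fun c _ => ?_, fun ε hε x => ?_⟩
  · exact ((contDiffOn_pd (m := 0) hF hW (by simp) c).continuousOn.comp hc hmap).mul (by fun_prop)
  · have h1 : HasDerivAt (fun ε : ℝ => X x + ε • η x) (η x) ε := by
      simpa using ((hasDerivAt_id ε).smul_const (η x)).const_add (X x)
    exact hasDerivAt_comp_curve (differentiableAt_of_contDiffOn hF (by simp) hW (hI ε hε x)) h1

lemma hasParamDeriv_velocity (hX : Continuous X) (hη : Continuous η) (c : Fin 2) :
    HasParamDeriv I (fun ε x => (X x + ε • η x) c) (fun _ x => η x c) := by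
  refine ⟨by fun_prop, by fun_prop, fun ε hε x => ?_⟩
  simpa using ((hasDerivAt_id ε).mul_const (η x c)).const_add (X x c)

lemma hasParamDeriv_density {q : ℝ × Plane → ℝ} (hq : ContDiff ℝ ∞ q)
    (hX : Continuous X) (hη : Continuous η) :
    HasParamDeriv I (fun ε x => q (x, X x + ε • η x))
      (fun ε x => fderiv ℝ q (x, X x + ε • η x) (0, η x)) := by
  have h1 : Continuous (fderiv ℝ q) := hq.continuous_fderiv (by simp)
  refine ⟨?_, ?_, fun ε hε x => ?_⟩
  · have := hq.continuous
    exact Continuous.continuousOn (by fun_prop)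
  · exact Continuous.continuousOn (by fun_prop)
  · have h2 : HasDerivAt (fun ε : ℝ => (x, X x + ε • η x)) ((0 : ℝ), η x) ε := by
      refine (hasDerivAt_const ε x).prodMk ?_
      simpa using ((hasDerivAt_id ε).smul_const (η x)).const_add (X x)
    exact ((hq.differentiable (by simp) _).hasFDerivAt).comp_hasDerivAt ε h2

lemma hasParamDeriv_density_velocity {q : ℝ × Plane → ℝ} (hq : ContDiff ℝ ∞ q) {v : ℝ → Plane}
    (hX : Continuous X) (hη : Continuous η) (hv : Continuous v) (hη' : Continuous η') :
    HasParamDeriv I (fun ε x => fderiv ℝ q (x, X x + ε • η x) (1, v x + ε • η' x))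
      (fun ε x => fderiv ℝ (fderiv ℝ q) (x, X x + ε • η x) (0, η x) (1, v x + ε • η' x)
        + fderiv ℝ q (x, X x + ε • η x) (0, η' x)) := by
  have hq1 : ContDiff ℝ ∞ (fderiv ℝ q) := hq.fderiv_right (m := ∞) (by simp)
  have h1 : Continuous (fderiv ℝ q) := hq1.continuous
  have h2 : Continuous (fderiv ℝ (fderiv ℝ q)) := hq1.continuous_fderiv (by simp)
  refine ⟨?_, ?_, fun ε hε x => ?_⟩
  · exact Continuous.continuousOn (by fun_prop)
  · exact Continuous.continuousOn (by fun_prop)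
  · have h3 : HasDerivAt (fun ε : ℝ => (x, X x + ε • η x)) ((0 : ℝ), η x) ε := by
      refine (hasDerivAt_const ε x).prodMk ?_
      simpa using ((hasDerivAt_id ε).smul_const (η x)).const_add (X x)
    have h4 : HasDerivAt (fun ε : ℝ => ((1 : ℝ), v x + ε • η' x)) ((0 : ℝ), η' x) ε := by
      refine (hasDerivAt_const ε 1).prodMk ?_
      simpa using ((hasDerivAt_id ε).smul_const (η' x)).const_add (v x)
    exact (((hq1.differentiable (by simp) _).hasFDerivAt).comp_hasDerivAt ε h3).clm_apply h4

lemma hasDerivAt_densityPd_comp {ψ : ℝ → Plane → ℝ} (hψ : IsDensity ψ) {Y : ℝ → Plane} {v : Plane}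
    {x : ℝ} (hY : HasDerivAt Y v x) (b : Fin 2) :
    HasDerivAt (fun y => varDeriv ψ Y y b) (fderiv ℝ (densityPd ψ b) (x, Y x) (1, v)) x :=
  HasFDerivAt.comp_hasDerivAt (f := fun y => (y, Y y)) x
    (((contDiff_densityPd hψ b).differentiable (by simp) (x, Y x)).hasFDerivAt)
    ((hasDerivAt_id' x).prodMk hY)

/-- The variation of `δψ/δX` when the curve moves with velocity `η`. -/
def varHess (ψ : ℝ → Plane → ℝ) (X η : ℝ → Plane) (x : ℝ) : Plane := fun b =>
  fderiv ℝ (densityPd ψ b) (x, X x) (0, η x)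

/-- The derivative of `varHess` along the curve. -/
def varHessDeriv (ψ : ℝ → Plane → ℝ) (X η η' : ℝ → Plane) (x : ℝ) : Plane := fun b =>
  fderiv ℝ (fderiv ℝ (densityPd ψ b)) (x, X x) (0, η x) (1, deriv X x)
    + fderiv ℝ (densityPd ψ b) (x, X x) (0, η' x)

lemma hasDerivAt_varHess {ψ : ℝ → Plane → ℝ} (hψ : IsDensity ψ) (hX : IsMap W X) {x : ℝ}
    (hη : HasDerivAt η (η' x) x) (b : Fin 2) :
    HasDerivAt (fun y => varHess ψ X η y b) (varHessDeriv ψ X η η' x b) x := by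
  have hq1 : ContDiff ℝ ∞ (fderiv ℝ (densityPd ψ b)) :=
    (contDiff_densityPd hψ b).fderiv_right (m := ∞) (by simp)
  have hs : IsSymmSndFDerivAt ℝ (densityPd ψ b) (x, X x) :=
    (contDiff_densityPd hψ b).contDiffAt.isSymmSndFDerivAt (by
      simpa using WithTop.coe_le_coe.mpr (le_top : (2 : ℕ∞) ≤ ⊤))
  have h3 : HasDerivAt (fun y : ℝ => (y, X y)) ((1 : ℝ), deriv X x) x :=
    (hasDerivAt_id x).prodMk (hX.hasDerivAt x)
  have h4 : HasDerivAt (fun y : ℝ => ((0 : ℝ), η y)) ((0 : ℝ), η' x) x :=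
    (hasDerivAt_const x 0).prodMk hη
  have h5 : HasDerivAt (fun y => fderiv ℝ (densityPd ψ b) (y, X y))
      (fderiv ℝ (fderiv ℝ (densityPd ψ b)) (x, X x) (1, deriv X x)) x :=
    HasFDerivAt.comp_hasDerivAt (f := fun y => (y, X y)) x
      ((hq1.differentiable (by simp) (x, X x)).hasFDerivAt) h3
  have h6 := h5.clm_apply h4
  rw [← hs (0, η x) (1, deriv X x)] at h6
  exact h6

/-- The derivative of the bracket when the curve moves with velocity `η`. -/
lemma hasDerivAt_bracket (hW : IsOpen W) (hg : ∀ a b, ContDiffOn ℝ 1 (Ω.g a b) W)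
    (hb : ∀ a b c, ContDiffOn ℝ 1 (Ω.b a b c) W) {φ ψ : ℝ → Plane → ℝ} (hφ : IsDensity φ)
    (hψ : IsDensity ψ) (hX : IsMap W X) (hη : ∀ x, HasDerivAt η (η' x) x) (hη' : Continuous η')
    {R : ℝ} (hR : ∀ x, R < |x| → η x = 0) {D : ℝ → ℝ}
    (hD : ∀ x, D x = ∑ a, (varHess φ X η x a *
        Ω.flow (X x) (deriv X x) (varDeriv ψ X x) (deriv (varDeriv ψ X) x) a
      + varDeriv φ X x a *
        (Ω.flow (X x) (deriv X x) (varHess ψ X η x) (varHessDeriv ψ X η η' x) a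
        + Ω.dflow (X x) (deriv X x) (η x) (η' x) (varDeriv ψ X x) (deriv (varDeriv ψ X) x) a))) :
    Integrable D ∧ Continuous D ∧
      HasDerivAt (fun ε : ℝ => Ω.bracket φ ψ fun x => X x + ε • η x) (∫ x, D x) 0 := by
  have hXc := hX.1.continuous
  have hηc : Continuous η := continuous_iff_continuousAt.mpr fun x => (hη x).continuousAt
  have hvc := hX.continuous_deriv
  obtain ⟨δ, hδ, hI⟩ := exists_perturbation_mem hW hX hηc hR
  obtain ⟨R', hR'⟩ := hφ.2
  have hF := HasParamDeriv.sum (I := Ioo (-δ) δ) fun a : Fin 2 =>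
    (hasParamDeriv_density (I := Ioo (-δ) δ) (contDiff_densityPd hφ a) hXc hηc).mul
      (HasParamDeriv.sum fun b : Fin 2 =>
        ((hasParamDeriv_comp hW (hg a b) hXc hηc hI).mul
          (hasParamDeriv_density_velocity (contDiff_densityPd hψ b) hXc hηc hvc hη')).add
        ((HasParamDeriv.sum fun c : Fin 2 =>
          (hasParamDeriv_comp hW (hb a b c) hXc hηc hI).mul
            (hasParamDeriv_velocity hvc hη' c)).mul
          (hasParamDeriv_density (contDiff_densityPd hψ b) hXc hηc)))
  have hβ : ∀ x b, deriv (varDeriv ψ X) x b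
      = fderiv ℝ (densityPd ψ b) (x, X x) (1, deriv X x) := fun x b =>
    (hasDerivAt_pi.mp (hasDerivAt_varDeriv hψ hX x) b).unique
      (hasDerivAt_densityPd_comp hψ (hX.hasDerivAt x) b)
  obtain ⟨h1, h2, h3⟩ := hF.hasDerivAt_integral (R := R') hδ (D := D) (fun ε x hx => by
    refine Finset.sum_eq_zero fun a _ => ?_
    rw [densityPd_eq_zero hR' a (z := (x, X x + ε • η x)) hx, zero_mul]) (fun x => by
    rw [hD]
    simp only [zero_smul, add_zero]
    refine Finset.sum_congr rfl fun a _ => ?_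
    simp only [HydroOp.flow, HydroOp.dflow, varHess, varHessDeriv, hβ, ← Finset.sum_add_distrib]
    congr 2
    refine Finset.sum_congr rfl fun b _ => ?_
    simp only [varDeriv, densityPd]
    ring)
  refine ⟨h1, h2, h3.congr_of_eventuallyEq (Eventually.of_forall fun ε => ?_)⟩
  simp only [HydroOp.bracket]
  congr 1
  ext1 x
  refine Finset.sum_congr rfl fun a _ => ?_
  have hY : HasDerivAt (fun x => X x + ε • η x) (deriv X x + ε • η' x) x :=
    (hX.hasDerivAt x).add ((hη x).const_smul ε)
  have hθ : HasDerivAt (varDeriv ψ fun x => X x + ε • η x) (fun b =>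
      fderiv ℝ (densityPd ψ b) (x, X x + ε • η x) (1, deriv X x + ε • η' x)) x :=
    hasDerivAt_pi.mpr fun b => hasDerivAt_densityPd_comp hψ hY b
  rw [Ω.apply_eq_flow hY hθ]
  rfl

/-- What remains of the variation of the bracket, after integration by parts, when the covectors do
not depend on the curve. -/
def HydroOp.reducedVar (Ω : HydroOp) (u v α α' β β' η : Plane) : ℝ :=
  ∑ a, ∑ b, ∑ c, ((Ω.b b a c u * α a * β' b - Ω.b a b c u * α' a * β b) * η c
    + ∑ d, α a * β b * (pd d (Ω.b a b c) u - pd c (Ω.b a b d) u) * v c * η d)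

set_option maxHeartbeats 800000 in
/-- The reduced variation of the bracket: the Hessian terms and `HydroOp.reducedVar`. -/
lemma exists_integral_bracket_variation (hW : IsOpen W) (hΩ : Ω.SkewCoeffs W)
    {φ ψ χ : ℝ → Plane → ℝ} (hφ : IsDensity φ) (hψ : IsDensity ψ) (hχ : IsDensity χ)
    (hX : IsMap W X) {D : ℝ → ℝ} (hη : ∀ x, η x = Ω.apply X (varDeriv χ X) x)
    (hD : ∀ x, D x = ∑ a, (varHess φ X η x a * Ω.apply X (varDeriv ψ X) x a
        - varHess ψ X η x a * Ω.apply X (varDeriv φ X) x a)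
      + Ω.reducedVar (X x) (deriv X x) (varDeriv φ X x) (deriv (varDeriv φ X) x)
        (varDeriv ψ X x) (deriv (varDeriv ψ X) x) (η x)) :
    Integrable D ∧ Ω.bracket₂ φ ψ χ X = ∫ x, D x := by
  have hη1 : ContDiff ℝ 1 η := by
    rw [show η = _ from funext hη]
    exact contDiff_apply_varDeriv hΩ.contDiff_g hΩ.contDiff_b hχ hX
  obtain ⟨Rχ, hRχ⟩ := hχ.2
  obtain ⟨R, hR⟩ := hφ.2
  have hηd : ∀ x, HasDerivAt η (deriv η x) x := fun x =>
    (hη1.differentiable (by simp) x).hasDerivAt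
  have hη' : Continuous (deriv η) := hη1.continuous_deriv (by simp)
  obtain ⟨h1, h2, h3⟩ := hasDerivAt_bracket hW hΩ.contDiff_g hΩ.contDiff_b hφ hψ hX hηd hη'
    (R := Rχ) (fun x hx => by rw [hη]; exact apply_varDeriv_eq_zero hRχ hx X)
    (fun x => rfl)
  set E : ℝ → ℝ := fun x => ∑ a, (varHess φ X η x a *
        Ω.flow (X x) (deriv X x) (varDeriv ψ X x) (deriv (varDeriv ψ X) x) a
      + varDeriv φ X x a *
        (Ω.flow (X x) (deriv X x) (varHess ψ X η x) (varHessDeriv ψ X η (deriv η) x) a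
        + Ω.dflow (X x) (deriv X x) (η x) (deriv η x) (varDeriv ψ X x) (deriv (varDeriv ψ X) x) a))
    with hE
  have hbr : Ω.bracket₂ φ ψ χ X = ∫ x, E x := by
    simp only [HydroOp.bracket₂, ← hη]
    exact h3.deriv
  have hα : ∀ x a, HasDerivAt (fun y => varDeriv φ X y a) (deriv (varDeriv φ X) x a) x :=
    fun x a => hasDerivAt_pi.mp (hasDerivAt_varDeriv hφ hX x) a
  have hβ : ∀ x a, HasDerivAt (fun y => varDeriv ψ X y a) (deriv (varDeriv ψ X) x a) x :=
    fun x a => hasDerivAt_pi.mp (hasDerivAt_varDeriv hψ hX x) a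
  have hηa : ∀ x a, HasDerivAt (fun y => η y a) (deriv η x a) x :=
    fun x a => hasDerivAt_pi.mp (hηd x) a
  -- the two integrands differ by the derivative of `α_a g^{ab} (δψ_b)˙ + α_a β_b b^{ab}_c η^c`
  have hB : ∀ x, HasDerivAt (fun y => ∑ a, ∑ b,
      (Ω.g a b (X y) * varDeriv φ X y a * varHess ψ X η y b
      + ∑ c, varDeriv φ X y a * varDeriv ψ X y b * Ω.b a b c (X y) * η y c)) (E x - D x) x := by
    intro x
    have hraw := HasDerivAt.fun_sum (u := Finset.univ) fun (a : Fin 2) _ =>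
      HasDerivAt.fun_sum (u := Finset.univ) fun (b : Fin 2) _ =>
      (((hasDerivAt_comp_map hW (hΩ.contDiff_g a b) hX x).fun_mul (hα x a)).fun_mul
        (hasDerivAt_varHess hψ hX (hηd x) b)).fun_add
      (HasDerivAt.fun_sum (u := Finset.univ) fun (c : Fin 2) _ =>
        (((hα x a).fun_mul (hβ x b)).fun_mul
          (hasDerivAt_comp_map hW (hΩ.contDiff_b a b c) hX x)).fun_mul (hηa x c))
    refine hraw.congr_deriv ?_
    rw [hD, Ω.apply_eq_flow (hX.hasDerivAt x) (hasDerivAt_varDeriv hφ hX x),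
      Ω.apply_eq_flow (hX.hasDerivAt x) (hasDerivAt_varDeriv hψ hX x)]
    simp only [hE, HydroOp.flow, HydroOp.dflow, HydroOp.reducedVar, Fin.sum_univ_two,
      hΩ.pd_g _ (hX.2 x), hΩ.symm _ (hX.2 x) 1 0]
    ring
  have hDc : Continuous D := by
    have c1 := fun a b c => continuous_comp_map (hΩ.contDiff_b a b c).continuousOn hX
    have c2 := fun a b c d => continuous_pd_comp_map hW (hΩ.contDiff_b a b c) hX d
    have c3 : ∀ a, Continuous fun x => varHess φ X η x a := fun a =>
      continuous_iff_continuousAt.mpr fun x => (hasDerivAt_varHess hφ hX (hηd x) a).continuousAt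
    have c4 : ∀ a, Continuous fun x => varHess ψ X η x a := fun a =>
      continuous_iff_continuousAt.mpr fun x => (hasDerivAt_varHess hψ hX (hηd x) a).continuousAt
    have c5 : ∀ a, Continuous fun x => Ω.apply X (varDeriv φ X) x a := continuous_pi_iff.mp
      (contDiff_apply_varDeriv hΩ.contDiff_g hΩ.contDiff_b hφ hX).continuous
    have c6 : ∀ a, Continuous fun x => Ω.apply X (varDeriv ψ X) x a := continuous_pi_iff.mp
      (contDiff_apply_varDeriv hΩ.contDiff_g hΩ.contDiff_b hψ hX).continuous
    have c7 := continuous_pi_iff.mp hX.continuous_deriv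
    have c8 := continuous_pi_iff.mp (continuous_deriv_varDeriv hφ hX)
    have c9 := continuous_pi_iff.mp (continuous_deriv_varDeriv hψ hX)
    have c10 := continuous_pi_iff.mp (contDiff_varDeriv hφ le_rfl hX.1).continuous
    have c11 := continuous_pi_iff.mp (contDiff_varDeriv hψ le_rfl hX.1).continuous
    have c12 := continuous_pi_iff.mp hη1.continuous
    rw [show D = _ from funext hD]
    refine (continuous_finsetSum _ fun a _ =>
      ((c3 a).mul (c6 a)).sub ((c4 a).mul (c5 a))).add ?_
    refine continuous_finsetSum _ fun a _ => continuous_finsetSum _ fun b _ =>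
      continuous_finsetSum _ fun c _ => (((((c1 b a c).mul (c10 a)).mul (c9 b)).sub
        (((c1 a b c).mul (c8 a)).mul (c11 b))).mul (c12 c)).add
      (continuous_finsetSum _ fun d _ => ((((c10 a).mul (c11 b)).mul
        ((c2 a b c d).sub (c2 a b d c))).mul (c7 c)).mul (c12 d))
  have hBR : ∀ x, R < |x| → ∑ a, ∑ b, (Ω.g a b (X x) * varDeriv φ X x a * varHess ψ X η x b
      + ∑ c, varDeriv φ X x a * varDeriv ψ X x b * Ω.b a b c (X x) * η x c) = 0 := by
    intro x hx
    simp [varDeriv_eq_zero hR hx X]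
  obtain ⟨hi, h0⟩ := integral_eq_zero_of_hasDerivAt_of_vanish hB (h2.sub hDc) hBR
  have hDi : Integrable D := by
    have h4 : Integrable (fun x => E x - (E x - D x)) := h1.sub hi
    simpa only [sub_sub_cancel] using h4
  refine ⟨hDi, ?_⟩
  rw [hbr]
  rw [integral_sub h1 hDi] at h0
  linarith

/-- The integrand of the Jacobi identity, in terms of the point and the velocity of a curve, and of
three covectors with their derivatives. -/
def HydroOp.jacobiator (Ω : HydroOp) (u v α α' β β' γ γ' : Plane) : ℝ :=
  Ω.reducedVar u v α α' β β' (Ω.flow u v γ γ') + Ω.reducedVar u v β β' γ γ' (Ω.flow u v α α')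
    + Ω.reducedVar u v γ γ' α α' (Ω.flow u v β β')

/-- For a skew-symmetric bracket the Jacobi identity involves the densities only through their first
derivatives along the curve: by the skew-symmetry and the symmetry of the Hessians, the second
derivatives cancel in the cyclic sum. -/
theorem bracket₂_cyclic_sum (hW : IsOpen W) (hΩ : Ω.SkewCoeffs W)
    {φ ψ χ : ℝ → Plane → ℝ} (hφ : IsDensity φ) (hψ : IsDensity ψ) (hχ : IsDensity χ)
    (hX : IsMap W X) :
    Ω.bracket₂ φ ψ χ X + Ω.bracket₂ ψ χ φ X + Ω.bracket₂ χ φ ψ X =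
      ∫ x, Ω.jacobiator (X x) (deriv X x) (varDeriv φ X x) (deriv (varDeriv φ X) x)
        (varDeriv ψ X x) (deriv (varDeriv ψ X) x) (varDeriv χ X x) (deriv (varDeriv χ X) x) := by
  obtain ⟨i1, e1⟩ := exists_integral_bracket_variation hW hΩ hφ hψ hχ hX (fun x => rfl)
    (fun x => rfl)
  obtain ⟨i2, e2⟩ := exists_integral_bracket_variation hW hΩ hψ hχ hφ hX (fun x => rfl)
    (fun x => rfl)
  obtain ⟨i3, e3⟩ := exists_integral_bracket_variation hW hΩ hχ hφ hψ hX (fun x => rfl)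
    (fun x => rfl)
  have h3 : ∀ {f₁ f₂ f₃ : ℝ → ℝ}, Integrable f₁ → Integrable f₂ → Integrable f₃ →
      (∫ x, f₁ x) + (∫ x, f₂ x) + ∫ x, f₃ x = ∫ x, (f₁ x + f₂ x + f₃ x) := fun i1 i2 i3 => by
    rw [← integral_add i1 i2]
    exact (integral_add (i1.add i2) i3).symm
  rw [e1, e2, e3, h3 i1 i2 i3]
  congr 1
  ext1 x
  have hflow : ∀ {θ : ℝ → Plane → ℝ}, IsDensity θ → Ω.apply X (varDeriv θ X) x =
      Ω.flow (X x) (deriv X x) (varDeriv θ X x) (deriv (varDeriv θ X) x) := fun hθ =>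
    Ω.apply_eq_flow (hX.hasDerivAt x) (hasDerivAt_varDeriv hθ hX x)
  have s1 := sum_fderiv_densityPd_comm hφ (x, X x) (Ω.apply X (varDeriv χ X) x)
    (Ω.apply X (varDeriv ψ X) x)
  have s2 := sum_fderiv_densityPd_comm hψ (x, X x) (Ω.apply X (varDeriv φ X) x)
    (Ω.apply X (varDeriv χ X) x)
  have s3 := sum_fderiv_densityPd_comm hχ (x, X x) (Ω.apply X (varDeriv ψ X) x)
    (Ω.apply X (varDeriv φ X) x)
  simp only [HydroOp.jacobiator, ← hflow hφ, ← hflow hψ, ← hflow hχ,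
    Finset.sum_sub_distrib, varHess]
  linarith

/-- The symmetric part of the bracket of two densities. -/
theorem bracket_add_bracket (hg : ∀ a b, ContDiffOn ℝ 1 (Ω.g a b) W)
    (hb : ∀ a b c, ContDiffOn ℝ 1 (Ω.b a b c) W) {φ ψ : ℝ → Plane → ℝ} (hφ : IsDensity φ)
    (hψ : IsDensity ψ) (hX : IsMap W X) :
    Ω.bracket φ ψ X + Ω.bracket ψ φ X =
      ∫ x, ∑ a, (varDeriv φ X x a *
          Ω.flow (X x) (deriv X x) (varDeriv ψ X x) (deriv (varDeriv ψ X) x) a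
        + varDeriv ψ X x a *
          Ω.flow (X x) (deriv X x) (varDeriv φ X x) (deriv (varDeriv φ X) x) a) := by
  have hflow : ∀ {θ : ℝ → Plane → ℝ}, IsDensity θ → ∀ x, Ω.apply X (varDeriv θ X) x =
      Ω.flow (X x) (deriv X x) (varDeriv θ X x) (deriv (varDeriv θ X) x) := fun hθ x =>
    Ω.apply_eq_flow (hX.hasDerivAt x) (hasDerivAt_varDeriv hθ hX x)
  have hint : ∀ {φ ψ : ℝ → Plane → ℝ}, IsDensity φ → IsDensity ψ →
      Integrable fun x => ∑ a, varDeriv φ X x a * Ω.apply X (varDeriv ψ X) x a := by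
    intro φ ψ hφ hψ
    obtain ⟨R, hR⟩ := hφ.2
    refine integrable_of_continuous_of_vanish (R := R) ?_ fun x hx => by
      simp [varDeriv_eq_zero hR hx X]
    have c1 := (contDiff_apply_varDeriv hg hb hψ hX).continuous
    have c2 := (contDiff_varDeriv hφ le_rfl hX.1).continuous
    fun_prop
  simp only [HydroOp.bracket]
  rw [← integral_add (hint hφ hψ) (hint hψ hφ)]
  simp only [hflow hφ, hflow hψ, Finset.sum_add_distrib]

end Variation

/-! ### Consequences of the Poisson property -/

section TestFunctions

/-- A continuous function that is orthogonal to the squares of all smooth functions with compact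
support vanishes. -/
lemma eq_zero_of_forall_integral_mul_sq {w : ℝ → ℝ} (hw : Continuous w)
    (h : ∀ f : ℝ → ℝ, ContDiff ℝ ∞ f → (∃ R, ∀ x, R < |x| → f x = 0) → ∫ x, w x * f x ^ 2 = 0) :
    w 0 = 0 := by
  have key : ∀ w : ℝ → ℝ, Continuous w → 0 < w 0 → ∃ f : ℝ → ℝ, ContDiff ℝ ∞ f ∧
      (∃ R, ∀ x, R < |x| → f x = 0) ∧ 0 < ∫ x, w x * f x ^ 2 := by
    intro w hw h0
    obtain ⟨r, hr, hball⟩ := Metric.isOpen_iff.mp (isOpen_lt continuous_const hw) 0 h0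
    let f : ContDiffBump (0 : ℝ) := ⟨r / 2, r, by positivity, by linarith⟩
    have hsupp : ∀ x : ℝ, r ≤ |x| → f x = 0 := fun x hx =>
      f.zero_of_le_dist (by simpa [Real.dist_eq] using hx)
    refine ⟨f, f.contDiff, ⟨r, fun x hx => hsupp x hx.le⟩, ?_⟩
    refine Continuous.integral_pos_of_hasCompactSupport_nonneg_nonzero (x := 0)
      (hw.mul (f.continuous.pow 2)) ?_ ?_ ?_
    · refine HasCompactSupport.intro (isCompact_Icc (a := -r) (b := r)) fun x hx => ?_
      rw [hsupp x, zero_pow two_ne_zero, mul_zero]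
      by_contra hlt
      exact hx (abs_le.mp (not_le.mp hlt).le)
    · intro x
      by_cases hx : r ≤ |x|
      · simp [hsupp x hx]
      · have : 0 < w x := hball (by simpa [Real.dist_eq] using hx)
        simp only [Pi.zero_apply]
        positivity
    · have : f 0 = 1 := f.one_of_mem_closedBall (by simp [f]; positivity)
      simp [this, h0.ne']
  rcases lt_trichotomy (w 0) 0 with h0 | h0 | h0
  · obtain ⟨f, hf, hR, hpos⟩ := key (fun x => -w x) hw.neg (by simpa using h0)
    have := h f hf hR
    simp only [neg_mul, integral_neg] at hpos
    linarith
  · exact h0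
  · obtain ⟨f, hf, hR, hpos⟩ := key w hw h0
    exact absurd (h f hf hR) hpos.ne'

lemma exists_cutoff (R : ℝ) : ∃ k : ℝ → ℝ, ContDiff ℝ ∞ k ∧ (∃ R', ∀ x, R' < |x| → k x = 0) ∧
    ∀ x, |x| ≤ R → k x = 1 ∧ deriv k x = 0 := by
  let f : ContDiffBump (0 : ℝ) := ⟨|R| + 1, |R| + 2, by positivity, by linarith⟩
  refine ⟨f, f.contDiff, ⟨|R| + 2, fun x hx => f.zero_of_le_dist (by
    simpa [Real.dist_eq, f] using hx.le)⟩, fun x hx => ?_⟩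
  have h1 : ∀ y : ℝ, |y| < |R| + 1 → f y = 1 := fun y hy =>
    f.one_of_mem_closedBall (by simpa [f] using hy.le)
  have hx' : |x| < |R| + 1 := by linarith [le_abs_self R]
  refine ⟨h1 x hx', ?_⟩
  have hev : f =ᶠ[𝓝 x] fun _ => 1 := by
    filter_upwards [(isOpen_lt continuous_abs continuous_const).mem_nhds hx'] with y hy
    exact h1 y hy
  rw [hev.deriv_eq]
  simp

lemma deriv_eq_zero_of_vanish {f : ℝ → ℝ} {R : ℝ} (h : ∀ x, R < |x| → f x = 0) {x : ℝ}
    (hx : R < |x|) : deriv f x = 0 := by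
  have hev : f =ᶠ[𝓝 x] fun _ => 0 := by
    filter_upwards [(isOpen_lt continuous_const continuous_abs).mem_nhds hx] with y hy
    exact h y hy
  rw [hev.deriv_eq]
  simp

lemma isDensity_linear {f : ℝ → ℝ} (hf : ContDiff ℝ ∞ f) (hR : ∃ R, ∀ x, R < |x| → f x = 0)
    (a : Fin 2) : IsDensity fun x u => f x * u a := by
  obtain ⟨R, hR⟩ := hR
  refine ⟨?_, R, fun x u hx => by simp [hR x hx]⟩
  have : ContDiff ℝ ∞ fun z : ℝ × Plane => z.2 a := by fun_prop
  exact (hf.comp contDiff_fst).mul this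

lemma varDeriv_linear (f : ℝ → ℝ) (a : Fin 2) (X : ℝ → Plane) :
    varDeriv (fun x u => f x * u a) X = fun x => Pi.single a (f x) := by
  ext x b
  have h : HasFDerivAt (fun u : Plane => f x * u a)
      (f x • ContinuousLinearMap.proj (R := ℝ) (φ := fun _ : Fin 2 => ℝ) a) (X x) :=
    (ContinuousLinearMap.proj (R := ℝ) (φ := fun _ : Fin 2 => ℝ) a).hasFDerivAt.const_mul (f x)
  simp [varDeriv, pd, h.fderiv, Pi.single_apply, eq_comm]

lemma deriv_single {f : ℝ → ℝ} (hf : ContDiff ℝ ∞ f) (a : Fin 2) :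
    deriv (fun x => (Pi.single a (f x) : Plane)) = fun x => Pi.single a (deriv f x) := by
  ext1 x
  refine HasDerivAt.deriv (hasDerivAt_pi.mpr fun b => ?_)
  rcases eq_or_ne b a with rfl | hb
  · simpa using (hf.differentiable (by simp) x).hasDerivAt
  · simpa [hb] using hasDerivAt_const x (0 : ℝ)

variable {W : Set Plane} {u : Plane}

lemma isMap_const (hu : u ∈ W) : IsMap W fun _ => u :=
  ⟨contDiff_const, fun _ => hu⟩

/-- There is a map to `W` through `u` in each coordinate direction. -/
lemma exists_isMap (hW : IsOpen W) (hu : u ∈ W) (c : Fin 2) :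
    ∃ X : ℝ → Plane, ∃ δ : ℝ, δ ≠ 0 ∧ IsMap W X ∧ X 0 = u ∧ deriv X 0 = Pi.single c δ := by
  obtain ⟨r, hr, hball⟩ := Metric.isOpen_iff.mp hW u hu
  have hd : ∀ x : ℝ, HasDerivAt (fun x : ℝ => u + Real.sin x • (Pi.single c (r / 2) : Plane))
      (Real.cos x • (Pi.single c (r / 2) : Plane)) x := fun x =>
    ((Real.hasDerivAt_sin x).smul_const _).const_add u
  refine ⟨fun x => u + Real.sin x • (Pi.single c (r / 2) : Plane), r / 2, by positivity,
    ⟨?_, fun x => hball ?_⟩, by simp, by rw [(hd 0).deriv]; simp⟩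
  · exact contDiff_const.add (Real.contDiff_sin.smul contDiff_const)
  · rw [Metric.mem_ball, dist_eq_norm, add_sub_cancel_left, norm_smul, Pi.norm_single,
      Real.norm_eq_abs, Real.norm_eq_abs, abs_of_pos (half_pos hr)]
    have := Real.abs_sin_le_one x
    nlinarith

end TestFunctions

section Necessity

variable {Ω : HydroOp} {W : Set Plane} {u : Plane}

/-- The skew-symmetry of the bracket at a constant map, for the densities `f(x) u^a` and
`x f(x) u^b`. -/
lemma HydroOp.IsPoisson.symm (h : Ω.IsPoisson W) (hu : u ∈ W) (a b : Fin 2) :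
    Ω.g a b u = Ω.g b a u := by
  have key := eq_zero_of_forall_integral_mul_sq (w := fun _ => (Ω.g a b u - Ω.g b a u) / 2)
    continuous_const ?_
  · linarith
  intro f hf ⟨R, hR⟩
  have hk : ContDiff ℝ ∞ fun x : ℝ => x * f x := contDiff_id.mul hf
  have hkR : ∀ x, R < |x| → x * f x = 0 := fun x hx => by rw [hR x hx, mul_zero]
  have hfd : ∀ x, HasDerivAt f (deriv f x) x := fun x =>
    (hf.differentiable (by simp) x).hasDerivAt
  have hf' : Continuous (deriv f) := hf.continuous_deriv (by simp)
  have hkd : ∀ x, deriv (fun x : ℝ => x * f x) x = f x + x * deriv f x := fun x => by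
    simpa using ((hasDerivAt_id' x).fun_mul (hfd x)).deriv
  have hφ := isDensity_linear hf ⟨R, hR⟩ a
  have hψ := isDensity_linear hk ⟨R, hkR⟩ b
  have h0 := h.skew _ _ hφ hψ _ (isMap_const hu)
  have h1 := bracket_add_bracket h.contDiff_g h.contDiff_b hφ hψ (isMap_const hu)
  rw [h0, neg_add_cancel] at h1
  -- the integrand differs from a multiple of `f ^ 2` by a multiple of the derivative of `x * f ^ 2`
  obtain ⟨i2, h2⟩ := integral_eq_zero_of_hasDerivAt_of_vanish (R := R)
    (f := fun x => (Ω.g a b u + Ω.g b a u) / 2 * (x * f x * f x))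
    (f' := fun x => (Ω.g a b u + Ω.g b a u) / 2 *
      ((1 * f x + x * deriv f x) * f x + x * f x * deriv f x))
    (fun x => (((hasDerivAt_id' x).fun_mul (hfd x)).fun_mul (hfd x)).const_mul _)
    (by have := hf.continuous; fun_prop) (fun x hx => by simp [hR x hx])
  have i3 : Integrable fun x => (Ω.g a b u - Ω.g b a u) / 2 * f x ^ 2 :=
    integrable_of_continuous_of_vanish (R := R) (by have := hf.continuous; fun_prop)
      (fun x hx => by simp [hR x hx])
  have h3 := integral_add i3 i2
  rw [h2, add_zero] at h3
  rw [← h3, h1]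
  congr 1
  ext1 x
  simp only [varDeriv_linear, deriv_single hf, deriv_single hk, hkd, HydroOp.flow, deriv_const]
  fin_cases a <;> fin_cases b <;> simp [Fin.sum_univ_two] <;> ring

/-- The relation `∂_c g^{ab} = b^{ab}_c + b^{ba}_c` comes from the densities `f(x) u^a` and
`f(x) u^b` along a map whose velocity at one point is a multiple of the `c`-th basis vector. -/
lemma HydroOp.IsPoisson.skewCoeffs (hW : IsOpen W) (h : Ω.IsPoisson W) : Ω.SkewCoeffs W := by
  refine ⟨h.contDiff_g, h.contDiff_b, fun u hu a b => h.symm hu a b, fun u hu a b c => ?_⟩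
  obtain ⟨X, δ, hδ, hX, h0, hX'⟩ := exists_isMap hW hu c
  have hgX : ∀ x, HasDerivAt (fun x => Ω.g a b (X x)) (∑ d, pd d (Ω.g a b) (X x) * deriv X x d) x :=
    hasDerivAt_comp_map hW (h.contDiff_g a b) hX
  have c1 : Continuous fun x => Ω.g a b (X x) :=
    continuous_comp_map (h.contDiff_g a b).continuousOn hX
  have c2 : ∀ d, Continuous fun x => pd d (Ω.g a b) (X x) :=
    continuous_pd_comp_map hW (h.contDiff_g a b) hX
  have c3 : ∀ a b c, Continuous fun x => Ω.b a b c (X x) := fun a b c =>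
    continuous_comp_map (h.contDiff_b a b c).continuousOn hX
  have c4 := hX.continuous_deriv
  have hwc : Continuous fun x => ∑ d, (Ω.b a b d (X x) + Ω.b b a d (X x) - pd d (Ω.g a b) (X x))
      * deriv X x d := by fun_prop
  have key := eq_zero_of_forall_integral_mul_sq hwc ?_
  · rw [h0, hX'] at key
    have : (Ω.b a b c u + Ω.b b a c u - pd c (Ω.g a b) u) * δ = 0 := by
      simpa [Pi.single_apply] using key
    have := (mul_eq_zero.mp this).resolve_right hδ
    linarith
  intro f hf ⟨R, hR⟩
  have hfd : ∀ x, HasDerivAt f (deriv f x) x := fun x =>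
    (hf.differentiable (by simp) x).hasDerivAt
  have hf' : Continuous (deriv f) := hf.continuous_deriv (by simp)
  have hfc := hf.continuous
  have hφ := isDensity_linear hf ⟨R, hR⟩ a
  have hψ := isDensity_linear hf ⟨R, hR⟩ b
  have h0 := h.skew _ _ hφ hψ _ hX
  have h1 := bracket_add_bracket h.contDiff_g h.contDiff_b hφ hψ hX
  rw [h0, neg_add_cancel] at h1
  obtain ⟨i2, h2⟩ := integral_eq_zero_of_hasDerivAt_of_vanish (R := R)
    (f := fun x => Ω.g a b (X x) * (f x * f x))
    (f' := fun x => (∑ d, pd d (Ω.g a b) (X x) * deriv X x d) * (f x * f x)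
      + Ω.g a b (X x) * (deriv f x * f x + f x * deriv f x))
    (fun x => (hgX x).fun_mul ((hfd x).fun_mul (hfd x))) (by fun_prop)
    (fun x hx => by simp [hR x hx])
  have i3 : Integrable fun x => (∑ d, (Ω.b a b d (X x) + Ω.b b a d (X x) - pd d (Ω.g a b) (X x))
      * deriv X x d) * f x ^ 2 :=
    integrable_of_continuous_of_vanish (R := R) (by fun_prop) (fun x hx => by simp [hR x hx])
  have h3 := integral_add i3 i2
  rw [h2, add_zero] at h3
  rw [← h3, h1]
  congr 1
  ext1 x
  have hs := h.symm (hX.2 x) 0 1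
  simp only [varDeriv_linear, deriv_single hf, HydroOp.flow]
  fin_cases a <;> fin_cases b <;> simp [Fin.sum_univ_two, hs] <;> ring

lemma HydroOp.SkewCoeffs.contDiff_two (hW : IsOpen W) (h : Ω.SkewCoeffs W) (a b : Fin 2) :
    ContDiffOn ℝ 2 (Ω.g a b) W := by
  have := contDiffOn_succ_of_pd (n := 1) hW ((h.contDiff_g a b).differentiableOn (by simp))
    fun c => ((h.contDiff_b a b c).add (h.contDiff_b b a c)).congr fun u hu => h.pd_g u hu a b c
  simpa [one_add_one_eq_two] using this

/-- The part of `∂_d b^{ab}_c - ∂_c b^{ab}_d` that is symmetric in `a, b` vanishes, being the curl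
of a gradient. -/
lemma HydroOp.SkewCoeffs.curl_b (hW : IsOpen W) (h : Ω.SkewCoeffs W) (hu : u ∈ W)
    (a b : Fin 2) : pd 1 (Ω.b a b 0) u - pd 0 (Ω.b a b 1) u
      = -(pd 1 (Ω.b b a 0) u - pd 0 (Ω.b b a 1) u) := by
  have hd : ∀ a b c, DifferentiableAt ℝ (Ω.b a b c) u := fun a b c =>
    differentiableAt_of_contDiffOn (h.contDiff_b a b c) (by simp) hW hu
  have h1 := pd_comm (h.contDiff_two hW a b) hW hu 1 0
  rw [pd_congr_on hW (fun w hw => h.pd_g w hw a b 0) hu, pd_add (hd _ _ _) (hd _ _ _),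
    pd_congr_on hW (fun w hw => h.pd_g w hw a b 1) hu, pd_add (hd _ _ _) (hd _ _ _)] at h1
  linarith

/-- The Jacobi identity for densities that are linear in the dependent variables. -/
lemma HydroOp.IsPoisson.integral_jacobiator (hW : IsOpen W) (h : Ω.IsPoisson W) {X : ℝ → Plane}
    (hX : IsMap W X) {f k l : ℝ → ℝ} (hf : ContDiff ℝ ∞ f) (hfR : ∃ R, ∀ x, R < |x| → f x = 0)
    (hk : ContDiff ℝ ∞ k) (hkR : ∃ R, ∀ x, R < |x| → k x = 0)
    (hl : ContDiff ℝ ∞ l) (hlR : ∃ R, ∀ x, R < |x| → l x = 0) (a b d : Fin 2) :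
    ∫ x, Ω.jacobiator (X x) (deriv X x) (Pi.single a (f x)) (Pi.single a (deriv f x))
      (Pi.single b (k x)) (Pi.single b (deriv k x)) (Pi.single d (l x)) (Pi.single d (deriv l x))
      = 0 := by
  have hφ := isDensity_linear hf hfR a
  have hψ := isDensity_linear hk hkR b
  have hχ := isDensity_linear hl hlR d
  have h0 := h.jacobi _ _ _ hφ hψ hχ _ hX
  rw [bracket₂_cyclic_sum hW (h.skewCoeffs hW) hφ hψ hχ hX] at h0
  simpa only [varDeriv_linear, deriv_single hf, deriv_single hk, deriv_single hl] using h0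

/-- The terms with two derivatives in the Jacobi identity. At a constant map, with `f = 1` on the
support of `k`, the densities `f(x) u^a`, `k(x) u^1`, `k(x) u^0` leave a multiple of the integral of
`k'^2`. -/
lemma HydroOp.IsPoisson.g_mul_b (hW : IsOpen W) (h : Ω.IsPoisson W) (hu : u ∈ W) (a : Fin 2) :
    ∑ c, Ω.g 0 c u * Ω.b 1 a c u = ∑ c, Ω.g 1 c u * Ω.b 0 a c u := by
  obtain ⟨k, hk, ⟨R, hkR⟩, hk1⟩ := exists_cutoff 0
  obtain ⟨f, hf, hfR, hf1⟩ := exists_cutoff R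
  have h0 := h.integral_jacobiator hW (isMap_const hu) hf hfR hk ⟨R, hkR⟩ hk ⟨R, hkR⟩ a 1 0
  set E : ℝ := ∑ c, Ω.g 0 c u * Ω.b 1 a c u - ∑ c, Ω.g 1 c u * Ω.b 0 a c u with hE
  have hint : ∀ x, Ω.jacobiator u (deriv (fun _ : ℝ => u) x) (Pi.single a (f x))
      (Pi.single a (deriv f x)) (Pi.single 1 (k x)) (Pi.single 1 (deriv k x)) (Pi.single 0 (k x))
      (Pi.single 0 (deriv k x)) = E * deriv k x ^ 2 := by
    intro x
    by_cases hx : R < |x|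
    · simp [hkR x hx, deriv_eq_zero_of_vanish hkR hx, HydroOp.jacobiator, HydroOp.reducedVar,
        HydroOp.flow]
    · rw [(hf1 x (not_lt.mp hx)).1, (hf1 x (not_lt.mp hx)).2]
      have hs := h.symm hu 0 1
      simp only [HydroOp.jacobiator, HydroOp.reducedVar, HydroOp.flow, Fin.sum_univ_two, hE,
        deriv_const]
      fin_cases a <;> simp [hs] <;> ring
  simp only [hint, integral_const_mul] at h0
  rcases mul_eq_zero.mp h0 with h1 | h1
  · linarith
  · exfalso
    have hk' : Continuous (deriv k) := hk.continuous_deriv (by simp)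
    have hz : ∀ x, deriv k x = 0 := by
      intro x
      by_contra hne
      refine (Continuous.integral_pos_of_hasCompactSupport_nonneg_nonzero (x := x)
        (f := fun x => deriv k x ^ 2) (by fun_prop) ?_ (fun x => by positivity)
        (by simpa using hne)).ne' h1
      refine HasCompactSupport.intro (isCompact_Icc (a := -R) (b := R)) fun x hx => ?_
      rw [deriv_eq_zero_of_vanish hkR, zero_pow two_ne_zero]
      by_contra hlt
      exact hx (abs_le.mp (not_lt.mp hlt))
    have hc := is_const_of_deriv_eq_zero (hk.differentiable (by simp)) hz 0 (|R| + 1)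
    rw [(hk1 0 (by simp)).1, hkR (|R| + 1)] at hc
    · exact one_ne_zero hc
    · rw [abs_of_pos (by positivity)]
      linarith [le_abs_self R]

/-- The terms with one derivative in the Jacobi identity, isolated by the densities `f(x) u^i`,
`k(x) u^j`, `x f(x) u^i` with `k = 1` on the support of `f`, for which the integrand is a multiple
of `f^2`. -/
lemma HydroOp.IsPoisson.curl_eq (hW : IsOpen W) (h : Ω.IsPoisson W) (hu : u ∈ W) {i j : Fin 2}
    (hij : i ≠ j) (e : Fin 2) :
    ∑ c, (Ω.g c i u * (pd c (Ω.b i j e) u - pd e (Ω.b i j c) u)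
      + Ω.b i j c u * Ω.b c i e u - Ω.b i i c u * Ω.b c j e u) = 0 := by
  obtain ⟨X, δ, hδ, hX, h0, hX'⟩ := exists_isMap hW hu e
  have hΩ := h.skewCoeffs hW
  have c1 : ∀ a b, Continuous fun x => Ω.g a b (X x) := fun a b =>
    continuous_comp_map (h.contDiff_g a b).continuousOn hX
  have c2 : ∀ a b c, Continuous fun x => Ω.b a b c (X x) := fun a b c =>
    continuous_comp_map (h.contDiff_b a b c).continuousOn hX
  have c3 : ∀ a b c d, Continuous fun x => pd d (Ω.b a b c) (X x) := fun a b c d =>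
    continuous_pd_comp_map hW (h.contDiff_b a b c) hX d
  have c4 := hX.continuous_deriv
  have hwc : Continuous fun x => ∑ e, (∑ c,
      (Ω.g c i (X x) * (pd c (Ω.b i j e) (X x) - pd e (Ω.b i j c) (X x))
      + Ω.b i j c (X x) * Ω.b c i e (X x) - Ω.b i i c (X x) * Ω.b c j e (X x))) * deriv X x e := by
    fun_prop
  have key := eq_zero_of_forall_integral_mul_sq hwc ?_
  · rw [h0, hX'] at key
    have : (∑ c, (Ω.g c i u * (pd c (Ω.b i j e) u - pd e (Ω.b i j c) u)
      + Ω.b i j c u * Ω.b c i e u - Ω.b i i c u * Ω.b c j e u)) * δ = 0 := by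
      simpa only [Pi.single_apply, mul_ite, mul_zero, Finset.sum_ite_eq', Finset.mem_univ, if_true]
        using key
    exact (mul_eq_zero.mp this).resolve_right hδ
  intro f hf ⟨R, hR⟩
  obtain ⟨k, hk, hkR, hk1⟩ := exists_cutoff R
  have hl : ContDiff ℝ ∞ fun x : ℝ => x * f x := contDiff_id.mul hf
  have hlR : ∀ x, R < |x| → x * f x = 0 := fun x hx => by rw [hR x hx, mul_zero]
  have hfd : ∀ x, HasDerivAt f (deriv f x) x := fun x =>
    (hf.differentiable (by simp) x).hasDerivAt
  have hld : ∀ x, deriv (fun x : ℝ => x * f x) x = f x + x * deriv f x := fun x => by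
    simpa using ((hasDerivAt_id' x).fun_mul (hfd x)).deriv
  have h1 := h.integral_jacobiator hW hX hf ⟨R, hR⟩ hk hkR hl ⟨R, hlR⟩ i j i
  rw [← h1]
  congr 1
  ext1 x
  by_cases hx : R < |x|
  · simp [hR x hx, hld, deriv_eq_zero_of_vanish hR hx, HydroOp.jacobiator, HydroOp.reducedVar,
      HydroOp.flow]
  · rw [(hk1 x (not_lt.mp hx)).1, (hk1 x (not_lt.mp hx)).2]
    have hs := h.symm (hX.2 x) 0 1
    have e1 := hΩ.curl_b hW (hX.2 x) 0 0
    have e2 := hΩ.curl_b hW (hX.2 x) 1 1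
    have e3 := hΩ.curl_b hW (hX.2 x) 0 1
    have e1' : pd 1 (Ω.b 0 0 0) (X x) = pd 0 (Ω.b 0 0 1) (X x) := by linarith
    have e2' : pd 1 (Ω.b 1 1 0) (X x) = pd 0 (Ω.b 1 1 1) (X x) := by linarith
    have e3' : pd 1 (Ω.b 0 1 0) (X x) = pd 0 (Ω.b 0 1 1) (X x)
      - (pd 1 (Ω.b 1 0 0) (X x) - pd 0 (Ω.b 1 0 1) (X x)) := by linarith
    simp only [HydroOp.jacobiator, HydroOp.reducedVar, HydroOp.flow, Fin.sum_univ_two, hld]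
    fin_cases i <;> fin_cases j
    · exact absurd rfl hij
    · simp [hs, e1', e2', e3']
      ring
    · simp [hs, e1', e2', e3']
      ring
    · exact absurd rfl hij

end Necessity

/-! ### The structure equations of a Hamiltonian formulation -/

/-- The coefficient `∂_j λ^i / (λ^j - λ^i)`: it is `A` for `(i, j) = (0, 1)` and `B` for
`(i, j) = (1, 0)`, which lets both be treated at once. -/
def coef (lam : Fin 2 → Plane → ℝ) (i j : Fin 2) (u : Plane) : ℝ :=
  pd j (lam i) u / (lam j u - lam i u)

/-- The standing assumptions on the characteristic velocities. -/
structure IsDiagSystem (lam : Fin 2 → Plane → ℝ) (W : Set Plane) : Prop where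
  isOpen : IsOpen W
  contDiff : ∀ a, ContDiffOn ℝ 6 (lam a) W
  ne : ∀ u ∈ W, ∀ i j, i ≠ j → lam i u ≠ lam j u
  coef_ne : ∀ u ∈ W, ∀ i j, i ≠ j → coef lam i j u ≠ 0

lemma sum_fin_two_of_ne {i j : Fin 2} (hij : i ≠ j) (f : Fin 2 → ℝ) : ∑ c, f c = f i + f j := by
  fin_cases i <;> fin_cases j
  · exact absurd rfl hij
  · exact Fin.sum_univ_two f
  · rw [Fin.sum_univ_two, add_comm]; rfl
  · exact absurd rfl hij

section Coef

variable {lam : Fin 2 → Plane → ℝ} {W : Set Plane} {u : Plane}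

lemma IsDiagSystem.mono (h : IsDiagSystem lam W) {V : Set Plane} (hV : IsOpen V) (hVW : V ⊆ W) :
    IsDiagSystem lam V :=
  ⟨hV, fun a => (h.contDiff a).mono hVW, fun u hu => h.ne u (hVW hu),
    fun u hu => h.coef_ne u (hVW hu)⟩

lemma IsDiagSystem.contDiff_coef (h : IsDiagSystem lam W) {i j : Fin 2} (hij : i ≠ j) :
    ContDiffOn ℝ 5 (coef lam i j) W :=
  (contDiffOn_pd (h.contDiff i) h.isOpen (by norm_num) j).div
    (((h.contDiff j).sub (h.contDiff i)).of_le (by norm_num))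
    fun u hu => sub_ne_zero.mpr (h.ne u hu j i hij.symm)

lemma IsDiagSystem.pd_lam (h : IsDiagSystem lam W) (hu : u ∈ W) {i j : Fin 2} (hij : i ≠ j) :
    pd j (lam i) u = coef lam i j u * (lam j u - lam i u) := by
  rw [coef, div_mul_cancel₀]
  exact sub_ne_zero.mpr (h.ne u hu j i hij.symm)

end Coef

/-- A continuous function on an open set that has a zero in every nonempty open subset vanishes. -/
lemma eq_zero_of_dense_zeros {W : Set Plane} (hW : IsOpen W) {d : Plane → ℝ} (hd : ContinuousOn d W)
    (h : ∀ O ⊆ W, IsOpen O → O.Nonempty → ∃ w ∈ O, d w = 0) {u : Plane} (hu : u ∈ W) : d u = 0 := by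
  by_contra hne
  obtain ⟨w, hw, h0⟩ := h _ inter_subset_left (hd.isOpen_inter_preimage hW isOpen_ne) ⟨u, hu, hne⟩
  exact hw.2 h0

/-- The equations between the coefficients of an operator that express that it is the Poisson
operator of a Hamiltonian formulation. -/
structure StructureEqs (lam : Fin 2 → Plane → ℝ) (W : Set Plane) (Ω : HydroOp) : Prop where
  contDiff_g : ∀ a b, ContDiffOn ℝ 2 (Ω.g a b) W
  g_off : ∀ u ∈ W, ∀ i j, i ≠ j → Ω.g i j u = 0
  pd_g : ∀ u ∈ W, ∀ i j, i ≠ j → pd j (Ω.g i i) u = -2 * coef lam i j u * Ω.g i i u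
  b_diag : ∀ u ∈ W, ∀ i c, Ω.b i i c u = 1 / 2 * pd c (Ω.g i i) u
  b_fst : ∀ u ∈ W, ∀ i j, i ≠ j → Ω.b i j i u = coef lam i j u * Ω.g j j u
  b_snd : ∀ u ∈ W, ∀ i j, i ≠ j → Ω.b i j j u = -coef lam j i u * Ω.g i i u
  flat : ∀ u ∈ W, ∀ i j, i ≠ j →
    Ω.g i i u * (pd i (coef lam j i) u + coef lam j i u ^ 2)
      + 1 / 2 * coef lam j i u * pd i (Ω.g i i) u
      + Ω.g j j u * (pd j (coef lam i j) u + coef lam i j u ^ 2)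
      + 1 / 2 * coef lam i j u * pd j (Ω.g j j) u = 0

section Formulation

variable {lam : Fin 2 → Plane → ℝ} {W : Set Plane} {u : Plane} {Ω : HydroOp} {h : Plane → ℝ}

/-- The Hamiltonian system is the given one exactly when `λ^a δ^a_c` is the matrix of the linearised
flow. -/
lemma forall_isMap_iff (hW : IsOpen W) (hh : ContDiffOn ℝ 2 h W) :
    (∀ X, IsMap W X → ∀ x a,
      lam a (X x) * deriv (fun y => X y a) x = Ω.apply X (fun y b => pd b h (X y)) x a) ↔
    ∀ u ∈ W, ∀ a c, (if a = c then lam a u else 0) =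
      ∑ b, (Ω.g a b u * pd c (pd b h) u + Ω.b a b c u * pd b h u) := by
  have hflow : ∀ X, IsMap W X → ∀ x, Ω.apply X (fun y b => pd b h (X y)) x =
      Ω.flow (X x) (deriv X x) (fun b => pd b h (X x))
        (fun b => ∑ c, pd c (pd b h) (X x) * deriv X x c) := fun X hX x =>
    Ω.apply_eq_flow (hX.hasDerivAt x) (hasDerivAt_pi.mpr fun b =>
      hasDerivAt_comp_map hW (contDiffOn_pd (m := 1) hh hW (by norm_num) b) hX x)
  have hX' : ∀ X, IsMap W X → ∀ x a, deriv (fun y => X y a) x = deriv X x a := fun X hX x a =>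
    (hasDerivAt_pi.mp (hX.hasDerivAt x) a).deriv
  constructor
  · intro H u hu a c
    obtain ⟨X, δ, hδ, hX, h0, hd⟩ := exists_isMap hW hu c
    have := H X hX 0 a
    rw [hflow X hX, hX' X hX, h0, hd] at this
    have h2 : ((if a = c then lam a u else 0) - ∑ b, (Ω.g a b u * pd c (pd b h) u
        + Ω.b a b c u * pd b h u)) * δ = 0 := by
      simp only [HydroOp.flow, Pi.single_apply, mul_ite, mul_zero, Finset.sum_ite_eq',
        Finset.mem_univ, if_true] at this
      split_ifs at this ⊢ <;>
      · simp only [Fin.sum_univ_two] at this ⊢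
        linear_combination this
    linarith [(mul_eq_zero.mp h2).resolve_right hδ]
  · intro H X hX x a
    rw [hflow X hX, hX' X hX]
    have h0 := H (X x) (hX.2 x) a 0
    have h1 := H (X x) (hX.2 x) a 1
    simp only [HydroOp.flow, Fin.sum_univ_two] at h0 h1 ⊢
    have h2 : lam a (X x) * deriv X x a = (if a = 0 then lam a (X x) else 0) * deriv X x 0
        + (if a = 1 then lam a (X x) else 0) * deriv X x 1 := by
      fin_cases a <;> simp
    rw [h2, h0, h1]
    ring

variable {i j : Fin 2}

/-- The relations between the coefficients of a Hamiltonian formulation that hold before the second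
derivatives of the Hamiltonian are compared; `i ≠ j` are the two indices. -/
structure PreStructureEqs (lam : Fin 2 → Plane → ℝ) (W : Set Plane) (Ω : HydroOp) (h : Plane → ℝ) :
    Prop where
  skew : Ω.SkewCoeffs W
  contDiff_h : ContDiffOn ℝ 2 h W
  g_off : ∀ u ∈ W, ∀ i j, i ≠ j → Ω.g i j u = 0
  b_diag : ∀ u ∈ W, ∀ i c, Ω.b i i c u = 1 / 2 * pd c (Ω.g i i) u
  b_skew : ∀ u ∈ W, ∀ i j, i ≠ j → ∀ c, Ω.b j i c u = -Ω.b i j c u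
  lam_eq : ∀ u ∈ W, ∀ i j, i ≠ j → lam i u = Ω.g i i u * pd i (pd i h) u
    + 1 / 2 * pd i (Ω.g i i) u * pd i h u + Ω.b i j i u * pd j h u
  zero_eq : ∀ u ∈ W, ∀ i j, i ≠ j → 0 = Ω.g i i u * pd j (pd i h) u
    + 1 / 2 * pd j (Ω.g i i) u * pd i h u + Ω.b i j j u * pd j h u
  rel : ∀ u ∈ W, ∀ i j, i ≠ j → Ω.g i i u * Ω.b i j i u = -(1 / 2) * Ω.g j j u * pd j (Ω.g i i) u
  curl : ∀ u ∈ W, ∀ i j, i ≠ j → Ω.g i i u * (pd i (Ω.b i j j) u - pd j (Ω.b i j i) u)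
    = 1 / 2 * pd i (Ω.g i i) u * Ω.b i j j u + 1 / 4 * pd j (Ω.g i i) u * pd j (Ω.g j j) u
      - 1 / 2 * Ω.b i j i u * pd j (Ω.g i i) u + Ω.b i j j u ^ 2

lemma IsHamiltonianFormulation.pre (hl : IsDiagSystem lam W)
    (H : IsHamiltonianFormulation lam W Ω h) : PreStructureEqs lam W Ω h := by
  obtain ⟨hP, hh, hsys⟩ := H
  have hW := hl.isOpen
  have hS := hP.skewCoeffs hW
  rw [forall_isMap_iff hW hh] at hsys
  have hoff0 : ∀ u ∈ W, Ω.g 0 1 u = 0 := by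
    -- `λ^a g^{ad} = (∇^a ∇_c h) g^{cd}` is symmetric in `a, d`
    intro u hu
    have h1 := hP.g_mul_b hW hu 0
    have h2 := hP.g_mul_b hW hu 1
    have h00 := hsys u hu 0 0
    have h01 := hsys u hu 0 1
    have h10 := hsys u hu 1 0
    have h11 := hsys u hu 1 1
    have hc := pd_comm hh hW hu 0 1
    have hs := hS.symm u hu 1 0
    have key : (lam 0 u - lam 1 u) * Ω.g 0 1 u = 0 := by
      simp only [Fin.sum_univ_two, hs, hc] at h1 h2 h00 h01 h10 h11
      simp only [if_true, zero_ne_one, one_ne_zero, if_false] at h00 h01 h10 h11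
      linear_combination Ω.g 0 1 u * h00 + Ω.g 1 1 u * h01 - Ω.g 0 0 u * h10 - Ω.g 0 1 u * h11
        - pd 0 h u * h1 - pd 1 h u * h2
    exact (mul_eq_zero.mp key).resolve_left (sub_ne_zero.mpr (hl.ne u hu 0 1 (by decide)))
  have hoff : ∀ u ∈ W, ∀ i j, i ≠ j → Ω.g i j u = 0 := by
    intro u hu i j hij
    fin_cases i <;> fin_cases j
    · exact absurd rfl hij
    · exact hoff0 u hu
    · exact (hS.symm u hu 1 0).trans (hoff0 u hu)
    · exact absurd rfl hij
  have hdiag : ∀ u ∈ W, ∀ i c, Ω.b i i c u = 1 / 2 * pd c (Ω.g i i) u := fun u hu i c => by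
    rw [hS.pd_g u hu]; ring
  have hskew : ∀ u ∈ W, ∀ i j, i ≠ j → ∀ c, Ω.b j i c u = -Ω.b i j c u := by
    intro u hu i j hij c
    have h1 := hS.pd_g u hu i j c
    rw [pd_congr_on hW (fun w hw => hoff w hw i j hij) hu, pd_const] at h1
    linarith
  have hgb : ∀ u ∈ W, ∀ i j, i ≠ j → ∀ a, ∑ c, Ω.g i c u * Ω.b j a c u
      = ∑ c, Ω.g j c u * Ω.b i a c u := by
    intro u hu i j hij a
    fin_cases i <;> fin_cases j
    · exact absurd rfl hij
    · exact hP.g_mul_b hW hu a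
    · exact (hP.g_mul_b hW hu a).symm
    · exact absurd rfl hij
  refine ⟨hS, hh, hoff, hdiag, hskew, ?_, ?_, ?_, ?_⟩
  · intro u hu i j hij
    have := hsys u hu i i
    rw [if_pos rfl, sum_fin_two_of_ne hij, hoff u hu i j hij, hdiag u hu i i] at this
    rw [this]; ring
  · intro u hu i j hij
    have := hsys u hu i j
    rw [if_neg hij, sum_fin_two_of_ne hij, hoff u hu i j hij, hdiag u hu i j] at this
    rw [this]; ring
  · intro u hu i j hij
    have := hgb u hu i j hij i
    rw [sum_fin_two_of_ne hij, sum_fin_two_of_ne hij, hoff u hu i j hij, hoff u hu j i hij.symm,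
      hskew u hu i j hij, hdiag u hu i j] at this
    linear_combination -this
  · intro u hu i j hij
    have := hP.curl_eq hW hu hij j
    rw [sum_fin_two_of_ne hij, hoff u hu j i hij.symm, hskew u hu i j hij, hdiag u hu i i,
      hdiag u hu i j, hdiag u hu j j] at this
    linear_combination this

namespace PreStructureEqs

variable (hl : IsDiagSystem lam W) (H : PreStructureEqs lam W Ω h)
include hl H

/-- `∂_j g^{ii} = -2 c_{ij} g^{ii}` where `g^{ii}` does not vanish: there the derivative of the
Hamiltonian has enough regularity to compare its mixed second derivatives. -/
lemma pd_g_of_ne (hij : i ≠ j) (hu : u ∈ W) (h0 : Ω.g i i u ≠ 0) :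
    pd j (Ω.g i i) u = -2 * coef lam i j u * Ω.g i i u := by
  have hW := hl.isOpen
  set O : Set Plane := W ∩ {w | Ω.g i i w ≠ 0} with hO
  have hOo : IsOpen O := (H.skew.contDiff_g i i).continuousOn.isOpen_inter_preimage hW isOpen_ne
  have huO : u ∈ O := ⟨hu, h0⟩
  have hOW : O ⊆ W := inter_subset_left
  have cg : ∀ k, ContDiffOn ℝ 2 (Ω.g k k) W := fun k => H.skew.contDiff_two hW k k
  have cg' : ∀ k c, ContDiffOn ℝ 1 (pd c (Ω.g k k)) W := fun k c =>
    contDiffOn_pd (cg k) hW (by norm_num) c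
  have ch : ∀ k, ContDiffOn ℝ 1 (pd k h) W := fun k =>
    contDiffOn_pd H.contDiff_h hW (by norm_num) k
  have cb := H.skew.contDiff_b
  have cl : ContDiffOn ℝ 1 (lam i) W := (hl.contDiff i).of_le (by norm_num)
  -- on `O` the derivatives of `p = ∂_i h` are functions of class `C^1`
  have hp1 : ∀ w ∈ O, pd i (pd i h) w = (lam i w - 1 / 2 * pd i (Ω.g i i) w * pd i h w
      - Ω.b i j i w * pd j h w) / Ω.g i i w := fun w hw => by
    rw [eq_div_iff hw.2]
    linear_combination -H.lam_eq w hw.1 i j hij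
  have hp2 : ∀ w ∈ O, pd j (pd i h) w = (-(1 / 2) * pd j (Ω.g i i) w * pd i h w
      - Ω.b i j j w * pd j h w) / Ω.g i i w := fun w hw => by
    rw [eq_div_iff hw.2]
    linear_combination -H.zero_eq w hw.1 i j hij
  have c1 : ContDiffOn ℝ 1 (pd i (pd i h)) O := by
    refine ContDiffOn.congr ?_ hp1
    exact ((((cl.sub ((contDiffOn_const.mul (cg' i i)).mul (ch i))).sub
      ((cb i j i).mul (ch j))).mono hOW).div ((cg i).of_le (by norm_num) |>.mono hOW)
      fun w hw => hw.2)
  have c2 : ContDiffOn ℝ 1 (pd j (pd i h)) O := by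
    refine ContDiffOn.congr ?_ hp2
    exact (((((contDiffOn_const.mul (cg' i j)).mul (ch i))).sub
      ((cb i j j).mul (ch j))).mono hOW).div ((cg i).of_le (by norm_num) |>.mono hOW)
      fun w hw => hw.2
  have hpC : ContDiffOn ℝ 2 (pd i h) O := by
    have := contDiffOn_succ_of_pd (n := 1) hOo (((ch i).mono hOW).differentiableOn (by simp))
      (fun a => by
        rcases (show a = i ∨ a = j by fin_cases i <;> fin_cases j <;> fin_cases a <;> simp_all) with
          rfl | rfl
        · exact c1
        · exact c2)
    simpa [one_add_one_eq_two] using this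
  have hmix := pd_comm hpC hOo huO i j
  have dp : ∀ {F : Plane → ℝ}, ContDiffOn ℝ 1 F W → ∀ a, HasPd a F (pd a F u) u := fun hF =>
    HasPd.of_contDiffOn hF (by simp) hW hu
  have dpO : ∀ {F : Plane → ℝ}, ContDiffOn ℝ 1 F O → ∀ a, HasPd a F (pd a F u) u := fun hF =>
    HasPd.of_contDiffOn hF (by simp) hOo huO
  have cg1 : ∀ k, ContDiffOn ℝ 1 (Ω.g k k) W := fun k => (cg k).of_le (by norm_num)
  -- differentiate the two equations for `∂_i h`
  have D1 : pd j (lam i) u = pd j (Ω.g i i) u * pd i (pd i h) u + Ω.g i i u * pd j (pd i (pd i h)) u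
      + (1 / 2 * pd j (pd i (Ω.g i i)) u * pd i h u + 1 / 2 * pd i (Ω.g i i) u * pd j (pd i h) u)
      + (pd j (Ω.b i j i) u * pd j h u + Ω.b i j i u * pd j (pd j h) u) := by
    rw [pd_congr_on hW (fun w hw => H.lam_eq w hw i j hij) hu]
    exact (((dp (cg1 i) j).mul (dpO c1 j)).add ((((dp (cg' i i) j).const_mul (1 / 2)).mul
      (dp (ch i) j))) |>.add ((dp (cb i j i) j).mul (dp (ch j) j))).eq
  have D2 : 0 = pd i (Ω.g i i) u * pd j (pd i h) u + Ω.g i i u * pd i (pd j (pd i h)) u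
      + (1 / 2 * pd i (pd j (Ω.g i i)) u * pd i h u + 1 / 2 * pd j (Ω.g i i) u * pd i (pd i h) u)
      + (pd i (Ω.b i j j) u * pd j h u + Ω.b i j j u * pd i (pd j h) u) := by
    have := pd_congr_on hW (fun w hw => H.zero_eq w hw i j hij) hu i
    rw [pd_const] at this
    rw [this]
    exact (((dp (cg1 i) i).mul (dpO c2 i)).add ((((dp (cg' i j) i).const_mul (1 / 2)).mul
      (dp (ch i) i))) |>.add ((dp (cb i j j) i).mul (dp (ch j) i))).eq
  have hG := pd_comm (cg i) hW hu i j
  have hq := pd_comm H.contDiff_h hW hu i j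
  have e1 := H.lam_eq u hu i j hij
  have e2 := H.zero_eq u hu i j hij
  have e4 := H.lam_eq u hu j i hij.symm
  rw [H.b_skew u hu i j hij] at e4
  have r1 := H.rel u hu i j hij
  have f := H.curl u hu i j hij
  have key : (lam j u - lam i u) * (pd j (Ω.g i i) u + 2 * coef lam i j u * Ω.g i i u) = 0 := by
    have hl' := hl.pd_lam hu hij
    rw [hl'] at D1
    rw [hmix, hG, hq] at D2
    linear_combination 2 * Ω.g i i u * D1 - 2 * Ω.g i i u * D2 - 2 * pd j h u * f
      - pd j (Ω.g i i) u * e1 + pd i (Ω.g i i) u * e2 + 2 * pd j (pd j h) u * r1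
      + pd j (Ω.g i i) u * e4 + 2 * Ω.b i j j u * e2
  have := (mul_eq_zero.mp key).resolve_left (sub_ne_zero.mpr (hl.ne u hu j i hij.symm))
  linarith

lemma pd_g (hij : i ≠ j) (hu : u ∈ W) : pd j (Ω.g i i) u = -2 * coef lam i j u * Ω.g i i u := by
  have hW := hl.isOpen
  have key := eq_zero_of_dense_zeros hW
    (d := fun w => pd j (Ω.g i i) w + 2 * coef lam i j w * Ω.g i i w) ?_ ?_ hu
  · linarith
  · exact (contDiffOn_pd (m := 0) (H.skew.contDiff_g i i) hW (by simp) j).continuousOn.add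
      ((continuousOn_const.mul (hl.contDiff_coef hij).continuousOn).mul
        (H.skew.contDiff_g i i).continuousOn)
  · intro O hOW hO hne
    by_cases hex : ∃ w ∈ O, Ω.g i i w ≠ 0
    · obtain ⟨w, hw, h0⟩ := hex
      exact ⟨w, hw, by linarith [H.pd_g_of_ne hl hij (hOW hw) h0]⟩
    · push Not at hex
      obtain ⟨w, hw⟩ := hne
      refine ⟨w, hw, ?_⟩
      rw [pd_congr_on hO hex hw, pd_const, hex w hw]
      ring

/-- `g` cannot vanish identically on an open set, because the characteristic velocities are not
constant. -/
lemma exists_g_ne_zero (hij : i ≠ j) {O : Set Plane} (hOW : O ⊆ W) (hO : IsOpen O)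
    (hne : O.Nonempty) : ∃ w ∈ O, Ω.g i i w ≠ 0 ∨ Ω.g j j w ≠ 0 := by
  by_contra! hex
  have hg : ∀ w ∈ O, ∀ c, pd c (Ω.g i i) w = 0 ∧ pd c (Ω.g j j) w = 0 := fun w hw c => by
    rw [pd_congr_on hO (fun w hw => (hex w hw).1) hw, pd_congr_on hO (fun w hw => (hex w hw).2) hw]
    simp [pd_const]
  have heq : ∀ w ∈ O, lam i w = Ω.b i j i w * pd j h w ∧ 0 = Ω.b i j j w * pd j h w ∧
      0 = Ω.b i j i w * pd i h w ∧ lam j w = -(Ω.b i j j w * pd i h w) := fun w hw => by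
    have e1 := H.lam_eq w (hOW hw) i j hij
    have e2 := H.zero_eq w (hOW hw) i j hij
    have e3 := H.zero_eq w (hOW hw) j i hij.symm
    have e4 := H.lam_eq w (hOW hw) j i hij.symm
    rw [H.b_skew w (hOW hw) i j hij] at e3 e4
    simp only [(hex w hw).1, (hex w hw).2, hg w hw] at e1 e2 e3 e4
    exact ⟨by linarith, by linarith, by linarith, by linarith⟩
  have hcontra : ∀ {i j : Fin 2}, i ≠ j → ∀ {O : Set Plane}, O ⊆ W → IsOpen O → O.Nonempty →
      (∀ w ∈ O, lam i w = 0) → False := by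
    intro i j hij O hOW hO ⟨w, hw⟩ hz
    have h1 := hl.pd_lam (hOW hw) hij
    rw [pd_congr_on hO hz hw, pd_const] at h1
    rcases mul_eq_zero.mp h1.symm with h2 | h2
    · exact hl.coef_ne w (hOW hw) i j hij h2
    · exact hl.ne w (hOW hw) j i hij.symm (sub_eq_zero.mp h2)
  by_cases hli : ∃ w ∈ O, lam i w ≠ 0
  · obtain ⟨w, hw, h0⟩ := hli
    refine hcontra hij.symm (O := O ∩ {w | lam i w ≠ 0}) (inter_subset_left.trans hOW)
      (((hl.contDiff i).continuousOn.mono hOW).isOpen_inter_preimage hO isOpen_ne) ⟨w, hw, h0⟩ ?_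
    intro w hw
    obtain ⟨e1, e2, e3, e4⟩ := heq w hw.1
    have h3 : Ω.b i j i w * pd j h w ≠ 0 := e1 ▸ hw.2
    have h4 := (mul_eq_zero.mp e3.symm).resolve_left (left_ne_zero_of_mul h3)
    rw [e4, h4]; ring
  · push Not at hli
    exact hcontra hij hOW hO hne hli

/-- Where `g^{ii}` does not vanish, this follows from the algebraic relation `rel`. On an open set
where `g^{ii}` vanishes, `λ^i = b^{ij}_i ∂_j h`, and its `j`-th derivative gives the same formula. -/
lemma b_fst (hij : i ≠ j) (hu : u ∈ W) : Ω.b i j i u = coef lam i j u * Ω.g j j u := by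
  have hW := hl.isOpen
  have key := eq_zero_of_dense_zeros hW
    (d := fun w => Ω.b i j i w - coef lam i j w * Ω.g j j w) ?_ ?_ hu
  · linarith
  · exact (H.skew.contDiff_b i j i).continuousOn.sub ((hl.contDiff_coef hij).continuousOn.mul
      (H.skew.contDiff_g j j).continuousOn)
  · intro O hOW hO hne
    by_cases hex : ∃ w ∈ O, Ω.g i i w ≠ 0
    · obtain ⟨w, hw, h0⟩ := hex
      refine ⟨w, hw, ?_⟩
      have r1 := H.rel w (hOW hw) i j hij
      rw [H.pd_g hl hij (hOW hw)] at r1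
      refine (mul_eq_zero.mp ?_).resolve_left h0
      linear_combination r1
    · push Not at hex
      obtain ⟨w, hw, h0⟩ := H.exists_g_ne_zero hl hij hOW hO hne
      have h0 : Ω.g j j w ≠ 0 := h0.resolve_left (fun h => h (hex w hw))
      set O' : Set Plane := O ∩ {w | Ω.g j j w ≠ 0} with hO'
      have hO'o : IsOpen O' :=
        ((H.skew.contDiff_g j j).continuousOn.mono hOW).isOpen_inter_preimage hO isOpen_ne
      have hwO' : w ∈ O' := ⟨hw, h0⟩
      refine ⟨w, hw, ?_⟩
      have hgi : ∀ w ∈ O, ∀ c, pd c (Ω.g i i) w = 0 := fun w hw c => by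
        rw [pd_congr_on hO hex hw, pd_const]
      -- on `O'` one has `b^{ij}_j = 0` and `λ^i = b^{ij}_i ∂_j h`
      have hsj : ∀ w ∈ O', Ω.b i j j w = 0 := fun w hw => by
        have r2 := H.rel w (hOW hw.1) j i hij.symm
        rw [hex w hw.1, H.b_skew w (hOW hw.1) i j hij] at r2
        refine (mul_eq_zero.mp ?_).resolve_left hw.2
        linear_combination -r2
      have hli : ∀ w ∈ O', lam i w = Ω.b i j i w * pd j h w := fun w hw => by
        have e1 := H.lam_eq w (hOW hw.1) i j hij
        rw [hex w hw.1, hgi w hw.1 i] at e1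
        linear_combination e1
      have hD := pd_congr_on hO'o hli hwO' j
      have hbi : DifferentiableAt ℝ (Ω.b i j i) w :=
        differentiableAt_of_contDiffOn (H.skew.contDiff_b i j i) (by simp) hW (hOW hw)
      have hq : DifferentiableAt ℝ (pd j h) w :=
        differentiableAt_of_contDiffOn (contDiffOn_pd (m := 1) H.contDiff_h hW (by norm_num) j)
          (by simp) hW (hOW hw)
      rw [pd_mul hbi hq, hl.pd_lam (hOW hw) hij] at hD
      have f := H.curl w (hOW hw) j i hij.symm
      have hb1 : pd j (Ω.b j i i) w = -pd j (Ω.b i j i) w := by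
        rw [pd_congr_on hW (fun w hw => H.b_skew w hw i j hij i) (hOW hw), pd_neg]
      have hb2 : pd i (Ω.b j i j) w = 0 := by
        rw [pd_congr_on hW (fun w hw => H.b_skew w hw i j hij j) (hOW hw), pd_neg,
          pd_congr_on hO'o hsj hwO', pd_const, neg_zero]
      rw [hb1, hb2, H.b_skew w (hOW hw) i j hij, H.b_skew w (hOW hw) i j hij, hsj w hwO',
        hgi w hw i] at f
      have e4 := H.lam_eq w (hOW hw) j i hij.symm
      rw [H.b_skew w (hOW hw) i j hij, hsj w hwO'] at e4
      have e1 := hli w hwO'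
      have h5 : (lam j w - lam i w) * (Ω.b i j i w - coef lam i j w * Ω.g j j w) = 0 := by
        linear_combination (-Ω.g j j w) * hD + pd j h w * f + Ω.b i j i w * e4 - Ω.b i j i w * e1
      exact (mul_eq_zero.mp h5).resolve_left
        (sub_ne_zero.mpr (hl.ne w (hOW hw) j i hij.symm))

lemma b_snd (hij : i ≠ j) (hu : u ∈ W) : Ω.b i j j u = -coef lam j i u * Ω.g i i u := by
  have h1 := H.b_fst hl hij.symm hu
  rw [H.b_skew u hu i j hij] at h1
  linarith

lemma flat_of_ne (hij : i ≠ j) (hu : u ∈ W) (h0 : Ω.g i i u ≠ 0) :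
    Ω.g i i u * (pd i (coef lam j i) u + coef lam j i u ^ 2)
      + 1 / 2 * coef lam j i u * pd i (Ω.g i i) u
      + Ω.g j j u * (pd j (coef lam i j) u + coef lam i j u ^ 2)
      + 1 / 2 * coef lam i j u * pd j (Ω.g j j) u = 0 := by
  have hW := hl.isOpen
  have dg : ∀ k, DifferentiableAt ℝ (Ω.g k k) u := fun k =>
    differentiableAt_of_contDiffOn (H.skew.contDiff_g k k) (by simp) hW hu
  have dc : ∀ {i j : Fin 2}, i ≠ j → DifferentiableAt ℝ (coef lam i j) u := fun hij =>
    differentiableAt_of_contDiffOn (hl.contDiff_coef hij) (by simp) hW hu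
  have h1 : pd j (Ω.b i j i) u
      = pd j (coef lam i j) u * Ω.g j j u + coef lam i j u * pd j (Ω.g j j) u := by
    rw [pd_congr_on hW (fun w hw => H.b_fst hl hij hw) hu, pd_mul (dc hij) (dg j)]
  have h2 : pd i (Ω.b i j j) u
      = -pd i (coef lam j i) u * Ω.g i i u - coef lam j i u * pd i (Ω.g i i) u := by
    rw [pd_congr_on hW (fun w hw => H.b_snd hl hij hw) hu,
      ((HasPd.of_diff (dc hij.symm) i).neg.mul (HasPd.of_diff (dg i) i)).eq]
    ring
  have f := H.curl u hu i j hij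
  rw [h1, h2, H.b_fst hl hij hu, H.b_snd hl hij hu, H.pd_g hl hij hu] at f
  refine (mul_eq_zero.mp ?_).resolve_left h0
  linear_combination -f

lemma flat (hij : i ≠ j) (hu : u ∈ W) :
    Ω.g i i u * (pd i (coef lam j i) u + coef lam j i u ^ 2)
      + 1 / 2 * coef lam j i u * pd i (Ω.g i i) u
      + Ω.g j j u * (pd j (coef lam i j) u + coef lam i j u ^ 2)
      + 1 / 2 * coef lam i j u * pd j (Ω.g j j) u = 0 := by
  have hW := hl.isOpen
  refine eq_zero_of_dense_zeros hW (d := fun u =>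
    Ω.g i i u * (pd i (coef lam j i) u + coef lam j i u ^ 2)
      + 1 / 2 * coef lam j i u * pd i (Ω.g i i) u
      + Ω.g j j u * (pd j (coef lam i j) u + coef lam i j u ^ 2)
      + 1 / 2 * coef lam i j u * pd j (Ω.g j j) u) ?_ ?_ hu
  · have cg : ∀ k, ContinuousOn (Ω.g k k) W := fun k => (H.skew.contDiff_g k k).continuousOn
    have cg' : ∀ k c, ContinuousOn (pd c (Ω.g k k)) W := fun k c =>
      (contDiffOn_pd (m := 0) (H.skew.contDiff_g k k) hW (by simp) c).continuousOn
    have cc1 := (hl.contDiff_coef hij).continuousOn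
    have cc2 := (hl.contDiff_coef hij.symm).continuousOn
    have cc1' := (contDiffOn_pd (m := 4) (hl.contDiff_coef hij) hW (by norm_num) j).continuousOn
    have cc2' :=
      (contDiffOn_pd (m := 4) (hl.contDiff_coef hij.symm) hW (by norm_num) i).continuousOn
    fun_prop
  · intro O hOW hO hne
    obtain ⟨w, hw, h0 | h0⟩ := H.exists_g_ne_zero hl hij hOW hO hne
    · exact ⟨w, hw, H.flat_of_ne hl hij (hOW hw) h0⟩
    · refine ⟨w, hw, ?_⟩
      linarith [H.flat_of_ne hl hij.symm (hOW hw) h0]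

end PreStructureEqs

theorem IsHamiltonianFormulation.structureEqs (hl : IsDiagSystem lam W)
    (H : IsHamiltonianFormulation lam W Ω h) : StructureEqs lam W Ω :=
  have P := H.pre hl
  ⟨P.skew.contDiff_two hl.isOpen, P.g_off, fun _ hu _ _ hij => P.pd_g hl hij hu, P.b_diag,
    fun _ hu _ _ hij => P.b_fst hl hij hu, fun _ hu _ _ hij => P.b_snd hl hij hu,
    fun _ hu _ _ hij => P.flat hl hij hu⟩

end Formulation

/-! ### Linear first integrals and the Killing equations -/

section Geodesics

variable {Γ : Fin 2 → Fin 2 → Fin 2 → Plane → ℝ} {W : Set Plane} {u : Plane}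

/-- A geodesic with given initial data. -/
lemma exists_geodesic (hW : IsOpen W) (hΓ : ∀ a b c, ContDiffOn ℝ 1 (Γ a b c) W) (hu : u ∈ W)
    (v₀ : Plane) : ∃ (γ v : ℝ → Plane) (ε : ℝ), 0 < ε ∧ IsGeodesicOn Γ W γ v (-ε) ε ∧
      γ 0 = u ∧ v 0 = v₀ := by
  let f : Plane × Plane → Plane × Plane := fun z =>
    (z.2, fun a => -∑ b, ∑ c, Γ a b c z.1 * z.2 b * z.2 c)
  have hf : ContDiffAt ℝ 1 f (u, v₀) := by
    refine contDiffAt_snd.prodMk (contDiffAt_pi.mpr fun a => ContDiffAt.neg ?_)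
    refine ContDiffAt.sum fun b _ => ContDiffAt.sum fun c _ => ?_
    have h1 : ContDiffAt ℝ 1 (fun z : Plane × Plane => Γ a b c z.1) (u, v₀) :=
      ((hΓ a b c).contDiffAt (hW.mem_nhds hu)).comp (u, v₀) contDiffAt_fst
    have h2 : ∀ b, ContDiffAt ℝ 1 (fun z : Plane × Plane => z.2 b) (u, v₀) := fun b => by fun_prop
    exact (h1.mul (h2 b)).mul (h2 c)
  obtain ⟨α, hα0, ε, hε, hα⟩ :=
    ContDiffAt.exists_forall_mem_closedBall_exists_eq_forall_mem_Ioo_hasDerivAt₀ hf 0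
  have hcont : ContinuousAt (fun t => (α t).1) 0 :=
    (hα 0 ⟨by linarith, by linarith⟩).continuousAt.fst
  have hmem : ∀ᶠ t in 𝓝 (0 : ℝ), (α t).1 ∈ W :=
    hcont.eventually (by simpa only [hα0] using hW.eventually_mem hu)
  obtain ⟨δ, hδ, hball⟩ := Metric.eventually_nhds_iff_ball.mp hmem
  refine ⟨fun t => (α t).1, fun t => (α t).2, min ε δ, lt_min hε hδ, fun τ hτ => ?_,
    by simp only [hα0], by simp only [hα0]⟩
  have hτ1 : τ ∈ Ioo (0 - ε) (0 + ε) := by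
    constructor
    · linarith [hτ.1, min_le_left ε δ]
    · linarith [hτ.2, min_le_left ε δ]
  have hτ2 : τ ∈ Metric.ball (0 : ℝ) δ := by
    rw [Real.ball_eq_Ioo]
    constructor
    · linarith [hτ.1, min_le_right ε δ]
    · linarith [hτ.2, min_le_right ε δ]
  have hd := hα τ hτ1
  refine ⟨hball τ hτ2, ?_, fun a => ?_⟩
  · exact (hasFDerivAt_fst (𝕜 := ℝ) (p := α τ)).comp_hasDerivAt τ hd
  · have h2 : HasDerivAt (fun t => (α t).2) (f (α τ)).2 τ :=
      (hasFDerivAt_snd (𝕜 := ℝ) (p := α τ)).comp_hasDerivAt τ hd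
    exact hasDerivAt_pi.mp h2 a

/-- A one-form is a first integral exactly when its symmetrised covariant derivative vanishes. -/
lemma isFirstIntegral_iff (hW : IsOpen W) (hΓ : ∀ a b c, ContDiffOn ℝ 1 (Γ a b c) W)
    {K : Fin 2 → Plane → ℝ} : IsFirstIntegral Γ W K ↔ (∀ a, ContDiffOn ℝ 1 (K a) W) ∧
      ∀ u ∈ W, ∀ v : Plane, ∑ a, ((∑ b, pd b (K a) u * v b) * v a
        + K a u * -∑ b, ∑ c, Γ a b c u * v b * v c) = 0 := by
  have hderiv : (∀ a, ContDiffOn ℝ 1 (K a) W) → ∀ (γ v : ℝ → Plane) (s t : ℝ),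
      IsGeodesicOn Γ W γ v s t → ∀ τ ∈ Ioo s t,
      HasDerivAt (fun σ => ∑ a, K a (γ σ) * v σ a) (∑ a, ((∑ b, pd b (K a) (γ τ) * v τ b) * v τ a
        + K a (γ τ) * -∑ b, ∑ c, Γ a b c (γ τ) * v τ b * v τ c)) τ := by
    intro hK γ v s t hγ τ hτ
    obtain ⟨hm, h1, h2⟩ := hγ τ hτ
    exact HasDerivAt.fun_sum fun a _ => (hasDerivAt_comp_curve
      (differentiableAt_of_contDiffOn (hK a) (by simp) hW hm) h1).mul (h2 a)
  constructor
  · rintro ⟨hK, h⟩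
    refine ⟨hK, fun u hu v₀ => ?_⟩
    obtain ⟨γ, v, ε, hε, hγ, rfl, rfl⟩ := exists_geodesic hW hΓ hu v₀
    have h0 : (0 : ℝ) ∈ Ioo (-ε) ε := ⟨by linarith, hε⟩
    exact (hderiv hK γ v _ _ hγ 0 h0).unique (h γ v _ _ hγ 0 h0)
  · rintro ⟨hK, h⟩
    refine ⟨hK, fun γ v s t hγ τ hτ => ?_⟩
    have := hderiv hK γ v s t hγ τ hτ
    rwa [h _ (hγ τ hτ).1] at this

end Geodesics

section Killing

variable {lam : Fin 2 → Plane → ℝ} {W : Set Plane} {u : Plane} {i j : Fin 2}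

lemma pd_log {F : Plane → ℝ} (hF : DifferentiableAt ℝ F u) (h0 : F u ≠ 0) (a : Fin 2) :
    pd a (fun w => Real.log (F w)) u = pd a F u / F u := by
  rw [pd_comp (Real.hasDerivAt_log h0) hF, div_eq_inv_mul]

/-- The Christoffel symbol `Γ^i_{ii}`, for `j` the index other than `i`. -/
def gammaDiag (lam : Fin 2 → Plane → ℝ) (i j : Fin 2) (u : Plane) : ℝ :=
  pd i (coef lam i j) u / coef lam i j u - 2 * coef lam j i u

/-- The Christoffel symbol `Γ^i_{ij}`, for `j` the index other than `i`. -/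
def gammaOff (lam : Fin 2 → Plane → ℝ) (i j : Fin 2) (u : Plane) : ℝ :=
  -(1 / 2 * (pd j (coef lam i j) u / coef lam i j u) + coef lam i j u)

lemma IsDiagSystem.christoffel_eq (hl : IsDiagSystem lam W) (hij : i ≠ j) (hu : u ∈ W) :
    christoffel lam i i i u = gammaDiag lam i j u ∧ christoffel lam i i j u = gammaOff lam i j u ∧
    christoffel lam i j i u = gammaOff lam i j u ∧ christoffel lam i j j u = 0 := by
  have h1 := pd_log (differentiableAt_of_contDiffOn (hl.contDiff_coef hij) (by simp) hl.isOpen hu)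
    (hl.coef_ne u hu i j hij)
  rw [gammaDiag, gammaOff, ← h1, ← h1]
  fin_cases i <;> fin_cases j
  · exact absurd rfl hij
  · exact ⟨rfl, rfl, rfl, rfl⟩
  · exact ⟨rfl, rfl, rfl, rfl⟩
  · exact absurd rfl hij

lemma IsDiagSystem.contDiff_gammaDiag (hl : IsDiagSystem lam W) (hij : i ≠ j) :
    ContDiffOn ℝ 4 (gammaDiag lam i j) W :=
  ((contDiffOn_pd (hl.contDiff_coef hij) hl.isOpen (by norm_num) i).div
    ((hl.contDiff_coef hij).of_le (by norm_num)) fun u hu => hl.coef_ne u hu i j hij).sub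
    (contDiffOn_const.mul ((hl.contDiff_coef hij.symm).of_le (by norm_num)))

lemma IsDiagSystem.contDiff_gammaOff (hl : IsDiagSystem lam W) (hij : i ≠ j) :
    ContDiffOn ℝ 4 (gammaOff lam i j) W :=
  ((contDiffOn_const.mul ((contDiffOn_pd (hl.contDiff_coef hij) hl.isOpen (by norm_num) j).div
    ((hl.contDiff_coef hij).of_le (by norm_num)) fun u hu => hl.coef_ne u hu i j hij)).add
    ((hl.contDiff_coef hij).of_le (by norm_num))).neg

lemma IsDiagSystem.contDiff_christoffel (hl : IsDiagSystem lam W) (a b c : Fin 2) :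
    ContDiffOn ℝ 1 (christoffel lam a b c) W := by
  have key : ∀ i j, i ≠ j → ContDiffOn ℝ 1 (christoffel lam i i i) W ∧
      ContDiffOn ℝ 1 (christoffel lam i i j) W ∧ ContDiffOn ℝ 1 (christoffel lam i j i) W ∧
      ContDiffOn ℝ 1 (christoffel lam i j j) W := by
    intro i j hij
    have h1 : ContDiffOn ℝ 1 (gammaDiag lam i j) W :=
      (hl.contDiff_gammaDiag hij).of_le (by norm_num)
    have h2 : ContDiffOn ℝ 1 (gammaOff lam i j) W := (hl.contDiff_gammaOff hij).of_le (by norm_num)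
    exact ⟨h1.congr fun u hu => (hl.christoffel_eq hij hu).1,
      h2.congr fun u hu => (hl.christoffel_eq hij hu).2.1,
      h2.congr fun u hu => (hl.christoffel_eq hij hu).2.2.1,
      contDiffOn_const.congr fun u hu => (hl.christoffel_eq hij hu).2.2.2⟩
  obtain ⟨a1, a2, a3, a4⟩ := key 0 1 (by decide)
  obtain ⟨b1, b2, b3, b4⟩ := key 1 0 (by decide)
  fin_cases a <;> fin_cases b <;> fin_cases c <;> assumption

/-- The Killing equations for the one-form `K`. -/
structure IsKilling (lam : Fin 2 → Plane → ℝ) (W : Set Plane) (K : Fin 2 → Plane → ℝ) : Prop where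
  contDiff : ∀ a, ContDiffOn ℝ 1 (K a) W
  pd_self : ∀ u ∈ W, ∀ i j, i ≠ j → pd i (K i) u = gammaDiag lam i j u * K i u
  pd_symm : ∀ u ∈ W, ∀ i j, i ≠ j → pd i (K j) u + pd j (K i) u
    = 2 * gammaOff lam i j u * K i u + 2 * gammaOff lam j i u * K j u

lemma isFirstIntegral_iff_isKilling (hl : IsDiagSystem lam W) {K : Fin 2 → Plane → ℝ} :
    IsFirstIntegral (christoffel lam) W K ↔ IsKilling lam W K := by
  rw [isFirstIntegral_iff hl.isOpen hl.contDiff_christoffel]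
  have h01 : (0 : Fin 2) ≠ 1 := by decide
  constructor
  · rintro ⟨hK, h⟩
    have hcoef : ∀ u ∈ W, ∀ v : Plane, _ := fun u hu v => by
      obtain ⟨a1, a2, a3, a4⟩ := hl.christoffel_eq h01 hu
      obtain ⟨b1, b2, b3, b4⟩ := hl.christoffel_eq h01.symm hu
      have := h u hu v
      simp only [Fin.sum_univ_two, a1, a2, a3, a4, b1, b2, b3, b4] at this
      exact this
    have e0 := fun u hu => hcoef u hu ![1, 0]
    have e1 := fun u hu => hcoef u hu ![0, 1]
    have e2 := fun u hu => hcoef u hu ![1, 1]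
    simp only [Matrix.cons_val_zero, Matrix.cons_val_one, Matrix.cons_val_fin_one] at e0 e1 e2
    refine ⟨hK, fun u hu i j hij => ?_, fun u hu i j hij => ?_⟩
    · fin_cases i <;> fin_cases j
      · exact absurd rfl hij
      · change pd 0 (K 0) u = gammaDiag lam 0 1 u * K 0 u
        linear_combination e0 u hu
      · change pd 1 (K 1) u = gammaDiag lam 1 0 u * K 1 u
        linear_combination e1 u hu
      · exact absurd rfl hij
    · fin_cases i <;> fin_cases j
      · exact absurd rfl hij
      · change pd 0 (K 1) u + pd 1 (K 0) u
          = 2 * gammaOff lam 0 1 u * K 0 u + 2 * gammaOff lam 1 0 u * K 1 u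
        linear_combination e2 u hu - e0 u hu - e1 u hu
      · change pd 1 (K 0) u + pd 0 (K 1) u
          = 2 * gammaOff lam 1 0 u * K 1 u + 2 * gammaOff lam 0 1 u * K 0 u
        linear_combination e2 u hu - e0 u hu - e1 u hu
      · exact absurd rfl hij
  · rintro ⟨hK, h1, h2⟩
    refine ⟨hK, fun u hu v => ?_⟩
    obtain ⟨a1, a2, a3, a4⟩ := hl.christoffel_eq h01 hu
    obtain ⟨b1, b2, b3, b4⟩ := hl.christoffel_eq h01.symm hu
    simp only [Fin.sum_univ_two, a1, a2, a3, a4, b1, b2, b3, b4]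
    linear_combination v 0 ^ 2 * h1 u hu 0 1 h01 + v 1 ^ 2 * h1 u hu 1 0 h01.symm
      + v 0 * v 1 * h2 u hu 0 1 h01

lemma forall_fin_two_of_ne {p : Fin 2 → Prop} (hij : i ≠ j) (hi : p i) (hj : p j) (a : Fin 2) :
    p a := by
  fin_cases i <;> fin_cases j <;> fin_cases a <;> first | exact absurd rfl hij | assumption

namespace IsKilling

variable {K : Fin 2 → Plane → ℝ}

/-- The Killing equations are of finite type, so that their solutions gain regularity. -/
lemma contDiff_pd (hl : IsDiagSystem lam W) (hK : IsKilling lam W K) (hij : i ≠ j) :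
    ContDiffOn ℝ 1 (pd i (K j)) W := by
  have hW := hl.isOpen
  have hself : ∀ i j, i ≠ j → ContDiffOn ℝ 1 (pd i (K i)) W := fun i j hij =>
    (((hl.contDiff_gammaDiag hij).of_le (by norm_num)).mul (hK.contDiff i)).congr
      fun u hu => hK.pd_self u hu i j hij
  set R : Plane → ℝ := fun u => 2 * gammaOff lam i j u * K i u + 2 * gammaOff lam j i u * K j u
  have hR : ContDiffOn ℝ 1 R W :=
    ((contDiffOn_const.mul ((hl.contDiff_gammaOff hij).of_le (by norm_num))).mul
      (hK.contDiff i)).add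
    ((contDiffOn_const.mul ((hl.contDiff_gammaOff hij.symm).of_le (by norm_num))).mul
      (hK.contDiff j))
  refine (contDiffOn_one_of_line (q' := fun a => if a = j then pd i (pd j (K j)) else
    fun u => pd i R u - pd j (pd i (K i)) u) hW ?_ ?_).1
  · refine forall_fin_two_of_ne hij ?_ ?_
    · rw [if_neg hij]
      exact (contDiffOn_pd (m := 0) hR hW (by simp) i).continuousOn.sub
        (contDiffOn_pd (m := 0) (hself i j hij) hW (by simp) j).continuousOn
    · rw [if_pos rfl]
      exact (contDiffOn_pd (m := 0) (hself j i hij.symm) hW (by simp) i).continuousOn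
  · intro u hu
    refine forall_fin_two_of_ne hij ?_ ?_
    · rw [if_neg hij]
      have h1 : HasDerivAt (fun t : ℝ => R (u + t • (Pi.single i 1 : Plane))) (pd i R u) 0 :=
        hasDerivAt_line (differentiableAt_of_contDiffOn hR (by simp) hW hu)
      have h2 := hasDerivAt_line_pd (j := j) hW (hK.contDiff i) (hself i j hij) hu
      refine (h1.sub h2).congr_of_eventuallyEq ?_
      have hc : ContinuousAt (fun t : ℝ => u + t • (Pi.single i 1 : Plane)) 0 := by fun_prop
      have : ∀ᶠ t : ℝ in 𝓝 0, u + t • (Pi.single i 1 : Plane) ∈ W :=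
        hc.eventually (by simpa using hW.mem_nhds hu)
      filter_upwards [this] with t ht
      have := hK.pd_symm _ ht i j hij
      simp only [R, Pi.sub_apply]
      linarith
    · rw [if_pos rfl]
      exact hasDerivAt_line_pd hW (hK.contDiff j) (hself j i hij.symm) hu

lemma contDiff_two (hl : IsDiagSystem lam W) (hK : IsKilling lam W K) (a : Fin 2) :
    ContDiffOn ℝ 2 (K a) W := by
  have key : ∀ i j : Fin 2, i ≠ j → ContDiffOn ℝ 2 (K j) W := by
    intro i j hij
    have := contDiffOn_succ_of_pd (n := 1) hl.isOpen ((hK.contDiff j).differentiableOn (by simp))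
      (forall_fin_two_of_ne hij (hK.contDiff_pd hl hij)
        ((((hl.contDiff_gammaDiag hij.symm).of_le (by norm_num)).mul (hK.contDiff j)).congr
          fun u hu => hK.pd_self u hu j i hij.symm))
    simpa [one_add_one_eq_two] using this
  fin_cases a
  · exact key 1 0 (by decide)
  · exact key 0 1 (by decide)

/-- The components of the one-form together with `∂_0 K_1`: the Killing equations express all other
first derivatives through these. -/
def jet (K : Fin 2 → Plane → ℝ) : Fin 3 → Plane → ℝ := ![K 0, K 1, pd 0 (K 1)]

/-- The prolongation of the Killing equations: the derivatives of the jet are linear functions of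
the jet. -/
lemma exists_closed_system (hl : IsDiagSystem lam W) :
    ∃ A : Fin 2 → Fin 3 → Fin 3 → Plane → ℝ, (∀ c m n, ContinuousOn (A c m n) W) ∧
      ∀ K, IsKilling lam W K → ∀ u ∈ W, ∀ c m, DifferentiableAt ℝ (jet K m) u ∧
        pd c (jet K m) u = ∑ n, A c m n u * jet K n u := by
  have hW := hl.isOpen
  have h01 : (0 : Fin 2) ≠ 1 := by decide
  set a := gammaDiag lam 0 1 with ha
  set b := gammaDiag lam 1 0 with hb
  set r := gammaOff lam 0 1 with hr
  set s := gammaOff lam 1 0 with hs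
  have ca := hl.contDiff_gammaDiag h01
  have cb := hl.contDiff_gammaDiag h01.symm
  have cr := hl.contDiff_gammaOff h01
  have cs := hl.contDiff_gammaOff h01.symm
  have hcd : ∀ {F : Plane → ℝ}, ContDiffOn ℝ 4 F W → ∀ c, ContinuousOn (pd c F) W := fun hF c =>
    (contDiffOn_pd (m := 0) hF hW (by norm_num) c).continuousOn
  refine ⟨fun c m n => (![
      ![![a, 0, 0], ![0, 0, 1],
        ![fun u => 2 * pd 0 r u + 2 * r u * a u - pd 1 a u - a u * (2 * r u),
          fun u => 2 * pd 0 s u - a u * (2 * s u), fun u => 2 * s u + a u]],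
      ![![fun u => 2 * r u, fun u => 2 * s u, -1], ![0, b, 0], ![0, pd 0 b, b]]]
        : Fin 2 → Fin 3 → Fin 3 → Plane → ℝ) c m n, ?_, ?_⟩
  · have c1 := ca.continuousOn
    have c2 := cb.continuousOn
    have c3 := cr.continuousOn
    have c4 := cs.continuousOn
    have d1 := hcd ca 1
    have d2 := hcd cb 0
    have d3 := hcd cr 0
    have d4 := hcd cs 0
    have z0 : ContinuousOn (0 : Plane → ℝ) W := continuousOn_const
    have z1 : ContinuousOn (1 : Plane → ℝ) W := continuousOn_const
    have z2 : ContinuousOn (-1 : Plane → ℝ) W :=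
      continuousOn_const (c := (-1 : ℝ))
    intro c m n
    fin_cases c <;> fin_cases m <;> fin_cases n <;> simp <;> first | assumption | fun_prop
  · intro K hK u hu
    have hd : ∀ {F : Plane → ℝ}, ContDiffOn ℝ 1 F W → ∀ c, HasPd c F (pd c F u) u := fun hF c =>
      HasPd.of_contDiffOn hF (by simp) hW hu c
    have hw := hK.contDiff_pd hl h01
    have e0 := hK.pd_self u hu 0 1 h01
    have e1 := hK.pd_self u hu 1 0 h01.symm
    have e2 : pd 1 (K 0) u = 2 * r u * K 0 u + 2 * s u * K 1 u - pd 0 (K 1) u := by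
      linarith [hK.pd_symm u hu 0 1 h01]
    have e3 : pd 1 (pd 0 (K 1)) u = pd 0 b u * K 1 u + b u * pd 0 (K 1) u := by
      rw [← pd_comm (hK.contDiff_two hl 1) hW hu 0 1,
        pd_congr_on hW (fun w hw => hK.pd_self w hw 1 0 h01.symm) hu]
      exact ((hd (cb.of_le (by norm_num)) 0).mul (hd (hK.contDiff 1) 0)).eq
    have e4 : pd 0 (pd 1 (K 0)) u = pd 1 a u * K 0 u + a u * pd 1 (K 0) u := by
      rw [← pd_comm (hK.contDiff_two hl 0) hW hu 1 0,
        pd_congr_on hW (fun w hw => hK.pd_self w hw 0 1 h01) hu]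
      exact ((hd (ca.of_le (by norm_num)) 1).mul (hd (hK.contDiff 0) 1)).eq
    have e5 : pd 0 (pd 1 (K 0)) u = 2 * pd 0 r u * K 0 u + 2 * r u * pd 0 (K 0) u
        + (2 * pd 0 s u * K 1 u + 2 * s u * pd 0 (K 1) u) - pd 0 (pd 0 (K 1)) u := by
      rw [pd_congr_on hW (G := fun u => 2 * r u * K 0 u + 2 * s u * K 1 u - pd 0 (K 1) u)
        (fun w hw => by linarith [hK.pd_symm w hw 0 1 h01]) hu]
      exact (((((hd (cr.of_le (by norm_num)) 0).const_mul 2).mul (hd (hK.contDiff 0) 0)).add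
        (((hd (cs.of_le (by norm_num)) 0).const_mul 2).mul (hd (hK.contDiff 1) 0))).sub
        (hd hw 0)).eq
    intro c m
    refine ⟨?_, ?_⟩
    · fin_cases m
      · exact (hd (hK.contDiff 0) 0).diff
      · exact (hd (hK.contDiff 1) 0).diff
      · exact (hd hw 0).diff
    · rw [e2] at e4
      fin_cases c <;> fin_cases m <;> simp [jet, Fin.sum_univ_three]
      · exact e0
      · linear_combination e5 - e4 + 2 * r u * e0
      · linear_combination e2
      · exact e1
      · exact e3

/-- A Killing form on a convex open set is determined by its jet at one point: along a segment the
jet solves a linear differential equation, so Grönwall's inequality applies. -/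
theorem eq_zero_of_jet_eq_zero (hl : IsDiagSystem lam W) (hc : Convex ℝ W)
    (hK : IsKilling lam W K) {p : Plane} (hp : p ∈ W) (h0 : ∀ m, jet K m p = 0) (hu : u ∈ W)
    (a : Fin 2) : K a u = 0 := by
  obtain ⟨A, hA, hsys⟩ := exists_closed_system hl
  let ℓ : ℝ → Plane := fun t => p + t • (u - p)
  have hℓc : Continuous ℓ := by fun_prop
  have hℓ : ∀ t ∈ Icc (0 : ℝ) 1, ℓ t ∈ W := fun t ht => hc.add_smul_sub_mem hp hu ht
  have hℓd : ∀ t, HasDerivAt ℓ (u - p) t := fun t => by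
    simpa only [one_smul, id] using ((hasDerivAt_id t).smul_const (u - p)).const_add p
  let y : ℝ → Fin 3 → ℝ := fun t m => jet K m (ℓ t)
  let y' : ℝ → Fin 3 → ℝ := fun t m => ∑ c, (∑ n, A c m n (ℓ t) * y t n) * (u - p) c
  have hy : ∀ t ∈ Icc (0 : ℝ) 1, HasDerivAt y (y' t) t := fun t ht =>
    hasDerivAt_pi.mpr fun m => by
      have h1 := hasDerivAt_comp_curve (hsys K hK _ (hℓ t ht) 0 m).1 (hℓd t)
      simpa only [(hsys K hK _ (hℓ t ht) _ m).2] using h1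
  let B : ℝ → ℝ := fun t => ∑ m, ∑ c, ∑ n, |A c m n (ℓ t)| * |(u - p) c|
  have hB : ContinuousOn B (Icc 0 1) := by
    refine continuousOn_finsetSum _ fun m _ => continuousOn_finsetSum _ fun c _ =>
      continuousOn_finsetSum _ fun n _ => ContinuousOn.mul ?_ continuousOn_const
    exact ((hA c m n).comp hℓc.continuousOn hℓ).abs
  obtain ⟨C, hC⟩ := isCompact_Icc.exists_bound_of_continuousOn hB
  have hbound : ∀ t ∈ Ico (0 : ℝ) 1, ‖y' t‖ ≤ C * ‖y t‖ := by
    intro t ht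
    have hCt : B t ≤ C := (le_abs_self _).trans (hC t (Ico_subset_Icc_self ht))
    have hBm : ∀ m, ∑ c, ∑ n, |A c m n (ℓ t)| * |(u - p) c| ≤ B t := fun m =>
      Finset.single_le_sum (f := fun m => ∑ c, ∑ n, |A c m n (ℓ t)| * |(u - p) c|)
        (fun m _ => by positivity) (Finset.mem_univ m)
    have hC0 : 0 ≤ C := le_trans (by positivity) hCt
    rw [pi_norm_le_iff_of_nonneg (by positivity)]
    intro m
    calc ‖y' t m‖ ≤ ∑ c, ‖(∑ n, A c m n (ℓ t) * y t n) * (u - p) c‖ := norm_sum_le _ _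
      _ ≤ ∑ c, ∑ n, |A c m n (ℓ t)| * |(u - p) c| * ‖y t‖ := by
        refine Finset.sum_le_sum fun c _ => ?_
        rw [Finset.sum_mul]
        refine (norm_sum_le _ _).trans (Finset.sum_le_sum fun n _ => ?_)
        rw [norm_mul, norm_mul, Real.norm_eq_abs, Real.norm_eq_abs ((u - p) c), mul_right_comm]
        exact mul_le_mul_of_nonneg_left (norm_le_pi_norm (y t) n) (by positivity)
      _ = (∑ c, ∑ n, |A c m n (ℓ t)| * |(u - p) c|) * ‖y t‖ := by
        simp only [Finset.sum_mul]
      _ ≤ C * ‖y t‖ := mul_le_mul_of_nonneg_right ((hBm m).trans hCt) (norm_nonneg _)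
  have hy0 : y 0 = 0 := funext fun m => by simpa [y, ℓ] using h0 m
  have hzero := eq_zero_of_abs_deriv_le_mul_abs_self_of_eq_zero_right
    (fun t ht => (hy t ht).continuousAt.continuousWithinAt)
    (fun t ht => (hy t (Ico_subset_Icc_self ht)).hasDerivWithinAt) hy0 hbound 1
    ⟨zero_le_one, le_rfl⟩
  have h1 : ∀ m, jet K m u = 0 := fun m => by
    have := congrFun hzero m
    simpa [y, ℓ] using this
  fin_cases a
  · exact h1 0
  · exact h1 1

end IsKilling

end Killing

/-! ### Flat pairs and Killing forms -/

section FlatPairs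

variable {lam : Fin 2 → Plane → ℝ} {W : Set Plane} {u : Plane} {i j : Fin 2}

/-- The diagonals `G_i = g^{ii}` of the possibly degenerate flat metrics, in contravariant form,
that are compatible with the diagonal system. -/
structure IsFlatPair (lam : Fin 2 → Plane → ℝ) (W : Set Plane) (G : Fin 2 → Plane → ℝ) :
    Prop where
  contDiff : ∀ i, ContDiffOn ℝ 2 (G i) W
  pd_eq : ∀ u ∈ W, ∀ i j, i ≠ j → pd j (G i) u = -2 * coef lam i j u * G i u
  flat : ∀ u ∈ W, ∀ i j, i ≠ j →
    G i u * (pd i (coef lam j i) u + coef lam j i u ^ 2)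
      + 1 / 2 * coef lam j i u * pd i (G i) u
      + G j u * (pd j (coef lam i j) u + coef lam i j u ^ 2)
      + 1 / 2 * coef lam i j u * pd j (G j) u = 0

lemma StructureEqs.isFlatPair {Ω : HydroOp} (h : StructureEqs lam W Ω) :
    IsFlatPair lam W fun i => Ω.g i i :=
  ⟨fun i => h.contDiff_g i i, h.pd_g, h.flat⟩

lemma rev_eq_of_ne (hij : i ≠ j) : i.rev = j := by
  fin_cases i <;> fin_cases j <;> first | exact absurd rfl hij | rfl

lemma ne_rev (i : Fin 2) : i ≠ i.rev := by fin_cases i <;> decide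

/-- The one-form `K_i = c_{ij} G_j`, with `j = i.rev` the index other than `i`. -/
def killingOf (lam G : Fin 2 → Plane → ℝ) (i : Fin 2) (u : Plane) : ℝ :=
  coef lam i i.rev u * G i.rev u

/-- The pair `G_j = K_i / c_{ij}`, with `i = j.rev`: the inverse of `killingOf`. -/
def pairOf (lam K : Fin 2 → Plane → ℝ) (j : Fin 2) (u : Plane) : ℝ :=
  K j.rev u / coef lam j.rev j u

lemma killingOf_eq {G : Fin 2 → Plane → ℝ} (hij : i ≠ j) (u : Plane) :
    killingOf lam G i u = coef lam i j u * G j u := by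
  rw [killingOf, rev_eq_of_ne hij]

lemma pairOf_eq {K : Fin 2 → Plane → ℝ} (hij : i ≠ j) (u : Plane) :
    pairOf lam K j u = K i u / coef lam i j u := by
  rw [pairOf, rev_eq_of_ne hij.symm]

/-- The flatness of the pair is the last of the Killing equations. -/
lemma IsFlatPair.isKilling (hl : IsDiagSystem lam W) {G : Fin 2 → Plane → ℝ}
    (hG : IsFlatPair lam W G) : IsKilling lam W (killingOf lam G) := by
  have hW := hl.isOpen
  have hpd : ∀ u ∈ W, ∀ i j, i ≠ j → ∀ c, pd c (killingOf lam G i) u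
      = pd c (coef lam i j) u * G j u + coef lam i j u * pd c (G j) u := fun u hu i j hij c => by
    rw [show killingOf lam G i = fun u => coef lam i j u * G j u from
      funext (killingOf_eq hij)]
    exact ((HasPd.of_contDiffOn (hl.contDiff_coef hij) (by simp) hW hu c).mul
      (HasPd.of_contDiffOn (hG.contDiff j) (by simp) hW hu c)).eq
  refine ⟨fun i => ((hl.contDiff_coef (ne_rev i)).of_le (by norm_num)).mul
    ((hG.contDiff _).of_le (by norm_num)), fun u hu i j hij => ?_, fun u hu i j hij => ?_⟩
  · have h0 := hl.coef_ne u hu i j hij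
    rw [hpd u hu i j hij, hG.pd_eq u hu j i hij.symm, killingOf_eq hij, gammaDiag]
    field_simp
    ring
  · have h0 := hl.coef_ne u hu i j hij
    have h1 := hl.coef_ne u hu j i hij.symm
    rw [hpd u hu i j hij, hpd u hu j i hij.symm, killingOf_eq hij, killingOf_eq hij.symm, gammaOff,
      gammaOff]
    field_simp
    linear_combination 2 * hG.flat u hu i j hij

lemma IsKilling.isFlatPair (hl : IsDiagSystem lam W) {K : Fin 2 → Plane → ℝ}
    (hK : IsKilling lam W K) : IsFlatPair lam W (pairOf lam K) := by
  have hW := hl.isOpen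
  have hC : ∀ j, ContDiffOn ℝ 2 (pairOf lam K j) W := fun j =>
    (hK.contDiff_two hl _).div ((hl.contDiff_coef (ne_rev j).symm).of_le (by norm_num))
      fun u hu => hl.coef_ne u hu _ _ (ne_rev j).symm
  have hmul : ∀ u ∈ W, ∀ i j, i ≠ j → K i u = coef lam i j u * pairOf lam K j u :=
    fun u hu i j hij => by
      rw [pairOf_eq hij, mul_div_cancel₀ _ (hl.coef_ne u hu i j hij)]
  have hpd : ∀ u ∈ W, ∀ i j, i ≠ j → ∀ c, pd c (K i) u = pd c (coef lam i j) u * pairOf lam K j u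
      + coef lam i j u * pd c (pairOf lam K j) u := fun u hu i j hij c => by
    rw [pd_congr_on hW (fun w hw => hmul w hw i j hij) hu]
    exact ((HasPd.of_contDiffOn (hl.contDiff_coef hij) (by simp) hW hu c).mul
      (HasPd.of_contDiffOn (hC j) (by simp) hW hu c)).eq
  refine ⟨hC, fun u hu i j hij => ?_, fun u hu i j hij => ?_⟩
  · have h0 := hl.coef_ne u hu j i hij.symm
    have h1 := hK.pd_self u hu j i hij.symm
    rw [hpd u hu j i hij.symm, hmul u hu j i hij.symm, gammaDiag] at h1
    field_simp at h1
    refine mul_left_cancel₀ h0 ?_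
    linear_combination h1
  · have h0 := hl.coef_ne u hu i j hij
    have h1 := hl.coef_ne u hu j i hij.symm
    have h2 := hK.pd_symm u hu i j hij
    rw [hpd u hu i j hij, hpd u hu j i hij.symm, hmul u hu i j hij, hmul u hu j i hij.symm,
      gammaOff, gammaOff] at h2
    field_simp at h2
    linear_combination 1 / 2 * h2

end FlatPairs

/-! ### The Poisson operator of a flat pair -/

section Operator

variable {lam : Fin 2 → Plane → ℝ} {W : Set Plane} {u : Plane} {i j : Fin 2}

/-- The relations between the coefficients make the integrand of the symmetric part of the bracket a
total derivative. -/
lemma HydroOp.SkewCoeffs.bracket_eq_neg {Ω : HydroOp} (hW : IsOpen W) (hΩ : Ω.SkewCoeffs W)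
    {φ ψ : ℝ → Plane → ℝ} (hφ : IsDensity φ) (hψ : IsDensity ψ) {X : ℝ → Plane} (hX : IsMap W X) :
    Ω.bracket φ ψ X = -Ω.bracket ψ φ X := by
  have key := bracket_add_bracket hΩ.contDiff_g hΩ.contDiff_b hφ hψ hX
  obtain ⟨R, hR⟩ := hφ.2
  have hd : ∀ x, HasDerivAt
      (fun x => ∑ a, ∑ b, Ω.g a b (X x) * varDeriv φ X x a * varDeriv ψ X x b)
      (∑ a, (varDeriv φ X x a *
          Ω.flow (X x) (deriv X x) (varDeriv ψ X x) (deriv (varDeriv ψ X) x) a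
        + varDeriv ψ X x a *
          Ω.flow (X x) (deriv X x) (varDeriv φ X x) (deriv (varDeriv φ X) x) a)) x := by
    intro x
    have h1 := hasDerivAt_pi.mp (hasDerivAt_varDeriv hφ hX x)
    have h2 := hasDerivAt_pi.mp (hasDerivAt_varDeriv hψ hX x)
    have h := HasDerivAt.fun_sum (u := Finset.univ) fun a _ =>
      HasDerivAt.fun_sum (u := Finset.univ) fun b _ =>
      ((hasDerivAt_comp_map hW (hΩ.contDiff_g a b) hX x).mul (h1 a)).mul (h2 b)
    refine h.congr_deriv ?_
    have hs := hΩ.symm _ (hX.2 x) 1 0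
    simp only [hΩ.pd_g _ (hX.2 x), HydroOp.flow, Fin.sum_univ_two, Pi.mul_apply, hs]
    ring
  have hc : Continuous fun x => ∑ a, (varDeriv φ X x a *
          Ω.flow (X x) (deriv X x) (varDeriv ψ X x) (deriv (varDeriv ψ X) x) a
        + varDeriv ψ X x a *
          Ω.flow (X x) (deriv X x) (varDeriv φ X x) (deriv (varDeriv φ X) x) a) := by
    have c0 := hX.continuous_deriv
    have c1 := (contDiff_varDeriv hφ le_rfl hX.1).continuous
    have c2 := (contDiff_varDeriv hψ le_rfl hX.1).continuous
    have c3 := continuous_deriv_varDeriv hφ hX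
    have c4 := continuous_deriv_varDeriv hψ hX
    have c5 := fun a b => continuous_comp_map (hΩ.contDiff_g a b).continuousOn hX
    have c6 := fun a b c => continuous_comp_map (hΩ.contDiff_b a b c).continuousOn hX
    simp only [HydroOp.flow]
    fun_prop
  have h0 := (integral_eq_zero_of_hasDerivAt_of_vanish hd hc (R := R) fun x hx => by
    simp [varDeriv_eq_zero hR hx X]).2
  rw [h0] at key
  linarith

/-- The operator with `g^{ii} = G_i` diagonal and with the `b^{ab}_c` that are forced on a
Hamiltonian formulation. -/
def diagOp (lam G : Fin 2 → Plane → ℝ) : HydroOp where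
  g a b u := if a = b then G a u else 0
  b a b c u := if a = b then 1 / 2 * pd c (G a) u else
    if c = a then coef lam a b u * G b u else -coef lam b a u * G a u

variable {G : Fin 2 → Plane → ℝ}

lemma diagOp_g_self (i : Fin 2) : (diagOp lam G).g i i = G i := by
  simp [diagOp]

lemma diagOp_g_off (hij : i ≠ j) : (diagOp lam G).g i j = fun _ => 0 := by
  simp [diagOp, hij]

lemma diagOp_b_self (i c : Fin 2) : (diagOp lam G).b i i c = fun u => 1 / 2 * pd c (G i) u := by
  simp [diagOp]

lemma diagOp_b_fst (hij : i ≠ j) :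
    (diagOp lam G).b i j i = fun u => coef lam i j u * G j u := by
  simp [diagOp, hij]

lemma diagOp_b_snd (hij : i ≠ j) :
    (diagOp lam G).b i j j = fun u => -coef lam j i u * G i u := by
  simp [diagOp, hij, hij.symm]

lemma IsFlatPair.skewCoeffs (hl : IsDiagSystem lam W) (hG : IsFlatPair lam W G) :
    (diagOp lam G).SkewCoeffs W := by
  have h01 : (0 : Fin 2) ≠ 1 := by decide
  have c1 : ∀ i, ContDiffOn ℝ 1 (G i) W := fun i => (hG.contDiff i).of_le (by norm_num)
  have cc : ∀ {i j : Fin 2}, i ≠ j → ContDiffOn ℝ 1 (coef lam i j) W := fun hij =>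
    (hl.contDiff_coef hij).of_le (by norm_num)
  refine ⟨fun a b => ?_, fun a b c => ?_, fun u hu a b => ?_, fun u hu a b c => ?_⟩
  · by_cases hab : a = b
    · subst hab; rw [diagOp_g_self]; exact c1 a
    · rw [diagOp_g_off hab]; exact contDiffOn_const
  · by_cases hab : a = b
    · subst hab; rw [diagOp_b_self]
      exact contDiffOn_const.mul (contDiffOn_pd (hG.contDiff a) hl.isOpen (by norm_num) c)
    · refine forall_fin_two_of_ne (p := fun c => ContDiffOn ℝ 1 ((diagOp lam G).b a b c) W) hab
        ?_ ?_ c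
      · rw [diagOp_b_fst hab]; exact (cc hab).mul (c1 b)
      · rw [diagOp_b_snd hab]; exact (cc (Ne.symm hab)).neg.mul (c1 a)
  · by_cases hab : a = b
    · rw [hab]
    · rw [diagOp_g_off hab, diagOp_g_off (Ne.symm hab)]
  · by_cases hab : a = b
    · subst hab; rw [diagOp_g_self, diagOp_b_self]; ring
    · rw [diagOp_g_off hab, pd_const]
      refine forall_fin_two_of_ne
        (p := fun c => 0 = (diagOp lam G).b a b c u + (diagOp lam G).b b a c u) hab ?_ ?_ c
      · rw [diagOp_b_fst hab, diagOp_b_snd (Ne.symm hab)]; ring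
      · rw [diagOp_b_snd hab, diagOp_b_fst (Ne.symm hab)]; ring

set_option maxHeartbeats 1000000 in
/-- The integrand of the Jacobi identity vanishes identically. -/
lemma IsFlatPair.jacobiator_eq_zero (hl : IsDiagSystem lam W) (hG : IsFlatPair lam W G)
    (hu : u ∈ W) (v α α' β β' γ γ' : Plane) :
    (diagOp lam G).jacobiator u v α α' β β' γ γ' = 0 := by
  have hW := hl.isOpen
  have h01 : (0 : Fin 2) ≠ 1 := by decide
  have dG : ∀ i c, HasPd c (G i) (pd c (G i) u) u := fun i c =>
    HasPd.of_contDiffOn (hG.contDiff i) (by simp) hW hu c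
  have dc : ∀ {i j : Fin 2}, i ≠ j → ∀ c, HasPd c (coef lam i j) (pd c (coef lam i j) u) u :=
    fun hij c => HasPd.of_contDiffOn (hl.contDiff_coef hij) (by simp) hW hu c
  have dG' : ∀ i c d, HasPd c (pd d (G i)) (pd c (pd d (G i)) u) u := fun i c d =>
    HasPd.of_contDiffOn (contDiffOn_pd (m := 1) (hG.contDiff i) hW (by norm_num) d) (by simp)
      hW hu c
  have e00 : ∀ i, pd 1 ((diagOp lam G).b i i 0) u = pd 0 ((diagOp lam G).b i i 1) u := fun i => by
    rw [diagOp_b_self, diagOp_b_self, ((dG' i 1 0).const_mul _).eq, ((dG' i 0 1).const_mul _).eq,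
      pd_comm (hG.contDiff i) hW hu]
  have e01 : ∀ i j, i ≠ j → pd i ((diagOp lam G).b i j j) u = pd j ((diagOp lam G).b i j i) u
      + (coef lam j i u ^ 2 * G i u + coef lam i j u ^ 2 * G j u
        - 1 / 2 * coef lam j i u * pd i (G i) u - 1 / 2 * coef lam i j u * pd j (G j) u) :=
    fun i j hij => by
      rw [diagOp_b_fst hij, diagOp_b_snd hij, ((dc hij.symm i).neg.mul (dG i i)).eq,
        ((dc hij j).mul (dG j j)).eq]
      linear_combination -hG.flat u hu i j hij
  have e01' := e01 0 1 h01
  have e10' := e01 1 0 h01.symm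
  have g1 := hG.pd_eq u hu 0 1 h01
  have g2 := hG.pd_eq u hu 1 0 h01.symm
  simp only [HydroOp.jacobiator, HydroOp.reducedVar, HydroOp.flow, Fin.sum_univ_two,
    e00, e01', e10']
  simp only [diagOp_g_self, diagOp_b_self, diagOp_b_fst h01, diagOp_b_fst h01.symm,
    diagOp_b_snd h01, diagOp_b_snd h01.symm, diagOp_g_off h01, diagOp_g_off h01.symm, g1, g2]
  ring

theorem IsFlatPair.isPoisson (hl : IsDiagSystem lam W) (hG : IsFlatPair lam W G) :
    (diagOp lam G).IsPoisson W := by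
  have hS := hG.skewCoeffs hl
  refine ⟨hS.contDiff_g, hS.contDiff_b, fun φ ψ hφ hψ X hX => hS.bracket_eq_neg hl.isOpen hφ hψ hX,
    fun φ ψ χ hφ hψ hχ X hX => ?_⟩
  rw [bracket₂_cyclic_sum hl.isOpen hS hφ hψ hχ hX]
  simp only [hG.jacobiator_eq_zero hl (hX.2 _), integral_zero]

end Operator

/-! ### Existence of the Hamiltonian -/

section Hamiltonian

variable {lam : Fin 2 → Plane → ℝ} {W : Set Plane} {u : Plane} {i j : Fin 2}
  {G : Fin 2 → Plane → ℝ}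

/-- It suffices to find the differential `p` of the Hamiltonian density. -/
lemma IsFlatPair.exists_formulation (hl : IsDiagSystem lam W) (hc : Convex ℝ W)
    (hG : IsFlatPair lam W G) {p : Fin 2 → Plane → ℝ} (hp : ∀ i, ContDiffOn ℝ 1 (p i) W)
    (h1 : ∀ u ∈ W, ∀ i j, i ≠ j → lam i u = G i u * pd i (p i) u
      + 1 / 2 * pd i (G i) u * p i u + coef lam i j u * G j u * p j u)
    (h2 : ∀ u ∈ W, ∀ i j, i ≠ j →
      G i u * (pd j (p i) u - coef lam i j u * p i u - coef lam j i u * p j u) = 0)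
    (h3 : ∀ u ∈ W, pd 1 (p 0) u = pd 0 (p 1) u) :
    ∃ h, IsHamiltonianFormulation lam W (diagOp lam G) h := by
  have hW := hl.isOpen
  obtain ⟨h, hd, hh⟩ := exists_pd_eq hW hc ((hp 0).differentiableOn (by simp))
    ((hp 1).differentiableOn (by simp)) h3
  have hpd : ∀ a, ∀ w ∈ W, pd a h w = p a w := fun a w hw => by
    fin_cases a
    · exact (hh w hw).1
    · exact (hh w hw).2
  have hC : ContDiffOn ℝ 2 h W := by
    have := contDiffOn_succ_of_pd (n := 1) hW hd fun a => (hp a).congr (hpd a)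
    simpa [one_add_one_eq_two] using this
  refine ⟨h, hG.isPoisson hl, hC, (forall_isMap_iff hW hC).mpr fun u hu a c => ?_⟩
  have hpd2 : ∀ a c, pd c (pd a h) u = pd c (p a) u := fun a c => pd_congr_on hW (hpd a) hu c
  simp only [hpd2, hpd _ u hu]
  by_cases hac : a = c
  · subst hac
    have hij := ne_rev a
    rw [if_pos rfl, sum_fin_two_of_ne hij, diagOp_g_self, diagOp_g_off hij, diagOp_b_self,
      diagOp_b_fst hij, h1 u hu a _ hij]
    ring
  · have hGa := hG.pd_eq u hu a c hac
    rw [if_neg hac, sum_fin_two_of_ne hac, diagOp_g_self, diagOp_g_off hac, diagOp_b_self,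
      diagOp_b_snd hac]
    simp only [hGa]
    linear_combination -h2 u hu a c hac

lemma forall_ne_of_ne (hij : i ≠ j) {p : Fin 2 → Fin 2 → Prop} (h1 : p i j) (h2 : p j i)
    (a b : Fin 2) (hab : a ≠ b) : p a b := by
  fin_cases i <;> fin_cases j <;> fin_cases a <;> fin_cases b <;>
    first | exact absurd rfl hij | exact absurd rfl hab | assumption

/-- The Hamiltonian of a degenerate pair is determined by solving algebraic equations. -/
theorem IsFlatPair.exists_formulation_of_degenerate (hl : IsDiagSystem lam W) (hc : Convex ℝ W)
    (hG : IsFlatPair lam W G) (hij : i ≠ j) (hi : ∀ u ∈ W, G i u ≠ 0) (hj : ∀ u ∈ W, G j u = 0) :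
    ∃ h, IsHamiltonianFormulation lam W (diagOp lam G) h := by
  have hW := hl.isOpen
  set c := coef lam j i with hcdef
  set e := coef lam i j with hedef
  have hc0 : ∀ w ∈ W, c w ≠ 0 := fun w hw => hl.coef_ne w hw j i hij.symm
  have cc : ContDiffOn ℝ 5 c W := hl.contDiff_coef hij.symm
  have ce : ContDiffOn ℝ 5 e W := hl.contDiff_coef hij
  have dp : ∀ {n : WithTop ℕ∞} {F : Plane → ℝ}, ContDiffOn ℝ n F W → n ≠ 0 → ∀ a, ∀ w ∈ W,
      HasPd a F (pd a F w) w := fun hF hn a w hw => HasPd.of_contDiffOn hF hn hW hw a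
  have dl : ∀ k a, ∀ w ∈ W, HasPd a (lam k) (pd a (lam k) w) w := fun k =>
    dp (hl.contDiff k) (by simp)
  have dc := dp cc (by simp)
  have de := dp ce (by simp)
  have dG := dp (hG.contDiff i) (by simp)
  have ccj : ContDiffOn ℝ 4 (pd j c) W := contDiffOn_pd cc hW (by norm_num) j
  have clj : ContDiffOn ℝ 5 (pd j (lam j)) W := contDiffOn_pd (hl.contDiff j) hW (by norm_num) j
  have hlj : ∀ w ∈ W, pd i (lam j) w = c w * (lam i w - lam j w) := fun w hw =>
    hl.pd_lam hw hij.symm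
  have hGj : ∀ w ∈ W, pd j (G i) w = -2 * e w * G i w := fun w hw => hG.pd_eq w hw i j hij
  have hflat : ∀ w ∈ W, pd i (G i) w = -2 * G i w * (pd i c w / c w + c w) := fun w hw => by
    have h0 := hc0 w hw
    have h1 := hG.flat w hw i j hij
    rw [hj w hw, pd_congr_on hW hj hw, pd_const, ← hcdef] at h1
    refine mul_left_cancel₀ h0 ?_
    field_simp
    linear_combination 2 * h1
  -- the integrability condition of the two equations for `G_i`
  have hcompat : ∀ w ∈ W,
      pd i e w - (pd i (pd j c) w * c w - pd j c w * pd i c w) / c w ^ 2 = pd j c w := by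
    intro w hw
    have h0 := hc0 w hw
    have hcomm := pd_comm (hG.contDiff i) hW hw i j
    rw [pd_congr_on hW hGj hw, pd_congr_on hW hflat hw, (((de i w hw).const_mul (-2)).mul
      (dG i w hw)).eq, (((dG j w hw).const_mul (-2)).mul
      (((dp (contDiffOn_pd (m := 4) cc hW (by norm_num) i) (by simp) j w hw).div (dc j w hw)
        h0).add (dc j w hw))).eq, hGj w hw, hflat w hw,
      ← pd_comm (cc.of_le (by norm_num)) hW hw i j] at hcomm
    refine mul_left_cancel₀ (hi w hw) ?_
    field_simp at hcomm ⊢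
    linear_combination -hcomm
  -- `P` solves the equation for `λ^j`, and `Q = (∂_j P - c_{ij} P) / c_{ji}` the off-diagonal one
  set P : Plane → ℝ := fun w => lam j w / (c w * G i w) with hP
  set N : Plane → ℝ := fun w => pd j (lam j) w + (e w - pd j c w / c w) * lam j w with hN
  set Q : Plane → ℝ := fun w => N w / (c w * (c w * G i w)) with hQ
  have hcG : ∀ w ∈ W, c w * G i w ≠ 0 := fun w hw => mul_ne_zero (hc0 w hw) (hi w hw)
  have hccG : ∀ w ∈ W, c w * (c w * G i w) ≠ 0 := fun w hw => mul_ne_zero (hc0 w hw) (hcG w hw)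
  have CcG : ContDiffOn ℝ 1 (fun w => c w * G i w) W :=
    (cc.of_le (by norm_num)).mul ((hG.contDiff i).of_le (by norm_num))
  have CN : ContDiffOn ℝ 1 N W := (clj.of_le (by norm_num)).add
    (((ce.of_le (by norm_num)).sub ((ccj.of_le (by norm_num)).div (cc.of_le (by norm_num)) hc0)).mul
      ((hl.contDiff j).of_le (by norm_num)))
  have CP : ContDiffOn ℝ 1 P W := ((hl.contDiff j).of_le (by norm_num)).div CcG hcG
  have CQ : ContDiffOn ℝ 1 Q W := CN.div ((cc.of_le (by norm_num)).mul CcG) hccG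
  have hPi : ∀ w ∈ W, G i w * pd i P w + 1 / 2 * pd i (G i) w * P w = lam i w := by
    intro w hw
    have h0 := hc0 w hw
    have h1 := hi w hw
    rw [((dl j i w hw).div ((dc i w hw).mul (dG i w hw)) (hcG w hw)).eq, hlj w hw, hflat w hw]
    simp only [P]
    field_simp
    ring
  have hPj : ∀ w ∈ W, pd j P w = e w * P w + c w * Q w := by
    intro w hw
    have h0 := hc0 w hw
    have h1 := hi w hw
    rw [((dl j j w hw).div ((dc j w hw).mul (dG j w hw)) (hcG w hw)).eq, hGj w hw]
    simp only [P, Q, N]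
    field_simp
    ring
  have hQi : ∀ w ∈ W, pd i Q w = e w * P w + c w * Q w := by
    intro w hw
    have h0 := hc0 w hw
    have h1 := hi w hw
    have hll : pd i (pd j (lam j)) w = pd j c w * (lam i w - lam j w)
        + c w * (e w * (lam j w - lam i w) - pd j (lam j) w) := by
      rw [← pd_comm ((hl.contDiff j).of_le (by norm_num)) hW hw j i, pd_congr_on hW hlj hw,
        ((dc j w hw).mul ((dl i j w hw).sub (dl j j w hw))).eq, hl.pd_lam hw hij]
    have hw' := hcompat w hw
    rw [(((dp clj (by simp) i w hw).add (((de i w hw).sub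
      ((dp ccj (by simp) i w hw).div (dc i w hw) h0)).mul (dl j i w hw))).div
      ((dc i w hw).mul ((dc i w hw).mul (dG i w hw))) (hccG w hw)).eq, hw', hll, hlj w hw,
      hflat w hw]
    simp only [P, Q, N]
    field_simp
    ring
  have hji : ¬ j = i := fun h => hij h.symm
  have key := fun w (hw : w ∈ W) => forall_ne_of_ne hij (p := fun a b =>
    (lam a w = G a w * pd a (if a = i then P else Q) w
      + 1 / 2 * pd a (G a) w * (if a = i then P else Q) w
      + coef lam a b w * G b w * (if b = i then P else Q) w) ∧
    (G a w * (pd b (if a = i then P else Q) w - coef lam a b w * (if a = i then P else Q) w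
      - coef lam b a w * (if b = i then P else Q) w) = 0) ∧
    pd b (if a = i then P else Q) w = pd a (if b = i then P else Q) w)
    (by
      simp only [if_true, hji, if_false]
      refine ⟨?_, ?_, by rw [hPj w hw, hQi w hw]⟩
      · rw [hPi w hw, hj w hw]; ring
      · rw [hPj w hw]; ring)
    (by
      have h0 := hc0 w hw
      have h1 := hi w hw
      simp only [if_true, hji, if_false]
      refine ⟨?_, ?_, by rw [hPj w hw, hQi w hw]⟩
      · rw [hj w hw, pd_congr_on hW hj hw, pd_const]
        simp only [P, ← hcdef]
        field_simp
        ring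
      · rw [hj w hw]; ring)
  refine hG.exists_formulation hl hc (p := fun a => if a = i then P else Q) (fun a => ?_)
    (fun w hw a b hab => (key w hw a b hab).1) (fun w hw a b hab => (key w hw a b hab).2.1)
    (fun w hw => (key w hw 0 1 (by decide)).2.2)
  by_cases ha : a = i
  · simp only [ha, if_true]; exact CP
  · simp only [ha, if_false]; exact CQ

/-- A continuous function without zeros on a convex set has constant sign. -/
lemma exists_sign (hc : Convex ℝ W) {F : Plane → ℝ} (hF : ContinuousOn F W)
    (h0 : ∀ u ∈ W, F u ≠ 0) : ∃ ε : ℝ, ε ^ 2 = 1 ∧ ∀ u ∈ W, 0 < ε * F u := by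
  by_cases hpos : ∃ w ∈ W, 0 < F w
  · obtain ⟨w, hw, hpos⟩ := hpos
    refine ⟨1, one_pow 2, fun u hu => ?_⟩
    rw [one_mul]
    by_contra hneg
    obtain ⟨v, hv, hv0⟩ := hc.isPreconnected.intermediate_value hu hw hF ⟨not_lt.mp hneg, hpos.le⟩
    exact h0 v hv hv0
  · push Not at hpos
    exact ⟨-1, by norm_num, fun u hu => by
      rw [neg_one_mul]
      exact neg_pos.mpr (lt_of_le_of_ne (hpos u hu) (h0 u hu))⟩

/-- The circular functions for `ε = 1`, the hyperbolic functions for `ε = -1`. -/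
lemma exists_circular {ε : ℝ} (hε : ε ^ 2 = 1) : ∃ C S : ℝ → ℝ, (∀ t, HasDerivAt S (C t) t) ∧
    (∀ t, HasDerivAt C (-ε * S t) t) ∧ ∀ t, C t ^ 2 + ε * S t ^ 2 = 1 := by
  rcases mul_self_eq_one_iff.mp ((sq ε).symm.trans hε) with rfl | rfl
  · refine ⟨Real.cos, Real.sin, Real.hasDerivAt_sin, fun t => ?_, fun t => ?_⟩
    · simpa using Real.hasDerivAt_cos t
    · linarith [Real.sin_sq_add_cos_sq t]
  · refine ⟨Real.cosh, Real.sinh, Real.hasDerivAt_sinh, fun t => ?_, fun t => ?_⟩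
    · simpa using Real.hasDerivAt_cosh t
    · linarith [Real.cosh_sq t]

/-- The roots `H_i = |G_i|^{-1/2}`: the Lamé coefficients of the metric. -/
lemma IsFlatPair.exists_lame (hl : IsDiagSystem lam W) (hc : Convex ℝ W) (hG : IsFlatPair lam W G)
    (h0 : ∀ u ∈ W, G i u ≠ 0) : ∃ (ε : ℝ) (H : Plane → ℝ), ε ^ 2 = 1 ∧ ContDiffOn ℝ 2 H W ∧
      ∀ u ∈ W, 0 < H u ∧ G i u = ε / H u ^ 2 ∧
        ∀ c, pd c H u = -(1 / 2) * H u * pd c (G i) u / G i u := by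
  obtain ⟨ε, hε, hpos⟩ := exists_sign hc (hG.contDiff i).continuousOn h0
  have hH : ContDiffOn ℝ 2 (fun u => (√(ε * G i u))⁻¹) W :=
    ((contDiffOn_const.mul (hG.contDiff i)).sqrt fun u hu => (hpos u hu).ne').inv
      fun u hu => (Real.sqrt_pos.mpr (hpos u hu)).ne'
  have hval : ∀ u ∈ W, (√(ε * G i u))⁻¹ ^ 2 * G i u = ε := fun u hu => by
    rw [inv_pow, Real.sq_sqrt (hpos u hu).le]
    have := h0 u hu
    have h1 : ε ≠ 0 := fun h => by simp [h] at hε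
    field_simp
    exact hε.symm
  refine ⟨ε, _, hε, hH, fun u hu => ?_⟩
  have hHpos : 0 < (√(ε * G i u))⁻¹ := inv_pos.mpr (Real.sqrt_pos.mpr (hpos u hu))
  refine ⟨hHpos, ?_, fun c => ?_⟩
  · rw [eq_div_iff (pow_pos hHpos 2).ne', mul_comm]
    exact hval u hu
  · have h1 := pd_congr_on hl.isOpen hval hu c
    have hd := HasPd.of_contDiffOn hH (by simp) hl.isOpen hu c
    simp only [sq] at h1
    have hdG := HasPd.of_contDiffOn (hG.contDiff i) (by simp) hl.isOpen hu c
    rw [pd_const, ((hd.mul hd).mul hdG).eq] at h1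
    rw [eq_div_iff (h0 u hu)]
    refine mul_left_cancel₀ hHpos.ne' ?_
    linear_combination 1 / 2 * h1

/-- In a flat pair without zeros the Lamé coefficients turn the equations for the differential of
the Hamiltonian into a linear system with a rotation (or a boost) as fundamental solution, which the
variation of constants reduces to quadratures. -/
theorem IsFlatPair.exists_formulation_of_nondegenerate (hl : IsDiagSystem lam W) (hc : Convex ℝ W)
    (hG : IsFlatPair lam W G) (h0 : ∀ u ∈ W, ∀ i, G i u ≠ 0) :
    ∃ h, IsHamiltonianFormulation lam W (diagOp lam G) h := by
  have hW := hl.isOpen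
  have h01 : (0 : Fin 2) ≠ 1 := by decide
  obtain ⟨ε₀, H₀, hε₀, CH₀, hH₀⟩ := hG.exists_lame hl hc (i := 0) fun u hu => h0 u hu 0
  obtain ⟨ε₁, H₁, hε₁, CH₁, hH₁⟩ := hG.exists_lame hl hc (i := 1) fun u hu => h0 u hu 1
  set c := coef lam 0 1 with hcdef
  set e := coef lam 1 0 with hedef
  have dp : ∀ {n : WithTop ℕ∞} {F : Plane → ℝ}, ContDiffOn ℝ n F W → n ≠ 0 → ∀ a, ∀ w ∈ W,
      HasPd a F (pd a F w) w := fun hF hn a w hw => HasPd.of_contDiffOn hF hn hW hw a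
  have dl : ∀ k a, ∀ w ∈ W, HasPd a (lam k) (pd a (lam k) w) w := fun k =>
    dp (hl.contDiff k) (by simp)
  have Cc : ContDiffOn ℝ 5 c W := hl.contDiff_coef h01
  have Ce : ContDiffOn ℝ 5 e W := hl.contDiff_coef h01.symm
  have dc := dp Cc (by simp)
  have de := dp Ce (by simp)
  have dH₀ := dp CH₀ (by simp)
  have dH₁ := dp CH₁ (by simp)
  have p₀ : ∀ w ∈ W, H₀ w ≠ 0 := fun w hw => (hH₀ w hw).1.ne'
  have p₁ : ∀ w ∈ W, H₁ w ≠ 0 := fun w hw => (hH₁ w hw).1.ne'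
  have hH₀1 : ∀ w ∈ W, pd 1 H₀ w = c w * H₀ w := fun w hw => by
    have := h0 w hw 0
    rw [(hH₀ w hw).2.2, hG.pd_eq w hw 0 1 h01, ← hcdef]
    field_simp
  have hH₁0 : ∀ w ∈ W, pd 0 H₁ w = e w * H₁ w := fun w hw => by
    have := h0 w hw 1
    rw [(hH₁ w hw).2.2, hG.pd_eq w hw 1 0 h01.symm, ← hedef]
    field_simp
  -- the rotation coefficients
  set β : Plane → ℝ := fun w => c w * H₀ w / H₁ w with hβ
  set γ : Plane → ℝ := fun w => e w * H₁ w / H₀ w with hγ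
  have Cβ : ContDiffOn ℝ 2 β W := ((Cc.of_le (by norm_num)).mul CH₀).div CH₁ p₁
  have Cγ : ContDiffOn ℝ 2 γ W := ((Ce.of_le (by norm_num)).mul CH₁).div CH₀ p₀
  have hεε : (ε₀ * ε₁) ^ 2 = 1 := by rw [mul_pow, hε₀, hε₁, one_mul]
  obtain ⟨C, S, hS, hC, hCS⟩ := exists_circular hεε
  set ε := ε₀ * ε₁ with hε
  -- the angle `ψ`; that its differential is closed is the flatness of the pair
  obtain ⟨ψ, hψd, hψ⟩ := exists_pd_eq (P := β) (Q := fun w => -ε * γ w) hW hc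
    (Cβ.differentiableOn (by simp)) ((contDiffOn_const.mul Cγ).differentiableOn (n := 2) (by simp))
    (fun w hw => by
      have h2 := p₀ w hw
      have h3 := p₁ w hw
      have hf := hG.flat w hw 0 1 h01
      have e0 : pd 0 (G 0) w = -2 * (pd 0 H₀ w / H₀ w) * G 0 w := by
        have := h0 w hw 0
        rw [(hH₀ w hw).2.2]; field_simp
      have e1 : pd 1 (G 1) w = -2 * (pd 1 H₁ w / H₁ w) * G 1 w := by
        have := h0 w hw 1
        rw [(hH₁ w hw).2.2]; field_simp
      rw [e0, e1, (hH₀ w hw).2.1, (hH₁ w hw).2.1, ← hcdef, ← hedef] at hf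
      rw [(((dc 1 w hw).mul (dH₀ 1 w hw)).div (dH₁ 1 w hw) h3).eq, ((((de 0 w hw).mul
        (dH₁ 0 w hw)).div (dH₀ 0 w hw) h2).const_mul (-ε)).eq, hH₀1 w hw, hH₁0 w hw]
      field_simp at hf ⊢
      linear_combination ε₁ * hf - (H₀ w ^ 3 * H₁ w * (pd 1 c w + c w ^ 2)
        - H₀ w ^ 3 * c w * pd 1 H₁ w) * hε₁)
  have dψ : ∀ w ∈ W, HasPd 0 ψ (β w) w ∧ HasPd 1 ψ (-ε * γ w) w := fun w hw =>
    have hd := hψd.differentiableAt (hW.mem_nhds hw)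
    ⟨⟨hd, (hψ w hw).1⟩, ⟨hd, (hψ w hw).2⟩⟩
  have dC0 := fun w hw => HasPd.comp (hC (ψ w)) (dψ w hw).1
  have dC1 := fun w hw => HasPd.comp (hC (ψ w)) (dψ w hw).2
  have dS0 := fun w hw => HasPd.comp (hS (ψ w)) (dψ w hw).1
  have dS1 := fun w hw => HasPd.comp (hS (ψ w)) (dψ w hw).2
  set μ₀ : Plane → ℝ := fun w => ε₀ * (lam 0 w * H₀ w) with hμ₀
  set μ₁ : Plane → ℝ := fun w => ε₁ * (lam 1 w * H₁ w) with hμ₁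
  have hμ₀1 : ∀ w ∈ W, HasPd 1 μ₀ (ε₀ * (c w * lam 1 w * H₀ w)) w := fun w hw => by
    have h := ((dl 0 1 w hw).mul (dH₀ 1 w hw)).const_mul ε₀
    refine ⟨h.diff, h.eq.trans ?_⟩
    rw [hl.pd_lam hw h01, hH₀1 w hw]; ring
  have hμ₁0 : ∀ w ∈ W, HasPd 0 μ₁ (ε₁ * (e w * lam 0 w * H₁ w)) w := fun w hw => by
    have h := ((dl 1 0 w hw).mul (dH₁ 0 w hw)).const_mul ε₁
    refine ⟨h.diff, h.eq.trans ?_⟩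
    rw [hl.pd_lam hw h01.symm, hH₁0 w hw]; ring
  have hdμ₀ : ∀ w ∈ W, DifferentiableAt ℝ μ₀ w := fun w hw => (hμ₀1 w hw).diff
  have hdμ₁ : ∀ w ∈ W, DifferentiableAt ℝ μ₁ w := fun w hw => (hμ₁0 w hw).diff
  have hdC : ∀ w ∈ W, DifferentiableAt ℝ (fun w => C (ψ w)) w := fun w hw => (dC0 w hw).diff
  have hdS : ∀ w ∈ W, DifferentiableAt ℝ (fun w => S (ψ w)) w := fun w hw => (dS0 w hw).diff
  have hβμ : ∀ w ∈ W, β w * μ₁ w = ε₁ * (c w * lam 1 w * H₀ w) := fun w hw => by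
    have := p₁ w hw
    simp only [β, μ₁]; field_simp
  have hγμ : ∀ w ∈ W, γ w * μ₀ w = ε₀ * (e w * lam 0 w * H₁ w) := fun w hw => by
    have := p₀ w hw
    simp only [γ, μ₀]; field_simp
  have hε0 : ε * ε₀ = ε₁ := by rw [hε]; linear_combination ε₁ * hε₀
  have hε1 : ε * ε₁ = ε₀ := by rw [hε]; linear_combination ε₀ * hε₁
  -- `(R, T)` are the normalised components `(∂_0 h / H_0, ∂_1 h / H_1)` in the rotated frame
  obtain ⟨R, hRd, hR⟩ := exists_pd_eq (P := fun w => C (ψ w) * μ₀ w)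
    (Q := fun w => ε * (S (ψ w) * μ₁ w)) hW hc
    (fun w hw => ((hdC w hw).mul (hdμ₀ w hw)).differentiableWithinAt)
    (fun w hw => (((hdS w hw).mul (hdμ₁ w hw)).const_mul ε).differentiableWithinAt)
    (fun w hw => by
      rw [((dC1 w hw).mul (hμ₀1 w hw)).eq, (((dS0 w hw).mul (hμ₁0 w hw)).const_mul ε).eq]
      linear_combination S (ψ w) * γ w * μ₀ w * hεε + S (ψ w) * hγμ w hw
        - ε * C (ψ w) * hβμ w hw
        - (C (ψ w) * (c w * lam 1 w * H₀ w) + S (ψ w) * (e w * lam 0 w * H₁ w)) * hε1)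
  obtain ⟨T, hTd, hT⟩ := exists_pd_eq (P := fun w => -(S (ψ w) * μ₀ w))
    (Q := fun w => C (ψ w) * μ₁ w) hW hc
    (fun w hw => ((hdS w hw).mul (hdμ₀ w hw)).neg.differentiableWithinAt)
    (fun w hw => ((hdC w hw).mul (hdμ₁ w hw)).differentiableWithinAt)
    (fun w hw => by
      rw [((dS1 w hw).mul (hμ₀1 w hw)).neg.eq, ((dC0 w hw).mul (hμ₁0 w hw)).eq]
      linear_combination ε * C (ψ w) * hγμ w hw + ε * S (ψ w) * hβμ w hw
        + C (ψ w) * (e w * lam 0 w * H₁ w) * hε0 + S (ψ w) * (c w * lam 1 w * H₀ w) * hε1)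
  have dR : ∀ w ∈ W, HasPd 0 R (C (ψ w) * μ₀ w) w ∧ HasPd 1 R (ε * (S (ψ w) * μ₁ w)) w :=
    fun w hw =>
    have hd := hRd.differentiableAt (hW.mem_nhds hw)
    ⟨⟨hd, (hR w hw).1⟩, ⟨hd, (hR w hw).2⟩⟩
  have dT : ∀ w ∈ W, HasPd 0 T (-(S (ψ w) * μ₀ w)) w ∧ HasPd 1 T (C (ψ w) * μ₁ w) w :=
    fun w hw =>
    have hd := hTd.differentiableAt (hW.mem_nhds hw)
    ⟨⟨hd, (hT w hw).1⟩, ⟨hd, (hT w hw).2⟩⟩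
  set P : Plane → ℝ := fun w => C (ψ w) * R w - ε * (S (ψ w) * T w) with hP
  set Q : Plane → ℝ := fun w => S (ψ w) * R w + C (ψ w) * T w with hQ
  have hP0 : ∀ w ∈ W, HasPd 0 P (μ₀ w - ε * β w * Q w) w := fun w hw => by
    have h := ((dC0 w hw).mul (dR w hw).1).sub (((dS0 w hw).mul (dT w hw).1).const_mul ε)
    refine ⟨h.diff, h.eq.trans ?_⟩
    simp only [Q]
    linear_combination μ₀ w * hCS (ψ w)
  have hP1 : ∀ w ∈ W, HasPd 1 P (γ w * Q w) w := fun w hw => by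
    have h := ((dC1 w hw).mul (dR w hw).2).sub (((dS1 w hw).mul (dT w hw).2).const_mul ε)
    refine ⟨h.diff, h.eq.trans ?_⟩
    simp only [Q]
    linear_combination γ w * (S (ψ w) * R w + C (ψ w) * T w) * hεε
  have hQ0 : ∀ w ∈ W, HasPd 0 Q (β w * P w) w := fun w hw => by
    have h := ((dS0 w hw).mul (dR w hw).1).add ((dC0 w hw).mul (dT w hw).1)
    refine ⟨h.diff, h.eq.trans ?_⟩
    simp only [P]
    ring
  have hQ1 : ∀ w ∈ W, HasPd 1 Q (μ₁ w - ε * γ w * P w) w := fun w hw => by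
    have h := ((dS1 w hw).mul (dR w hw).2).add ((dC1 w hw).mul (dT w hw).2)
    refine ⟨h.diff, h.eq.trans ?_⟩
    simp only [P]
    linear_combination μ₁ w * hCS (ψ w)
  have cP : ContinuousOn P W := fun w hw => (hP0 w hw).diff.continuousAt.continuousWithinAt
  have cQ : ContinuousOn Q W := fun w hw => (hQ0 w hw).diff.continuousAt.continuousWithinAt
  have cμ₀ : ContinuousOn μ₀ W := fun w hw => (hdμ₀ w hw).continuousAt.continuousWithinAt
  have cμ₁ : ContinuousOn μ₁ W := fun w hw => (hdμ₁ w hw).continuousAt.continuousWithinAt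
  have CP : ContDiffOn ℝ 1 P W := by
    have := contDiffOn_succ_of_pd (n := 0) (F := P) hW
      (fun w hw => (hP0 w hw).diff.differentiableWithinAt) (forall_fin_two_of_ne h01
        (contDiffOn_zero.mpr ((cμ₀.sub ((continuousOn_const.mul Cβ.continuousOn).mul cQ)).congr
          fun w hw => (hP0 w hw).eq))
        (contDiffOn_zero.mpr ((Cγ.continuousOn.mul cQ).congr fun w hw => (hP1 w hw).eq)))
    simpa using this
  have CQ : ContDiffOn ℝ 1 Q W := by
    have := contDiffOn_succ_of_pd (n := 0) (F := Q) hW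
      (fun w hw => (hQ0 w hw).diff.differentiableWithinAt) (forall_fin_two_of_ne h01
        (contDiffOn_zero.mpr ((Cβ.continuousOn.mul cP).congr fun w hw => (hQ0 w hw).eq))
        (contDiffOn_zero.mpr ((cμ₁.sub ((continuousOn_const.mul Cγ.continuousOn).mul cP)).congr
          fun w hw => (hQ1 w hw).eq)))
    simpa using this
  have hp : ∀ w ∈ W, pd 1 (fun w => H₀ w * P w) w
      = c w * (H₀ w * P w) + e w * (H₁ w * Q w) := fun w hw => by
    have := p₀ w hw
    rw [((dH₀ 1 w hw).mul (hP1 w hw)).eq, hH₀1 w hw]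
    simp only [γ]
    field_simp
  have hq : ∀ w ∈ W, pd 0 (fun w => H₁ w * Q w) w
      = c w * (H₀ w * P w) + e w * (H₁ w * Q w) := fun w hw => by
    have := p₁ w hw
    rw [((dH₁ 0 w hw).mul (hQ0 w hw)).eq, hH₁0 w hw]
    simp only [β]
    field_simp
    ring
  refine hG.exists_formulation hl hc (p := ![fun w => H₀ w * P w, fun w => H₁ w * Q w])
    (forall_fin_two_of_ne h01 ((CH₀.of_le (by norm_num)).mul CP)
      ((CH₁.of_le (by norm_num)).mul CQ))
    (fun w hw => forall_ne_of_ne h01 ?_ ?_) (fun w hw => forall_ne_of_ne h01 ?_ ?_)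
    (fun w hw => (hp w hw).trans (hq w hw).symm)
  · have h2 := p₀ w hw
    have h3 := p₁ w hw
    simp only [Matrix.cons_val_zero, Matrix.cons_val_one, Matrix.cons_val_fin_one]
    have h4 : G 0 w * pd 0 H₀ w = -(1 / 2) * H₀ w * pd 0 (G 0) w := by
      rw [(hH₀ w hw).2.2, mul_div_cancel₀ _ (h0 w hw 0)]
    have h5 : G 0 w * H₀ w * μ₀ w = lam 0 w := by
      rw [(hH₀ w hw).2.1]; simp only [μ₀]; field_simp; linear_combination lam 0 w * hε₀
    have h6 : G 0 w * H₀ w * (ε * β w) = c w * G 1 w * H₁ w := by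
      rw [(hH₀ w hw).2.1, (hH₁ w hw).2.1]; simp only [β]; field_simp; linear_combination c w * hε0
    rw [((dH₀ 0 w hw).mul (hP0 w hw)).eq, ← hcdef]
    linear_combination -P w * h4 - h5 + Q w * h6
  · have h2 := p₀ w hw
    have h3 := p₁ w hw
    simp only [Matrix.cons_val_zero, Matrix.cons_val_one, Matrix.cons_val_fin_one]
    have h4 : G 1 w * pd 1 H₁ w = -(1 / 2) * H₁ w * pd 1 (G 1) w := by
      rw [(hH₁ w hw).2.2, mul_div_cancel₀ _ (h0 w hw 1)]
    have h5 : G 1 w * H₁ w * μ₁ w = lam 1 w := by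
      rw [(hH₁ w hw).2.1]; simp only [μ₁]; field_simp; linear_combination lam 1 w * hε₁
    have h6 : G 1 w * H₁ w * (ε * γ w) = e w * G 0 w * H₀ w := by
      rw [(hH₀ w hw).2.1, (hH₁ w hw).2.1]; simp only [γ]; field_simp; linear_combination e w * hε1
    rw [((dH₁ 1 w hw).mul (hQ1 w hw)).eq, ← hedef]
    linear_combination -Q w * h4 - h5 + P w * h6
  · simp only [Matrix.cons_val_zero, Matrix.cons_val_one, Matrix.cons_val_fin_one]
    rw [hp w hw, ← hcdef, ← hedef]; ring
  · simp only [Matrix.cons_val_zero, Matrix.cons_val_one, Matrix.cons_val_fin_one]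
    rw [hq w hw, ← hcdef, ← hedef]; ring

end Hamiltonian

/-! ### Hamiltonian formulations against first integrals -/

section Correspondence

variable {lam : Fin 2 → Plane → ℝ} {W : Set Plane} {n : ℕ}

lemma indepForms_killingOf (hl : IsDiagSystem lam W) {Ω : Fin n → HydroOp}
    (hS : ∀ i, StructureEqs lam W (Ω i)) (hind : IndepOps W Ω) :
    IndepForms W fun i => killingOf lam fun a => (Ω i).g a a := by
  intro c hc
  have hW := hl.isOpen
  have hdiag : ∀ u ∈ W, ∀ a, ∑ i, c i * (Ω i).g a a u = 0 := fun u hu a => by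
    have h := hc u hu a.rev
    have hne := (ne_rev a).symm
    simp only [killingOf_eq hne, mul_left_comm (c _) (coef lam a.rev a u), ← Finset.mul_sum] at h
    exact (mul_eq_zero.mp h).resolve_left (hl.coef_ne u hu _ _ hne)
  refine hind c fun u hu => ⟨fun a b => ?_, fun a b d => ?_⟩
  · by_cases hab : a = b
    · rw [← hab]; exact hdiag u hu a
    · simp only [(hS _).g_off u hu a b hab, mul_zero, Finset.sum_const_zero]
  · by_cases hab : a = b
    · subst hab
      have h := pd_congr_on hW (fun w hw => hdiag w hw a) hu d
      have hd : ∀ i, DifferentiableAt ℝ ((Ω i).g a a) u := fun i =>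
        differentiableAt_of_contDiffOn ((hS i).contDiff_g a a) (by simp) hW hu
      rw [pd_const, pd_sum fun i _ => (hd i).const_mul (c i)] at h
      simp only [pd_const_mul (hd _)] at h
      simp only [(hS _).b_diag u hu, mul_left_comm (c _) (1 / 2 : ℝ), ← Finset.mul_sum, h, mul_zero]
    · refine forall_fin_two_of_ne (p := fun d => ∑ i, c i * (Ω i).b a b d u = 0) hab ?_ ?_ d
      · simp only [(hS _).b_fst u hu a b hab, mul_left_comm (c _) (coef lam a b u),
          ← Finset.mul_sum, hdiag u hu, mul_zero]
      · simp only [(hS _).b_snd u hu a b hab, mul_left_comm (c _) (-coef lam b a u),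
          ← Finset.mul_sum, hdiag u hu, mul_zero]

lemma indepOps_diagOp (hl : IsDiagSystem lam W) {K : Fin n → Fin 2 → Plane → ℝ}
    (hind : IndepForms W K) : IndepOps W fun i => diagOp lam (pairOf lam (K i)) := by
  intro c hc
  refine hind c fun u hu a => ?_
  have h := (hc u hu).1 a.rev a.rev
  simp only [diagOp_g_self, pairOf_eq (ne_rev a), ← mul_div_assoc, ← Finset.sum_div] at h
  exact (div_eq_zero_iff.mp h).resolve_right (hl.coef_ne u hu _ _ (ne_rev a))

theorem admitsFirstIntegrals_of_admitsHamiltonians (hl : IsDiagSystem lam W)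
    (h : AdmitsHamiltonians lam W n) : AdmitsFirstIntegrals (christoffel lam) W n := by
  obtain ⟨Ω, hΩ, hind⟩ := h
  choose h hh using hΩ
  have hS := fun i => (hh i).structureEqs hl
  exact ⟨_, fun i => (isFirstIntegral_iff_isKilling hl).mpr ((hS i).isFlatPair.isKilling hl),
    indepForms_killingOf hl hS hind⟩

theorem admitsNondegHamiltonians_iff (hl : IsDiagSystem lam W) (hc : Convex ℝ W) :
    AdmitsNondegHamiltonians lam W n ↔ AdmitsNondegFirstIntegrals (christoffel lam) W n := by
  have h01 : (0 : Fin 2) ≠ 1 := by decide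
  constructor
  · rintro ⟨Ω, hΩ, hind⟩
    choose h hh using fun i => (hΩ i).1
    have hS := fun i => (hh i).structureEqs hl
    refine ⟨_, fun i => ⟨(isFirstIntegral_iff_isKilling hl).mpr ((hS i).isFlatPair.isKilling hl),
      fun u hu a => ?_⟩, indepForms_killingOf hl hS hind⟩
    have hdet := (hΩ i).2 u hu
    rw [Matrix.det_fin_two] at hdet
    simp only [Matrix.of_apply, (hS i).g_off u hu 0 1 h01, zero_mul, sub_zero] at hdet
    have hg : ∀ b, (Ω i).g b b u ≠ 0 :=
      forall_fin_two_of_ne h01 (left_ne_zero_of_mul hdet) (right_ne_zero_of_mul hdet)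
    exact mul_ne_zero (hl.coef_ne u hu _ _ (ne_rev a)) (hg _)
  · rintro ⟨K, hK, hind⟩
    have hG := fun i => ((isFirstIntegral_iff_isKilling hl).mp (hK i).1).isFlatPair hl
    have h0 : ∀ i, ∀ u ∈ W, ∀ a, pairOf lam (K i) a u ≠ 0 := fun i u hu a =>
      div_ne_zero ((hK i).2 u hu _) (hl.coef_ne u hu _ _ (ne_rev a).symm)
    refine ⟨_, fun i => ⟨(hG i).exists_formulation_of_nondegenerate hl hc (h0 i), fun u hu => ?_⟩,
      indepOps_diagOp hl hind⟩
    rw [Matrix.det_fin_two]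
    simp only [Matrix.of_apply, diagOp_g_self, diagOp_g_off h01, zero_mul, sub_zero]
    exact mul_ne_zero (h0 i u hu 0) (h0 i u hu 1)

end Correspondence

/-! ### The space of first integrals -/

section KillingSpace

variable {lam : Fin 2 → Plane → ℝ} {W : Set Plane} {n : ℕ} {p : Plane}

lemma IsKilling.mono {K : Fin 2 → Plane → ℝ} (hK : IsKilling lam W K) {V : Set Plane}
    (hV : V ⊆ W) : IsKilling lam V K :=
  ⟨fun a => (hK.contDiff a).mono hV, fun u hu => hK.pd_self u (hV hu),
    fun u hu => hK.pd_symm u (hV hu)⟩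

lemma IsKilling.sum {ι : Type*} [Fintype ι] (hl : IsDiagSystem lam W)
    {K : ι → Fin 2 → Plane → ℝ} (hK : ∀ i, IsKilling lam W (K i)) (c : ι → ℝ) :
    IsKilling lam W fun a u => ∑ i, c i * K i a u := by
  have hpd : ∀ u ∈ W, ∀ a b, pd b (fun u => ∑ i, c i * K i a u) u = ∑ i, c i * pd b (K i a) u :=
    fun u hu a b => by
      have hd : ∀ i, DifferentiableAt ℝ (K i a) u := fun i =>
        differentiableAt_of_contDiffOn ((hK i).contDiff a) (by simp) hl.isOpen hu
      rw [pd_sum fun i _ => (hd i).const_mul (c i)]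
      simp only [pd_const_mul (hd _)]
  refine ⟨fun a => ContDiffOn.sum fun i _ => contDiffOn_const.mul ((hK i).contDiff a),
    fun u hu i j hij => ?_, fun u hu i j hij => ?_⟩
  · rw [hpd u hu, Finset.mul_sum]
    exact Finset.sum_congr rfl fun k _ => by rw [(hK k).pd_self u hu i j hij]; ring
  · rw [hpd u hu, hpd u hu, Finset.mul_sum, Finset.mul_sum, ← Finset.sum_add_distrib,
      ← Finset.sum_add_distrib]
    exact Finset.sum_congr rfl fun k _ => by
      linear_combination c k * (hK k).pd_symm u hu i j hij

lemma IsKilling.add_smul (hl : IsDiagSystem lam W) {K L : Fin 2 → Plane → ℝ}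
    (hK : IsKilling lam W K) (hL : IsKilling lam W L) (t : ℝ) :
    IsKilling lam W fun a u => K a u + t * L a u := by
  have := IsKilling.sum hl (K := ![K, L]) (by
    intro i
    fin_cases i
    · exact hK
    · exact hL) ![1, t]
  simpa [Fin.sum_univ_two] using this

lemma IsKilling.jet_sum {ι : Type*} [Fintype ι] (hl : IsDiagSystem lam W)
    {K : ι → Fin 2 → Plane → ℝ} (hK : ∀ i, IsKilling lam W (K i)) (c : ι → ℝ) (hp : p ∈ W)
    (m : Fin 3) : jet (fun a u => ∑ i, c i * K i a u) m p = ∑ i, c i * jet (K i) m p := by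
  fin_cases m
  · rfl
  · rfl
  · have hd : ∀ i, DifferentiableAt ℝ (K i 1) p := fun i =>
      differentiableAt_of_contDiffOn ((hK i).contDiff 1) (by simp) hl.isOpen hp
    change pd 0 (fun u => ∑ i, c i * K i 1 u) p = ∑ i, c i * pd 0 (K i 1) p
    rw [pd_sum fun i _ => (hd i).const_mul (c i)]
    simp only [pd_const_mul (hd _)]

lemma IsKilling.jet_add_smul (hl : IsDiagSystem lam W) {K L : Fin 2 → Plane → ℝ}
    (hK : IsKilling lam W K) (hL : IsKilling lam W L) (t : ℝ) (hp : p ∈ W) (m : Fin 3) :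
    jet (fun a u => K a u + t * L a u) m p = jet K m p + t * jet L m p := by
  have := IsKilling.jet_sum hl (K := ![K, L]) (by
    intro i
    fin_cases i
    · exact hK
    · exact hL) ![1, t] hp m
  simpa [Fin.sum_univ_two] using this

/-- On a convex open set, the independence of first integrals can be read off at any one point. -/
lemma indepForms_iff_linearIndependent (hl : IsDiagSystem lam W) (hc : Convex ℝ W)
    {K : Fin n → Fin 2 → Plane → ℝ} (hK : ∀ i, IsKilling lam W (K i)) (hp : p ∈ W) :
    IndepForms W K ↔ LinearIndependent ℝ fun i m => IsKilling.jet (K i) m p := by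
  rw [Fintype.linearIndependent_iff]
  constructor
  · intro h c hsum
    have h0 : ∀ m, IsKilling.jet (fun a u => ∑ i, c i * K i a u) m p = 0 := fun m => by
      rw [IsKilling.jet_sum hl hK c hp]
      simpa using congrFun hsum m
    exact fun i => congrFun (h c fun u hu a =>
      IsKilling.eq_zero_of_jet_eq_zero hl hc (IsKilling.sum hl hK c) hp h0 hu a) i
  · intro h c hsum
    refine funext (h c (funext fun m => ?_))
    have h1 := IsKilling.jet_sum hl hK c hp m
    have h2 : IsKilling.jet (fun a u => ∑ i, c i * K i a u) m p = 0 := by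
      fin_cases m
      · exact hsum p hp 0
      · exact hsum p hp 1
      · change pd 0 (fun u => ∑ i, c i * K i 1 u) p = 0
        rw [pd_congr_on hl.isOpen (fun w hw => hsum w hw 1) hp, pd_const]
    rw [h2] at h1
    simpa using h1.symm

lemma indepForms_mono (hl : IsDiagSystem lam W) (hc : Convex ℝ W) {K : Fin n → Fin 2 → Plane → ℝ}
    (hK : ∀ i, IsKilling lam W (K i)) (hind : IndepForms W K) {V : Set Plane} (hV : IsOpen V)
    (hVc : Convex ℝ V) (hVW : V ⊆ W) (hne : V.Nonempty) : IndepForms V K := by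
  obtain ⟨p, hp⟩ := hne
  exact (indepForms_iff_linearIndependent (hl.mono hV hVW) hVc (fun i => (hK i).mono hVW) hp).mpr
    ((indepForms_iff_linearIndependent hl hc hK (hVW hp)).mp hind)

lemma admitsFirstIntegrals_iff (hl : IsDiagSystem lam W) :
    AdmitsFirstIntegrals (christoffel lam) W n ↔
      ∃ K : Fin n → Fin 2 → Plane → ℝ, (∀ i, IsKilling lam W (K i)) ∧ IndepForms W K := by
  simp only [AdmitsFirstIntegrals, isFirstIntegral_iff_isKilling hl]

lemma AdmitsFirstIntegrals.le_three (hl : IsDiagSystem lam W) (hc : Convex ℝ W)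
    (hne : W.Nonempty) (h : AdmitsFirstIntegrals (christoffel lam) W n) : n ≤ 3 := by
  obtain ⟨K, hK, hind⟩ := (admitsFirstIntegrals_iff hl).mp h
  obtain ⟨p, hp⟩ := hne
  simpa using
    ((indepForms_iff_linearIndependent hl hc hK hp).mp hind).fintype_card_le_finrank

lemma AdmitsFirstIntegrals.of_le (hl : IsDiagSystem lam W) (hc : Convex ℝ W)
    (hne : W.Nonempty) (h : AdmitsFirstIntegrals (christoffel lam) W n) {m : ℕ} (hm : m ≤ n) :
    AdmitsFirstIntegrals (christoffel lam) W m := by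
  obtain ⟨K, hK, hind⟩ := (admitsFirstIntegrals_iff hl).mp h
  obtain ⟨p, hp⟩ := hne
  refine (admitsFirstIntegrals_iff hl).mpr ⟨fun i => K (Fin.castLE hm i), fun i => hK _, ?_⟩
  rw [indepForms_iff_linearIndependent hl hc (fun i => hK _) hp]
  exact ((indepForms_iff_linearIndependent hl hc hK hp).mp hind).comp _
    (Fin.castLE_injective hm)

lemma admitsHamiltonians_zero : AdmitsHamiltonians lam W 0 :=
  ⟨fun i => i.elim0, fun i => i.elim0, fun _ _ => Subsingleton.elim _ _⟩

/-- On a small convex set, a maximal number of independent first integrals is attained: smaller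
convex sets carry no more. -/
lemma exists_maximal (hl : IsDiagSystem lam W) (hne : W.Nonempty) :
    ∃ V ⊆ W, IsOpen V ∧ Convex ℝ V ∧ V.Nonempty ∧ ∀ O ⊆ V, IsOpen O → Convex ℝ O → O.Nonempty →
      ∀ n, AdmitsFirstIntegrals (christoffel lam) O n →
        AdmitsFirstIntegrals (christoffel lam) V n := by
  classical
  let P : ℕ → Prop := fun n => ∃ V ⊆ W, IsOpen V ∧ Convex ℝ V ∧ V.Nonempty ∧
    AdmitsFirstIntegrals (christoffel lam) V n
  have hP0 : P 0 := by
    obtain ⟨p, hp⟩ := hne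
    obtain ⟨r, hr, hball⟩ := Metric.isOpen_iff.mp hl.isOpen p hp
    exact ⟨_, hball, Metric.isOpen_ball, convex_ball p r, ⟨p, Metric.mem_ball_self hr⟩,
      fun i => i.elim0, fun i => i.elim0, fun _ _ => Subsingleton.elim _ _⟩
  have hP3 : ∀ n, P n → n ≤ 3 := by
    rintro n ⟨V, hVW, hV, hVc, hVne, h⟩
    exact h.le_three (hl.mono hV hVW) hVc hVne
  obtain ⟨V, hVW, hV, hVc, hVne, hmax⟩ := Nat.findGreatest_spec (P := P) (Nat.zero_le 3) hP0
  refine ⟨V, hVW, hV, hVc, hVne, fun O hOV hO hOc hOne n hn => ?_⟩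
  have hPn : P n := ⟨O, hOV.trans hVW, hO, hOc, hOne, hn⟩
  exact hmax.of_le (hl.mono hV hVW) hVc hVne (Nat.le_findGreatest (hP3 n hPn) hPn)

end KillingSpace

/-! ### Generic points -/

section Generic

variable {lam : Fin 2 → Plane → ℝ} {V W : Set Plane} {n : ℕ}

/-- Translating a linearly independent family by a fixed vector preserves independence when the
family is rescaled by a small nonzero factor: at most one nonzero factor is exceptional. -/
lemma eventually_linearIndependent_add_smul {E : Type*} [AddCommGroup E] [Module ℝ E]
    {v : Fin n → E} (hv : LinearIndependent ℝ v) (x : E) :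
    ∀ᶠ t : ℝ in 𝓝[≠] 0, LinearIndependent ℝ fun i => x + t • v i := by
  obtain ⟨s, hs⟩ : ∃ s : ℝ, ∀ c : Fin n → ℝ, ∀ t, t ≠ 0 → t ≠ s →
      (∑ i, c i) • x + t • ∑ i, c i • v i = 0 → ∑ i, c i = 0 := by
    by_cases hx : x ∈ Submodule.span ℝ (range v)
    · obtain ⟨a, rfl⟩ := (Submodule.mem_span_range_iff_exists_fun ℝ).mp hx
      refine ⟨-∑ i, a i, fun c t ht hts hsum => ?_⟩
      have h0 : ∑ i, ((∑ j, c j) * a i + t * c i) • v i = 0 := by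
        rw [← hsum, Finset.smul_sum, Finset.smul_sum, ← Finset.sum_add_distrib]
        exact Finset.sum_congr rfl fun i _ => by rw [smul_smul, smul_smul, add_smul]
      have h1 := Fintype.linearIndependent_iff.mp hv _ h0
      have h2 : (∑ j, c j) * (∑ i, a i + t) = 0 := by
        have : ∑ i, ((∑ j, c j) * a i + t * c i) = 0 := Finset.sum_eq_zero fun i _ => h1 i
        rw [Finset.sum_add_distrib, ← Finset.mul_sum, ← Finset.mul_sum] at this
        linear_combination this
      exact (mul_eq_zero.mp h2).resolve_right fun h => hts (by linarith)
    · refine ⟨0, fun c t _ _ hsum => ?_⟩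
      by_contra hne
      refine hx ((Submodule.smul_mem_iff _ hne).mp ?_)
      rw [eq_neg_of_add_eq_zero_left hsum]
      exact Submodule.neg_mem _ (Submodule.smul_mem _ _ (Submodule.sum_mem _ fun i _ =>
        Submodule.smul_mem _ _ (Submodule.subset_span ⟨i, rfl⟩)))
  have hne : ∀ᶠ t : ℝ in 𝓝[≠] 0, t ≠ s := by
    by_cases h : s = 0
    · rw [h]; exact self_mem_nhdsWithin
    · exact nhdsWithin_le_nhds (isOpen_ne.mem_nhds (Ne.symm h))
  filter_upwards [hne, self_mem_nhdsWithin] with t hts ht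
  refine Fintype.linearIndependent_iff.mpr fun c hc => ?_
  have hsum : (∑ i, c i) • x + t • ∑ i, c i • v i = 0 := by
    rw [← hc, Finset.sum_smul, Finset.smul_sum, ← Finset.sum_add_distrib]
    exact Finset.sum_congr rfl fun i _ => by rw [smul_add, smul_comm t]
  have h0 := hs c t ht hts hsum
  rw [h0, zero_smul, zero_add] at hsum
  exact Fintype.linearIndependent_iff.mp hv c ((smul_eq_zero.mp hsum).resolve_left ht)

/-- On every convex open subset of `V`, there are as many independent Hamiltonian formulations as
first integrals. -/
def IsGood (lam : Fin 2 → Plane → ℝ) (V : Set Plane) : Prop :=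
  ∀ W ⊆ V, IsOpen W → Convex ℝ W → ∀ n,
    AdmitsHamiltonians lam W n ↔ AdmitsFirstIntegrals (christoffel lam) W n

lemma isGood_of_forall (hl : IsDiagSystem lam V)
    (h : ∀ W ⊆ V, IsOpen W → Convex ℝ W → W.Nonempty → ∀ n,
      AdmitsFirstIntegrals (christoffel lam) W n → AdmitsHamiltonians lam W n) :
    IsGood lam V := by
  intro W hWV hW hWc n
  refine ⟨admitsFirstIntegrals_of_admitsHamiltonians (hl.mono hW hWV), fun hFI => ?_⟩
  rcases W.eq_empty_or_nonempty with rfl | hne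
  · obtain ⟨K, -, hind⟩ := hFI
    rcases Nat.eq_zero_or_pos n with rfl | hn
    · exact admitsHamiltonians_zero
    · have := congrFun (hind (fun _ => 1) (by simp)) ⟨0, hn⟩
      exact absurd this one_ne_zero
  · exact h W hWV hW hWc hne n hFI

/-- A first integral without zeros in its components can be perturbed by any others, which then
become non-degenerate. -/
lemma admitsHamiltonians_of_nondegenerate (hl : IsDiagSystem lam V) (hVc : Convex ℝ V)
    {L : Fin 2 → Plane → ℝ} (hL : IsKilling lam V L) (hL0 : ∀ u ∈ V, ∀ a, L a u ≠ 0)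
    {B : Set Plane} (hB : IsCompact B) (hBV : B ⊆ V)
    (hWB : W ⊆ B) (hW : IsOpen W) (hWc : Convex ℝ W) (hne : W.Nonempty)
    (h : AdmitsFirstIntegrals (christoffel lam) V n) : AdmitsHamiltonians lam W n := by
  obtain ⟨K, hK, hind⟩ := (admitsFirstIntegrals_iff hl).mp h
  obtain ⟨p, hp⟩ := hne
  have hWV := hWB.trans hBV
  have hlW := hl.mono hW hWV
  have hev : ∀ᶠ t : ℝ in 𝓝 0, ∀ u ∈ B, ∀ i a, L a u + t * K i a u ≠ 0 := by
    refine hB.eventually_forall_of_forall_eventually fun u hu => ?_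
    refine eventually_all.mpr fun i => eventually_all.mpr fun a => ?_
    have cL := ((hL.contDiff a).continuousOn.continuousAt (hl.isOpen.mem_nhds (hBV hu)))
    have cK := (((hK i).contDiff a).continuousOn.continuousAt (hl.isOpen.mem_nhds (hBV hu)))
    have hcont : ContinuousAt (fun z : ℝ × Plane => L a z.2 + z.1 * K i a z.2) (0, u) :=
      (ContinuousAt.comp (x := ((0 : ℝ), u)) cL continuousAt_snd).add (continuousAt_fst.mul
        (ContinuousAt.comp (x := ((0 : ℝ), u)) cK continuousAt_snd))
    exact hcont.eventually_ne (by simpa using hL0 u (hBV hu) a)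
  have hjet := eventually_linearIndependent_add_smul
    ((indepForms_iff_linearIndependent hl hVc hK (hWV hp)).mp hind)
    (fun m => IsKilling.jet L m p)
  obtain ⟨t, ht1, ht2⟩ := ((hev.filter_mono nhdsWithin_le_nhds).and hjet).exists
  have hKt : ∀ i, IsKilling lam W fun a u => L a u + t * K i a u := fun i =>
    (hL.add_smul hl (hK i) t).mono hWV
  have hindt : IndepForms W fun i a u => L a u + t * K i a u := by
    rw [indepForms_iff_linearIndependent hlW hWc hKt hp]
    have hjets : (fun i m => IsKilling.jet (fun a u => L a u + t * K i a u) m p)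
        = fun i => (fun m => IsKilling.jet L m p) + t • fun m => IsKilling.jet (K i) m p :=
      funext fun i => funext fun m => IsKilling.jet_add_smul hl hL (hK i) t (hWV hp) m
    rw [hjets]
    exact ht2
  obtain ⟨Ω, hΩ, hind⟩ := (admitsNondegHamiltonians_iff hlW hWc).mpr
    ⟨_, fun i => ⟨(isFirstIntegral_iff_isKilling hlW).mpr (hKt i),
      fun u hu a => ht1 u (hWB hu) i a⟩, hindt⟩
  exact ⟨Ω, fun i => (hΩ i).1, hind⟩

/-- A first integral one of whose components vanishes identically is determined by the value of the
other at a point. -/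
lemma IsKilling.eq_zero_of_component (hl : IsDiagSystem lam W) (hc : Convex ℝ W)
    {K : Fin 2 → Plane → ℝ} (hK : IsKilling lam W K) {i j : Fin 2} (hij : i ≠ j)
    (hj : ∀ u ∈ W, K j u = 0) {p : Plane} (hp : p ∈ W) (hi : K i p = 0) {u : Plane} (hu : u ∈ W)
    (a : Fin 2) : K a u = 0 := by
  have hall : ∀ a, K a p = 0 := forall_fin_two_of_ne hij hi (hj p hp)
  have hpdj : ∀ c, pd c (K j) p = 0 := fun c => by
    rw [pd_congr_on hl.isOpen hj hp, pd_const]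
  refine eq_zero_of_jet_eq_zero hl hc hK hp (fun m => ?_) hu a
  fin_cases m
  · exact hall 0
  · exact hall 1
  · change pd 0 (K 1) p = 0
    have h := hK.pd_symm p hp 0 1 (by decide)
    rw [hall 0, hall 1] at h
    revert hpdj
    fin_cases j
    · intro hpdj
      have := hpdj 1
      simp only [Fin.zero_eta] at this
      linarith
    · intro hpdj
      exact hpdj 0

lemma admitsHamiltonians_of_degenerate (hl : IsDiagSystem lam W) (hc : Convex ℝ W)
    {i j : Fin 2} (hij : i ≠ j)
    (hj : ∀ K, IsKilling lam W K → ∀ u ∈ W, K j u = 0)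
    (h : AdmitsFirstIntegrals (christoffel lam) W n) : AdmitsHamiltonians lam W n := by
  obtain ⟨K, hK, hind⟩ := (admitsFirstIntegrals_iff hl).mp h
  refine ⟨_, fun k => ?_, indepOps_diagOp hl hind⟩
  have hi : ∀ u ∈ W, K k i u ≠ 0 := fun u hu h0 => by
    have hz := fun w hw => (hK k).eq_zero_of_component hl hc hij (hj _ (hK k)) hu h0 (u := w) hw
    have := congrFun (hind (Pi.single k 1) fun w hw a => by
      rw [Finset.sum_eq_single k (fun l _ hlk => by rw [Pi.single_eq_of_ne hlk, zero_mul])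
        (by simp), hz w hw, mul_zero]) k
    simp at this
  refine ((hK k).isFlatPair hl).exists_formulation_of_degenerate hl hc hij.symm (fun u hu => ?_)
    fun u hu => ?_
  · rw [pairOf_eq hij]
    exact div_ne_zero (hi u hu) (hl.coef_ne u hu _ _ hij)
  · rw [pairOf_eq hij.symm, hj _ (hK k) u hu, zero_div]

/-- Either some first integral is non-degenerate, or all of them share a vanishing component. -/
theorem exists_isGood (hl : IsDiagSystem lam W) (hne : W.Nonempty) :
    ∃ V ⊆ W, IsOpen V ∧ V.Nonempty ∧ IsGood lam V := by
  obtain ⟨V, hVW, hV, hVc, hVne, hmax⟩ := exists_maximal hl hne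
  have hlV := hl.mono hV hVW
  by_cases hA : ∃ O ⊆ V, IsOpen O ∧ Convex ℝ O ∧ O.Nonempty ∧ ∃ L, IsKilling lam O L ∧
      ∀ u ∈ O, ∀ a, L a u ≠ 0
  · obtain ⟨O, hOV, hO, hOc, ⟨p, hp⟩, L, hL, hL0⟩ := hA
    obtain ⟨r, hr, hball⟩ := Metric.nhds_basis_closedBall.mem_iff.mp (hO.mem_nhds hp)
    have hlO := hlV.mono hO hOV
    have hsub : Metric.ball p r ⊆ O := Metric.ball_subset_closedBall.trans hball
    refine ⟨Metric.ball p r, (hsub.trans hOV).trans hVW, Metric.isOpen_ball,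
      ⟨p, Metric.mem_ball_self hr⟩, isGood_of_forall (hlO.mono Metric.isOpen_ball hsub)
      fun X hX hXo hXc hXne n hFI => ?_⟩
    have hXO := hX.trans hsub
    obtain ⟨K, hK, hind⟩ := (admitsFirstIntegrals_iff hlV).mp
      (hmax X (hXO.trans hOV) hXo hXc hXne n hFI)
    exact admitsHamiltonians_of_nondegenerate hlO hOc hL hL0 (isCompact_closedBall p r) hball
      (hX.trans Metric.ball_subset_closedBall) hXo hXc hXne
      ((admitsFirstIntegrals_iff hlO).mpr ⟨K, fun i => (hK i).mono hOV,
        indepForms_mono hlV hVc hK hind hO hOc hOV ⟨p, hp⟩⟩)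
  · have hprod : ∀ O ⊆ V, IsOpen O → ∀ L, IsKilling lam O L → ∀ u ∈ O, L 0 u * L 1 u = 0 := by
      intro O hOV hO L hL u hu
      by_contra h0
      have hev : ∀ᶠ w in 𝓝 u, w ∈ O ∧ ∀ a, L a w ≠ 0 := by
        refine (hO.eventually_mem hu).and (eventually_all.mpr fun a => ?_)
        refine ((hL.contDiff a).continuousOn.continuousAt (hO.mem_nhds hu)).eventually_ne ?_
        revert a
        exact forall_fin_two_of_ne (by decide : (0 : Fin 2) ≠ 1) (left_ne_zero_of_mul h0)
          (right_ne_zero_of_mul h0)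
      obtain ⟨r, hr, hball⟩ := Metric.eventually_nhds_iff_ball.mp hev
      exact hA ⟨Metric.ball u r, fun w hw => hOV (hball w hw).1, Metric.isOpen_ball,
        convex_ball u r, ⟨u, Metric.mem_ball_self hr⟩, L, hL.mono fun w hw => (hball w hw).1,
        fun w hw => (hball w hw).2⟩
    have hprod' : ∀ O ⊆ V, IsOpen O → ∀ L, IsKilling lam O L → ∀ i j, i ≠ j → ∀ u ∈ O,
        L i u * L j u = 0 := fun O hOV hO L hL i j hij u hu =>
      forall_ne_of_ne (p := fun i j => L i u * L j u = 0) (by decide : (0 : Fin 2) ≠ 1)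
        (hprod O hOV hO L hL u hu) (by rw [mul_comm]; exact hprod O hOV hO L hL u hu) i j hij
    by_cases hB : ∃ K, IsKilling lam V K ∧ ∃ u ∈ V, ∃ i, K i u ≠ 0
    · obtain ⟨K, hK, u, hu, i, hi⟩ := hB
      have hij := ne_rev i
      have hev : ∀ᶠ w in 𝓝 u, w ∈ V ∧ K i w ≠ 0 := (hV.eventually_mem hu).and
        (((hK.contDiff i).continuousOn.continuousAt (hV.mem_nhds hu)).eventually_ne hi)
      obtain ⟨r, hr, hball⟩ := Metric.eventually_nhds_iff_ball.mp hev
      have hsub : Metric.ball u r ⊆ V := fun w hw => (hball w hw).1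
      refine ⟨Metric.ball u r, hsub.trans hVW, Metric.isOpen_ball,
        ⟨u, Metric.mem_ball_self hr⟩, isGood_of_forall (hlV.mono Metric.isOpen_ball hsub)
        fun X hX hXo hXc hXne n hFI => ?_⟩
      have hXV := hX.trans hsub
      have hlX := hlV.mono hXo hXV
      refine admitsHamiltonians_of_degenerate hlX hXc hij (fun L hL w hw => ?_) hFI
      have hKi := (hball w (hX hw)).2
      have hKj := (mul_eq_zero.mp (hprod' V Subset.rfl hV K hK i i.rev hij w
        (hXV hw))).resolve_left hKi
      have hLL := hprod' X hXV hXo L hL i i.rev hij w hw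
      have hKL := hprod' X hXV hXo _ ((hK.mono hXV).add_smul hlX hL 1) i i.rev hij w hw
      refine (mul_eq_zero.mp ?_).resolve_left hKi
      rw [hKj] at hKL
      linear_combination hKL - hLL
    · push Not at hB
      refine ⟨V, hVW, hV, hVne, isGood_of_forall hlV fun X hX hXo hXc hXne n hFI => ?_⟩
      obtain ⟨K, hK, hind⟩ := (admitsFirstIntegrals_iff hlV).mp (hmax X hX hXo hXc hXne n hFI)
      rcases Nat.eq_zero_or_pos n with rfl | hn
      · exact admitsHamiltonians_zero
      · have := congrFun (hind (fun _ => 1) fun w hw a =>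
          Finset.sum_eq_zero fun i _ => by rw [hB _ (hK i) w hw a, mul_zero]) ⟨0, hn⟩
        exact absurd this one_ne_zero

end Generic

end Hydro

end

theorem theorem2 (U : Set Hydro.Plane) (hU : IsOpen U) (lam : Fin 2 → Hydro.Plane → ℝ)
    (hlam : ∀ a, ContDiffOn ℝ 6 (lam a) U)
    (hne : ∀ u ∈ U, lam 0 u ≠ lam 1 u)
    (hA : ∀ u ∈ U, Hydro.coefA lam u ≠ 0)
    (hB : ∀ u ∈ U, Hydro.coefB lam u ≠ 0) :
    -- on every open set, independent formulations give as many independent first integrals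
    (∀ W ⊆ U, IsOpen W → ∀ n : ℕ,
      Hydro.AdmitsHamiltonians lam W n →
        Hydro.AdmitsFirstIntegrals (Hydro.christoffel lam) W n) ∧
    -- on every convex open set, the equivalence for non-degenerate formulations
    (∀ W ⊆ U, IsOpen W → Convex ℝ W → ∀ n : ℕ,
      (Hydro.AdmitsNondegHamiltonians lam W n ↔
        Hydro.AdmitsNondegFirstIntegrals (Hydro.christoffel lam) W n)) ∧
    -- near a generic point, the equivalence for all formulations
    (∃ G ⊆ U, IsOpen G ∧ U ⊆ closure G ∧ ∀ p ∈ G, ∃ V ⊆ U, IsOpen V ∧ p ∈ V ∧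
      ∀ W ⊆ V, IsOpen W → Convex ℝ W → ∀ n : ℕ,
        (Hydro.AdmitsHamiltonians lam W n ↔
          Hydro.AdmitsFirstIntegrals (Hydro.christoffel lam) W n) ∧
        ((Hydro.AdmitsHamiltonians lam W n ∧ ¬ Hydro.AdmitsHamiltonians lam W (n + 1)) ↔
          (Hydro.AdmitsFirstIntegrals (Hydro.christoffel lam) W n ∧
            ¬ Hydro.AdmitsFirstIntegrals (Hydro.christoffel lam) W (n + 1)))) := by
  have h01 : (0 : Fin 2) ≠ 1 := by decide
  have hl : Hydro.IsDiagSystem lam U := ⟨hU, hlam,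
    fun u hu => Hydro.forall_ne_of_ne h01 (hne u hu) (hne u hu).symm,
    fun u hu => Hydro.forall_ne_of_ne h01 (hA u hu) (hB u hu)⟩
  refine ⟨fun W hWU hW n => Hydro.admitsFirstIntegrals_of_admitsHamiltonians (hl.mono hW hWU),
    fun W hWU hW hWc n => Hydro.admitsNondegHamiltonians_iff (hl.mono hW hWU) hWc,
    ⋃₀ {V | V ⊆ U ∧ IsOpen V ∧ Hydro.IsGood lam V}, ?_, ?_, ?_, ?_⟩
  · exact Set.sUnion_subset fun V hV => hV.1
  · exact isOpen_sUnion fun V hV => hV.2.1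
  · intro u hu
    refine mem_closure_iff.mpr fun O hO huO => ?_
    obtain ⟨V, hVO, hV, ⟨p, hp⟩, hgood⟩ := Hydro.exists_isGood
      (hl.mono (hO.inter hU) Set.inter_subset_right) ⟨u, huO, hu⟩
    exact ⟨p, (hVO hp).1, V, ⟨fun w hw => (hVO hw).2, hV, hgood⟩, hp⟩
  · rintro p ⟨V, ⟨hVU, hV, hgood⟩, hp⟩
    refine ⟨V, hVU, hV, hp, fun W hWV hW hWc n => ?_⟩
    have h := hgood W hWV hW hWc
    exact ⟨h n, by rw [h n, h (n + 1)]⟩
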